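/- \textbf{Conventions.} All vector spaces and Lie algebras are complex and $h$ is a formal parameter. For a complex vector space $V$ let $V[[h]]$ be the $\mathbb C[[h]]$-module of formal power series with coefficients in $V$, and $V[[h]]\,\hat\otimes\,W[[h]]=(V\otimes W)[[h]]$ the completed tensor product. Actions, coactions, coproducts, etc. are $\mathbb C[[h]]$-linear (hence $h$-adically continuous), and Hopf algebras are topological Hopf algebras with respect to $\hat\otimes$. Latin indices run over $1,2,3$, repeated Latin indices are summed, $\epsilon_{ijk}$ is totally antisymmetric with $\epsilon_{123}=1$, and $\imath^2=-1$. The Lie algebra $\mathfrak{io}(1,3)$ has basis $M_i,N_i,P_i,P_4$ and brackets $$[M_i,M_j]=\imath\epsilon_{ijk}M_k,\quad [M_i,N_j]=\imath\epsilon_{ijk}N_k,\quad [N_i,N_j]=-\imath\epsilon_{ijk}M_k,$$ $$[M_j,P_k]=\imath\epsilon_{jkl}P_l,\quad [M_j,P_4]=0,\quad [N_j,P_k]=-\imath\delta_{jk}P_4,\quad [N_j,P_4]=-\imath P_j,$$ and the $P$'s commute; $\mathfrak o(1,3)$ is the span of the $M_i,N_i$ and $\mathfrak{ab}(P_1,\dots,P_4)$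 the span of the $P$'s. Put $P^2=P_iP_i-P_4^2$, $$\sqrt{1-h^2P^2}=\sum_{n\ge 0}(-1)^n\binom{1/2}{n}h^{2n}(P^2)^n,\qquad \Xi=hP_4+\sqrt{1-h^2P^2}.$$ \textbf{Data.} Let $\mathcal H=\mathcal U_{\mathfrak o(1,3)}[[h]]$ with the primitive coproduct, and $\mathcal A=\mathcal U_{\mathfrak{ab}(P_1,\dots,P_4)}[[h]]$ with $$\Delta_\kappa(P_i)=P_i\otimes\Xi+1\otimes P_i,\qquad \Delta_\kappa(P_4)=P_4\otimes\Xi+\Xi^{-1}\otimes P_4+hP_m\Xi^{-1}\otimes P_m .$$ Let $\mathcal H$ act on $\mathcal A$ from the right by the classical action $$P_k\triangleleft M_j=-\imath\epsilon_{jkl}P_l,\quad P_4\triangleleft M_j=0,\quad P_k\triangleleft N_j=\imath\delta_{jk}P_4,\quad P_4\triangleleft N_j=\imath P_j,$$ and let $\beta_\kappa:\mathcal H\to\mathcal A\,\hat\otimes\,\mathcal H$, written $L\mapsto L^{(-1)}\otimes L^{(0)}$, be given on generators by $$\beta_\kappa(M_i)=1\otimes M_i,\qquad \beta_\kappa(N_i)=\Xi^{-1}\otimes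 N_i-h\epsilon_{ijm}P_j\Xi^{-1}\otimes M_m .$$ \textbf{Theorem.} (1) These formulas determine unique topological Hopf algebra structures on the algebras $\mathcal H$ and $\mathcal A$, a unique right $\mathcal H$-module algebra structure on $\mathcal A$, and a unique extension of $\beta_\kappa$ to $\mathcal H$ that satisfies (B) below. (2) $\beta_\kappa$ makes $\mathcal H$ a left $\mathcal A$-comodule coalgebra: $(\mathrm{id}\otimes\beta_\kappa)\beta_\kappa=(\Delta_{\mathcal A}\otimes\mathrm{id})\beta_\kappa$, $(\epsilon_{\mathcal A}\otimes\mathrm{id})\beta_\kappa=\mathrm{id}$, $L^{(-1)}\epsilon_{\mathcal H}(L^{(0)})=\epsilon_{\mathcal H}(L)1$ and $L^{(-1)}\otimes L^{(0)}{}_{(1)}\otimes L^{(0)}{}_{(2)}=L_{(1)}{}^{(-1)}L_{(2)}{}^{(-1)}\otimes L_{(1)}{}^{(0)}\otimes L_{(2)}{}^{(0)}$. (3) Majid's compatibility conditions hold for all $f\in\mathcal A$ and $L,M\in\mathcal H$: (A) $\Delta_{\mathcal A}(f\triangleleft L)=(f_{(1)}\triangleleft L_{(1)})L_{(2)}{}^{(-1)}\otimes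 f_{(2)}\triangleleft L_{(2)}{}^{(0)}$ and $\epsilon_{\mathcal A}(f\triangleleft L)=\epsilon_{\mathcal A}(f)\epsilon_{\mathcal H}(L)$; (B) $\beta_\kappa(LM)=(L^{(-1)}\triangleleft M_{(1)})M_{(2)}{}^{(-1)}\otimes L^{(0)}M_{(2)}{}^{(0)}$ and $\beta_\kappa(1)=1\otimes1$; (C) $L_{(1)}{}^{(-1)}(f\triangleleft L_{(2)})\otimes L_{(1)}{}^{(0)}=(f\triangleleft L_{(1)})L_{(2)}{}^{(-1)}\otimes L_{(2)}{}^{(0)}$. (4) The following formulas define, uniquely, a topological Hopf algebra $\mathcal H\Join\mathcal A$ on $\mathcal H\,\hat\otimes\,\mathcal A$ with unit $1\otimes1$: $(L\otimes f)(M\otimes g)=LM_{(1)}\otimes(f\triangleleft M_{(2)})g$, $\Delta(L\otimes f)=(L_{(1)}\otimes L_{(2)}{}^{(-1)}f_{(1)})\otimes(L_{(2)}{}^{(0)}\otimes f_{(2)})$, $\epsilon(L\otimes f)=\epsilon_{\mathcal H}(L)\epsilon_{\mathcal A}(f)$ and $S(L\otimes f)=(1\otimes S_{\mathcal A}(L^{(-1)}f))(S_{\mathcal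 H}(L^{(0)})\otimes1)$. (5) There is a unique topological Hopf algebra structure on the algebra $\mathcal U_{\mathfrak{io}(1,3)}[[h]]$ (the $\kappa$-Poincar\'e Hopf algebra in the classical basis) with $\Delta(P_i)$, $\Delta(P_4)$ given by the formulas for $\Delta_\kappa$ above, $$\Delta(M_i)=M_i\otimes1+1\otimes M_i,\qquad \Delta(N_i)=N_i\otimes1+\Xi^{-1}\otimes N_i-h\epsilon_{ijm}P_j\Xi^{-1}\otimes M_m,$$ counit vanishing on $\mathfrak{io}(1,3)$, and antipode $$S(M_i)=-M_i,\quad S(N_i)=-\Xi N_i-h\epsilon_{ijm}P_jM_m,\quad S(P_i)=-P_i\Xi^{-1},\quad S(P_4)=-P_4+hP_iP_i\Xi^{-1}.$$ There is an isomorphism of topological Hopf algebras from it onto $\mathcal H\Join\mathcal A$ with $M_i\mapsto M_i\otimes1$, $N_i\mapsto N_i\otimes1$, $P_i\mapsto1\otimes P_i$ and $P_4\mapsto1\otimes P_4$. -/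

import Mathlib

open scoped TensorProduct
open Finset.HasAntidiagonal (antidiagonal)

noncomputable section

namespace KappaPoincare

/-! ### Topologically free modules over formal power series -/

/-- The ring of formal power series in the deformation parameter `h`. -/
abbrev K : Type := PowerSeries ℂ

/-- `Ser V` is the `h`-adic extension `V[[h]]` of a complex vector space `V`: the formal power
series with coefficient `v.coeff n` in `V` at `h ^ n`. Every `K`-linear map between such modules is
continuous for the `h`-adic topologies, so `→ₗ[K]` is the right notion of morphism. -/
@[ext]
structure Ser (V : Type) where
  coeff : ℕ → V

namespace Ser

section Basics

variable {V W V' W' : Type} [AddCommGroup V] [Module ℂ V] [AddCommGroup W] [Module ℂ W]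
  [AddCommGroup V'] [Module ℂ V'] [AddCommGroup W'] [Module ℂ W']

theorem coeff_injective {V : Type} : Function.Injective (coeff : Ser V → ℕ → V) :=
  fun _ _ e => Ser.ext e

instance {V : Type} [AddCommGroup V] : Zero (Ser V) := ⟨⟨0⟩⟩
instance {V : Type} [AddCommGroup V] : Add (Ser V) := ⟨fun v w => ⟨v.coeff + w.coeff⟩⟩
instance {V : Type} [AddCommGroup V] : Neg (Ser V) := ⟨fun v => ⟨-v.coeff⟩⟩
instance {V : Type} [AddCommGroup V] : Sub (Ser V) := ⟨fun v w => ⟨v.coeff - w.coeff⟩⟩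
instance {V R : Type} [SMul R V] : SMul R (Ser V) := ⟨fun c v => ⟨c • v.coeff⟩⟩

instance {V : Type} [AddCommGroup V] : AddCommGroup (Ser V) :=
  coeff_injective.addCommGroup coeff rfl (fun _ _ => rfl) (fun _ => rfl) (fun _ _ => rfl)
    (fun _ _ => rfl) (fun _ _ => rfl)

/-- The additive map which forgets the structure of a series. -/
def coeffHom {V : Type} [AddCommGroup V] : Ser V →+ (ℕ → V) where
  toFun := coeff
  map_zero' := rfl
  map_add' _ _ := rfl

instance : Module ℂ (Ser V) := coeff_injective.module ℂ coeffHom (fun _ _ => rfl)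

@[simp] theorem coeff_add {V : Type} [AddCommGroup V] (v w : Ser V) (n : ℕ) : (v + w).coeff n = v.coeff n + w.coeff n := rfl

@[simp] theorem coeff_zero {V : Type} [AddCommGroup V] (n : ℕ) : (0 : Ser V).coeff n = 0 := rfl

@[simp] theorem coeff_csmul (c : ℂ) (v : Ser V) (n : ℕ) : (c • v).coeff n = c • v.coeff n := rfl

theorem coeff_sum {V ι : Type} [AddCommGroup V] (s : Finset ι) (f : ι → Ser V) (n : ℕ) :
    (∑ x ∈ s, f x).coeff n = ∑ x ∈ s, (f x).coeff n := by
  have := congrFun (map_sum (coeffHom (V := V)) f s) n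
  rw [Finset.sum_apply] at this
  exact this

theorem sum_triple {B : Type} [AddCommGroup B] (n : ℕ) (f : ℕ → ℕ → ℕ → B) :
    ∑ ij ∈ antidiagonal n, ∑ kl ∈ antidiagonal ij.1, f kl.1 kl.2 ij.2 =
      ∑ ij ∈ antidiagonal n, ∑ kl ∈ antidiagonal ij.2, f ij.1 kl.1 kl.2 := by
  simp only [Finset.sum_sigma']
  apply Finset.sum_nbij' (fun ⟨⟨_i, j⟩, ⟨k, l⟩⟩ ↦ ⟨(k, l + j), (l, j)⟩)
    (fun ⟨⟨i, _j⟩, ⟨k, l⟩⟩ ↦ ⟨(i + k, l), (i, k)⟩)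
  · rintro ⟨⟨i, j⟩, ⟨k, l⟩⟩ hx
    simp only [Finset.mem_sigma, Finset.HasAntidiagonal.mem_antidiagonal] at hx
    obtain ⟨rfl, rfl⟩ := hx
    simp [add_assoc]
  · rintro ⟨⟨i, j⟩, ⟨k, l⟩⟩ hx
    simp only [Finset.mem_sigma, Finset.HasAntidiagonal.mem_antidiagonal] at hx
    obtain ⟨rfl, rfl⟩ := hx
    simp [add_assoc]
  · rintro ⟨⟨i, j⟩, ⟨k, l⟩⟩ hx
    simp only [Finset.mem_sigma, Finset.HasAntidiagonal.mem_antidiagonal] at hx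
    obtain ⟨_, rfl⟩ := hx
    rfl
  · rintro ⟨⟨i, j⟩, ⟨k, l⟩⟩ hx
    simp only [Finset.mem_sigma, Finset.HasAntidiagonal.mem_antidiagonal] at hx
    obtain ⟨_, rfl⟩ := hx
    rfl
  · rintro ⟨⟨i, j⟩, ⟨k, l⟩⟩ hx
    rfl

/-- Multiplication of a vector-valued series by a scalar-valued one (Cauchy product). -/
instance : SMul K (Ser V) where
  smul a v := ⟨fun n => ∑ ij ∈ antidiagonal n, PowerSeries.coeff ij.1 a • v.coeff ij.2⟩

theorem coeff_smul (a : K) (v : Ser V) (n : ℕ) : (a • v).coeff n =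
    ∑ ij ∈ antidiagonal n, PowerSeries.coeff ij.1 a • v.coeff ij.2 := rfl

theorem C_smul (c : ℂ) (v : Ser V) : (PowerSeries.C c : K) • v = c • v := by
  ext n
  rw [coeff_smul, Finset.sum_eq_single (0, n)]
  · simp
  · rintro ⟨i, j⟩ hij hne
    have hi : i ≠ 0 := by
      rintro rfl
      apply hne
      simpa using hij
    simp [PowerSeries.coeff_C, hi]
  · intro hn
    simp at hn

instance : Module K (Ser V) where
  one_smul v := by
    have := C_smul (1 : ℂ) v
    simpa using this
  mul_smul a b v := by
    ext n
    simp only [coeff_smul, PowerSeries.coeff_mul, Finset.sum_smul, Finset.smul_sum, mul_smul]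
    exact sum_triple n
      (fun i j k => PowerSeries.coeff i a • PowerSeries.coeff j b • v.coeff k)
  smul_zero a := by ext n; simp [coeff_smul]
  smul_add a v w := by ext n; simp [coeff_smul, Finset.sum_add_distrib]
  add_smul a b v := by ext n; simp [coeff_smul, add_smul, Finset.sum_add_distrib]
  zero_smul v := by ext n; simp [coeff_smul]

/-- A vector, seen as a constant series. -/
def const : V →ₗ[ℂ] Ser V where
  toFun v := ⟨fun n => if n = 0 then v else 0⟩
  map_add' v w := by ext n; by_cases hn : n = 0 <;> simp [hn]
  map_smul' c v := by ext n; by_cases hn : n = 0 <;> simp [hn]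

/-- The unique `K`-linear (hence `h`-adically continuous) map `V[[h]] → W[[h]]` which extends a
given complex linear map `V → W[[h]]`. -/
def extend (φ : V →ₗ[ℂ] Ser W) : Ser V →ₗ[K] Ser W where
  toFun v := ⟨fun n => ∑ ij ∈ antidiagonal n, (φ (v.coeff ij.1)).coeff ij.2⟩
  map_add' v w := by ext n; simp [Finset.sum_add_distrib]
  map_smul' a v := by
    ext n
    simp only [coeff_smul, RingHom.id_apply, map_sum, map_smul, Finset.smul_sum, coeff_sum,
      coeff_csmul]
    exact sum_triple n
      (fun i j k => PowerSeries.coeff i a • (φ (v.coeff j)).coeff k)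

/-- The coefficientwise extension `V[[h]] → W[[h]]` of a complex linear map `V → W`. -/
def coeffwise (f : V →ₗ[ℂ] W) : Ser V →ₗ[K] Ser W := extend (const ∘ₗ f)

/-- The tensor product of two series, as an element of the completed tensor product
`V[[h]] ⊗̂ W[[h]] = (V ⊗ W)[[h]]`. -/
def tmul (v : Ser V) (w : Ser W) : Ser (V ⊗[ℂ] W) :=
  ⟨fun n => ∑ ij ∈ antidiagonal n, v.coeff ij.1 ⊗ₜ[ℂ] w.coeff ij.2⟩

/-- The map `v ↦ v ⊗ w`. -/
def tmulRight (w : Ser W) : Ser V →ₗ[K] Ser (V ⊗[ℂ] W) where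
  toFun v := tmul v w
  map_add' v v' := by ext n; simp [tmul, TensorProduct.add_tmul, Finset.sum_add_distrib]
  map_smul' a v := by
    ext n
    simp only [tmul, coeff_smul, RingHom.id_apply, TensorProduct.sum_tmul, Finset.smul_sum,
      ← TensorProduct.smul_tmul']
    exact sum_triple n (fun i j k => PowerSeries.coeff i a • (v.coeff j ⊗ₜ[ℂ] w.coeff k))

/-- The map `w ↦ v ⊗ w`. -/
def tmulLeft (v : Ser V) : Ser W →ₗ[K] Ser (V ⊗[ℂ] W) where
  toFun w := tmul v w
  map_add' w w' := by ext n; simp [tmul, TensorProduct.tmul_add, Finset.sum_add_distrib]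
  map_smul' a w := by
    ext n
    simp only [tmul, coeff_smul, RingHom.id_apply, TensorProduct.tmul_sum, Finset.smul_sum,
      TensorProduct.tmul_smul]
    rw [← sum_triple n (fun j i k => PowerSeries.coeff i a • (v.coeff j ⊗ₜ[ℂ] w.coeff k)),
      ← sum_triple n (fun i j k => PowerSeries.coeff i a • (v.coeff j ⊗ₜ[ℂ] w.coeff k))]
    refine Finset.sum_congr rfl fun ij _ => ?_
    exact (Finset.Nat.sum_antidiagonal_swap (n := ij.1)
      (f := fun kl => PowerSeries.coeff kl.2 a • (v.coeff kl.1 ⊗ₜ[ℂ] w.coeff ij.2))).symm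

/-- The completed tensor product `f ⊗̂ g` of two `K`-linear maps; it sends `v ⊗ w` to
`f v ⊗ g w`. -/
def tmap (f : Ser V →ₗ[K] Ser V') (g : Ser W →ₗ[K] Ser W') :
    Ser (V ⊗[ℂ] W) →ₗ[K] Ser (V' ⊗[ℂ] W') :=
  extend (TensorProduct.lift (LinearMap.mk₂ ℂ (fun v w => tmul (f (const v)) (g (const w)))
    (fun v v' w => by ext n; simp [tmul, TensorProduct.add_tmul, Finset.sum_add_distrib])
    (fun c v w => by
      ext n
      rw [map_smul const, ← C_smul c (const v), map_smul f, C_smul]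
      simp [tmul, TensorProduct.smul_tmul', Finset.smul_sum])
    (fun v w w' => by ext n; simp [tmul, TensorProduct.tmul_add, Finset.sum_add_distrib])
    (fun c v w => by
      ext n
      rw [map_smul const, ← C_smul c (const w), map_smul g, C_smul]
      simp [tmul, Finset.smul_sum])))

/-- An ordinary power series with coefficients in a ring `U`, seen as an element of `U[[h]]`. -/
def ofPS {U : Type} [Ring U] (f : PowerSeries U) : Ser U := ⟨fun n => PowerSeries.coeff n f⟩

end Basics

end Ser

open Ser

/-! ### Topological Hopf algebras and bicrossproducts -/

section Hopf

variable {V W : Type} [AddCommGroup V] [Module ℂ V] [AddCommGroup W] [Module ℂ W]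

/-- A topological Hopf algebra structure over `K` on the topologically free module `V[[h]]`. -/
structure HopfStr (V : Type) [AddCommGroup V] [Module ℂ V] where
  mul : Ser (V ⊗[ℂ] V) →ₗ[K] Ser V
  one : Ser V
  comul : Ser V →ₗ[K] Ser (V ⊗[ℂ] V)
  counit : Ser V →ₗ[K] Ser ℂ
  antipode : Ser V →ₗ[K] Ser V
  mul_assoc : mul ∘ₗ tmap mul LinearMap.id =
    mul ∘ₗ tmap LinearMap.id mul ∘ₗ coeffwise (TensorProduct.assoc ℂ V V V).toLinearMap
  one_mul : ∀ v, mul (tmul one v) = v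
  mul_one : ∀ v, mul (tmul v one) = v
  coassoc : coeffwise (TensorProduct.assoc ℂ V V V).toLinearMap ∘ₗ
    tmap comul LinearMap.id ∘ₗ comul = tmap LinearMap.id comul ∘ₗ comul
  counit_comul : coeffwise (TensorProduct.lid ℂ V).toLinearMap ∘ₗ
    tmap counit LinearMap.id ∘ₗ comul = LinearMap.id
  comul_counit : coeffwise (TensorProduct.rid ℂ V).toLinearMap ∘ₗ
    tmap LinearMap.id counit ∘ₗ comul = LinearMap.id
  comul_mul : comul ∘ₗ mul = tmap mul mul ∘ₗ
    coeffwise (TensorProduct.tensorTensorTensorComm ℂ V V V V).toLinearMap ∘ₗ tmap comul comul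
  comul_one : comul one = tmul one one
  counit_mul : counit ∘ₗ mul = coeffwise (LinearMap.mul' ℂ ℂ) ∘ₗ tmap counit counit
  counit_one : counit one = const 1
  antipode_left : ∀ v, mul (tmap antipode LinearMap.id (comul v)) =
    coeffwise (TensorProduct.lid ℂ V).toLinearMap (tmul (counit v) one)
  antipode_right : ∀ v, mul (tmap LinearMap.id antipode (comul v)) =
    coeffwise (TensorProduct.lid ℂ V).toLinearMap (tmul (counit v) one)

/-- `Φ` is an isomorphism of topological Hopf algebras. -/
structure IsHopfIso (𝒱 : HopfStr V) (𝒲 : HopfStr W) (Φ : Ser V ≃ₗ[K] Ser W) : Prop where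
  map_mul : Φ.toLinearMap ∘ₗ 𝒱.mul = 𝒲.mul ∘ₗ tmap Φ.toLinearMap Φ.toLinearMap
  map_one : Φ 𝒱.one = 𝒲.one
  map_comul : 𝒲.comul ∘ₗ Φ.toLinearMap = tmap Φ.toLinearMap Φ.toLinearMap ∘ₗ 𝒱.comul
  map_counit : 𝒲.counit ∘ₗ Φ.toLinearMap = 𝒱.counit
  map_antipode : 𝒲.antipode ∘ₗ Φ.toLinearMap = Φ.toLinearMap ∘ₗ 𝒱.antipode

/-- The underlying topological algebra of `𝒰` is `U[[h]]` with the product of `U`. -/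
def HasClassicalProduct {U : Type} [Ring U] [Algebra ℂ U] (𝒰 : HopfStr U) : Prop :=
  𝒰.mul = coeffwise (LinearMap.mul' ℂ U) ∧ 𝒰.one = const 1

variable {H A : Type} [AddCommGroup H] [Module ℂ H] [AddCommGroup A] [Module ℂ A]

/-- `(x ⊗ y) ⊗ (z ⊗ (a ⊗ w)) ↦ ((x ⊗ z) ⊗ a) ⊗ (y ⊗ w)`. -/
def shuffle (X Y Z A W : Type) [AddCommGroup X] [Module ℂ X] [AddCommGroup Y] [Module ℂ Y]
    [AddCommGroup Z] [Module ℂ Z] [AddCommGroup A] [Module ℂ A] [AddCommGroup W] [Module ℂ W] :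
    ((X ⊗[ℂ] Y) ⊗[ℂ] (Z ⊗[ℂ] (A ⊗[ℂ] W))) ≃ₗ[ℂ] (((X ⊗[ℂ] Z) ⊗[ℂ] A) ⊗[ℂ] (Y ⊗[ℂ] W)) :=
  TensorProduct.tensorTensorTensorComm ℂ X Y Z (A ⊗[ℂ] W) ≪≫ₗ
    TensorProduct.congr (LinearEquiv.refl ℂ (X ⊗[ℂ] Z)) (TensorProduct.leftComm ℂ Y A W) ≪≫ₗ
    (TensorProduct.assoc ℂ (X ⊗[ℂ] Z) A (Y ⊗[ℂ] W)).symm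

/-- The map `act : f ⊗ L ↦ f ◁ L` makes `A[[h]]` a right `H[[h]]`-module algebra:
`(f ◁ L) ◁ M = f ◁ (L M)`, `f ◁ 1 = f`, `(f g) ◁ L = (f ◁ L₁) (g ◁ L₂)`, `1 ◁ L = ε(L) 1`. -/
structure IsRightModuleAlgebra (ℋ : HopfStr H) (𝒜 : HopfStr A)
    (act : Ser (A ⊗[ℂ] H) →ₗ[K] Ser A) : Prop where
  act_act : ∀ f L M, act (tmul (act (tmul f L)) M) = act (tmul f (ℋ.mul (tmul L M)))
  act_one : ∀ f, act (tmul f ℋ.one) = f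
  mul_act : ∀ f g L, act (tmul (𝒜.mul (tmul f g)) L) = 𝒜.mul (tmap act act
    (coeffwise (TensorProduct.tensorTensorTensorComm ℂ A A H H).toLinearMap
      (tmul (tmul f g) (ℋ.comul L))))
  one_act : ∀ L, act (tmul 𝒜.one L) =
    coeffwise (TensorProduct.lid ℂ A).toLinearMap (tmul (ℋ.counit L) 𝒜.one)

/-- The map `β`, written `L ↦ L⁽⁻¹⁾ ⊗ L⁽⁰⁾`, makes `H[[h]]` a left `A[[h]]`-comodule coalgebra:
`(id ⊗ β) β = (Δ ⊗ id) β`, `(ε ⊗ id) β = id`, `L⁽⁻¹⁾ ε(L⁽⁰⁾) = ε(L) 1`, and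
`L⁽⁻¹⁾ ⊗ L⁽⁰⁾₁ ⊗ L⁽⁰⁾₂ = L₁⁽⁻¹⁾ L₂⁽⁻¹⁾ ⊗ L₁⁽⁰⁾ ⊗ L₂⁽⁰⁾`. -/
structure IsLeftComoduleCoalgebra (ℋ : HopfStr H) (𝒜 : HopfStr A)
    (β : Ser H →ₗ[K] Ser (A ⊗[ℂ] H)) : Prop where
  coassoc : tmap LinearMap.id β ∘ₗ β = coeffwise (TensorProduct.assoc ℂ A A H).toLinearMap ∘ₗ
    tmap 𝒜.comul LinearMap.id ∘ₗ β
  counit_coact : coeffwise (TensorProduct.lid ℂ H).toLinearMap ∘ₗ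
    tmap 𝒜.counit LinearMap.id ∘ₗ β = LinearMap.id
  coact_counit : ∀ L, coeffwise (TensorProduct.rid ℂ A).toLinearMap
    (tmap LinearMap.id ℋ.counit (β L)) =
      coeffwise (TensorProduct.lid ℂ A).toLinearMap (tmul (ℋ.counit L) 𝒜.one)
  coact_comul : tmap LinearMap.id ℋ.comul ∘ₗ β = tmap 𝒜.mul LinearMap.id ∘ₗ
    coeffwise (TensorProduct.tensorTensorTensorComm ℂ A H A H).toLinearMap ∘ₗ
      tmap β β ∘ₗ ℋ.comul

/-- The compatibility of `β` with products and with the unit (the conditions (B)):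
`β(L M) = (L⁽⁻¹⁾ ◁ M₁) M₂⁽⁻¹⁾ ⊗ L⁽⁰⁾ M₂⁽⁰⁾` and `β(1) = 1 ⊗ 1`. -/
structure IsMultiplicativeCoaction (ℋ : HopfStr H) (𝒜 : HopfStr A)
    (act : Ser (A ⊗[ℂ] H) →ₗ[K] Ser A) (β : Ser H →ₗ[K] Ser (A ⊗[ℂ] H)) : Prop where
  coact_mul : ∀ L M, β (ℋ.mul (tmul L M)) =
    tmap (𝒜.mul ∘ₗ tmap act LinearMap.id) ℋ.mul (coeffwise (shuffle A H H A H).toLinearMap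
      (tmul (β L) (tmap LinearMap.id β (ℋ.comul M))))
  coact_one : β ℋ.one = tmul 𝒜.one ℋ.one

/-- Majid's compatibility conditions (A), (B), (C) between an action and a coaction. -/
structure MajidCompatible (ℋ : HopfStr H) (𝒜 : HopfStr A)
    (act : Ser (A ⊗[ℂ] H) →ₗ[K] Ser A) (β : Ser H →ₗ[K] Ser (A ⊗[ℂ] H)) : Prop
    extends IsMultiplicativeCoaction ℋ 𝒜 act β where
  /-- `Δ(f ◁ L) = (f₁ ◁ L₁) L₂⁽⁻¹⁾ ⊗ (f₂ ◁ L₂⁽⁰⁾)` -/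
  comul_act : ∀ f L, 𝒜.comul (act (tmul f L)) =
    tmap (𝒜.mul ∘ₗ tmap act LinearMap.id) act (coeffwise (shuffle A A H A H).toLinearMap
      (tmul (𝒜.comul f) (tmap LinearMap.id β (ℋ.comul L))))
  /-- `ε(f ◁ L) = ε(f) ε(L)` -/
  counit_act : ∀ f L, 𝒜.counit (act (tmul f L)) =
    coeffwise (LinearMap.mul' ℂ ℂ) (tmul (𝒜.counit f) (ℋ.counit L))
  /-- `L₁⁽⁻¹⁾ (f ◁ L₂) ⊗ L₁⁽⁰⁾ = (f ◁ L₁) L₂⁽⁻¹⁾ ⊗ L₂⁽⁰⁾` -/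
  coact_act : ∀ f L,
    tmap 𝒜.mul LinearMap.id (coeffwise (TensorProduct.rightComm ℂ A H A).toLinearMap
      (tmap LinearMap.id act (coeffwise (TensorProduct.leftComm ℂ A (A ⊗[ℂ] H) H).toLinearMap
        (tmul f (tmap β LinearMap.id (ℋ.comul L)))))) =
    tmap 𝒜.mul LinearMap.id (coeffwise (TensorProduct.assoc ℂ A A H).symm.toLinearMap
      (tmap act LinearMap.id (coeffwise (TensorProduct.assoc ℂ A H (A ⊗[ℂ] H)).symm.toLinearMap
        (tmul f (tmap LinearMap.id β (ℋ.comul L))))))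

/-- `ℬ` is the bicrossproduct Hopf algebra on `H[[h]] ⊗̂ A[[h]]` built from `act` and `β`. -/
structure IsBicrossproduct (ℋ : HopfStr H) (𝒜 : HopfStr A)
    (act : Ser (A ⊗[ℂ] H) →ₗ[K] Ser A) (β : Ser H →ₗ[K] Ser (A ⊗[ℂ] H))
    (ℬ : HopfStr (H ⊗[ℂ] A)) : Prop where
  /-- `(L ⊗ f) (M ⊗ g) = L M₁ ⊗ (f ◁ M₂) g` -/
  mul_eq : ∀ L f M g, ℬ.mul (tmul (tmul L f) (tmul M g)) =
    tmap LinearMap.id 𝒜.mul (coeffwise (TensorProduct.assoc ℂ H A A).toLinearMap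
      (tmul (tmap ℋ.mul act
        (coeffwise (TensorProduct.tensorTensorTensorComm ℂ H A H H).toLinearMap
          (tmul (tmul L f) (ℋ.comul M)))) g))
  one_eq : ℬ.one = tmul ℋ.one 𝒜.one
  /-- `Δ(L ⊗ f) = (L₁ ⊗ L₂⁽⁻¹⁾ f₁) ⊗ (L₂⁽⁰⁾ ⊗ f₂)` -/
  comul_eq : ∀ L f, ℬ.comul (tmul L f) =
    tmap (tmap LinearMap.id 𝒜.mul ∘ₗ coeffwise (TensorProduct.assoc ℂ H A A).toLinearMap)
      LinearMap.id
      (coeffwise (TensorProduct.tensorTensorTensorComm ℂ (H ⊗[ℂ] A) H A A).toLinearMap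
        (tmul (coeffwise (TensorProduct.assoc ℂ H A H).symm.toLinearMap
          (tmap LinearMap.id β (ℋ.comul L))) (𝒜.comul f)))
  /-- `ε(L ⊗ f) = ε(L) ε(f)` -/
  counit_eq : ∀ L f, ℬ.counit (tmul L f) =
    coeffwise (LinearMap.mul' ℂ ℂ) (tmul (ℋ.counit L) (𝒜.counit f))
  /-- `S(L ⊗ f) = (1 ⊗ S(L⁽⁻¹⁾ f)) (S(L⁽⁰⁾) ⊗ 1)` -/
  antipode_eq : ∀ L f, ℬ.antipode (tmul L f) =
    ℬ.mul (tmap (tmulLeft ℋ.one ∘ₗ 𝒜.antipode ∘ₗ 𝒜.mul) (tmulRight 𝒜.one ∘ₗ ℋ.antipode)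
      (coeffwise (TensorProduct.rightComm ℂ A H A).toLinearMap (tmul (β L) f)))

end Hopf

/-! ### The Lie algebras -/

/-- The totally antisymmetric symbol, with value `1` at `(1, 2, 3)`. -/
def eps (i j k : Fin 3) : ℂ :=
  ((i.val : ℂ) - j.val) * ((j.val : ℂ) - k.val) * ((k.val : ℂ) - i.val) / 2

/-- The (complexified) Lorentz Lie algebra `o(1,3)`: the element with components `m`, `n` is
`∑ i, (m i • M i + n i • N i)`. -/
@[ext]
structure Lorentz : Type where
  m : Fin 3 → ℂ
  n : Fin 3 → ℂ

namespace Lorentz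

/-- The components of an element. -/
def toProd (x : Lorentz) : (Fin 3 → ℂ) × (Fin 3 → ℂ) := (x.m, x.n)

theorem toProd_injective : Function.Injective toProd := fun x y e => by
  simpa [toProd, Lorentz.ext_iff] using e

instance : Zero Lorentz := ⟨⟨0, 0⟩⟩
instance : Add Lorentz := ⟨fun x y => ⟨x.m + y.m, x.n + y.n⟩⟩
instance : Neg Lorentz := ⟨fun x => ⟨-x.m, -x.n⟩⟩
instance : Sub Lorentz := ⟨fun x y => ⟨x.m - y.m, x.n - y.n⟩⟩
instance {R : Type} [SMul R ℂ] : SMul R Lorentz := ⟨fun c x => ⟨c • x.m, c • x.n⟩⟩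

instance : AddCommGroup Lorentz :=
  toProd_injective.addCommGroup toProd rfl (fun _ _ => rfl) (fun _ => rfl) (fun _ _ => rfl)
    (fun _ _ => rfl) (fun _ _ => rfl)

instance : Module ℂ Lorentz :=
  toProd_injective.module ℂ ⟨⟨toProd, rfl⟩, fun _ _ => rfl⟩ (fun _ _ => rfl)

/-- `[M i, M j] = √-1 ε i j k M k`, `[M i, N j] = √-1 ε i j k N k`,
`[N i, N j] = - √-1 ε i j k M k`. -/
instance : Bracket Lorentz Lorentz where
  bracket x y :=
    { m := fun k => Complex.I * ∑ i, ∑ j, eps i j k * (x.m i * y.m j - x.n i * y.n j)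
      n := fun k => Complex.I * ∑ i, ∑ j, eps i j k * (x.m i * y.n j + x.n i * y.m j) }

theorem bracket_m (x y : Lorentz) (k : Fin 3) : ⁅x, y⁆.m k =
    Complex.I * ∑ i, ∑ j, eps i j k * (x.m i * y.m j - x.n i * y.n j) := rfl
theorem bracket_n (x y : Lorentz) (k : Fin 3) : ⁅x, y⁆.n k =
    Complex.I * ∑ i, ∑ j, eps i j k * (x.m i * y.n j + x.n i * y.m j) := rfl

theorem sum_eps (k : Fin 3) (f : Fin 3 → Fin 3 → ℂ) :
    ∑ i, ∑ j, eps i j k * f i j = f (k + 1) (k + 2) - f (k + 2) (k + 1) := by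
  fin_cases k <;> simp [Fin.sum_univ_three, eps] <;> ring

@[simp] theorem add_m (x y : Lorentz) (i : Fin 3) : (x + y).m i = x.m i + y.m i := rfl
@[simp] theorem add_n (x y : Lorentz) (i : Fin 3) : (x + y).n i = x.n i + y.n i := rfl
@[simp] theorem zero_m (i : Fin 3) : (0 : Lorentz).m i = 0 := rfl
@[simp] theorem zero_n (i : Fin 3) : (0 : Lorentz).n i = 0 := rfl
@[simp] theorem smul_m (c : ℂ) (x : Lorentz) (i : Fin 3) : (c • x).m i = c * x.m i := rfl
@[simp] theorem smul_n (c : ℂ) (x : Lorentz) (i : Fin 3) : (c • x).n i = c * x.n i := rfl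

instance : LieRing Lorentz where
  add_lie x y z := by
    ext k <;> simp only [bracket_m, bracket_n, sum_eps, add_m, add_n] <;> ring
  lie_add x y z := by
    ext k <;> simp only [bracket_m, bracket_n, sum_eps, add_m, add_n] <;> ring
  lie_self x := by
    ext k <;> simp only [bracket_m, bracket_n, sum_eps, zero_m, zero_n] <;> ring
  leibniz_lie x y z := by
    ext k <;> fin_cases k <;> simp [bracket_m, bracket_n, sum_eps] <;> ring

instance : LieAlgebra ℂ Lorentz where
  lie_smul c x y := by
    ext k <;> simp only [bracket_m, bracket_n, sum_eps, smul_m, smul_n] <;> ring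

/-- The generators of rotations. -/
def M (i : Fin 3) : Lorentz := ⟨Pi.single i 1, 0⟩

/-- The generators of boosts. -/
def N (i : Fin 3) : Lorentz := ⟨0, Pi.single i 1⟩

end Lorentz

/-- The four-dimensional abelian Lie algebra `ab(P₁, P₂, P₃, P₄)`: the element with components `p`
and `t` is `∑ i, p i • P i + t • P₄`. -/
@[ext]
structure Translations : Type where
  p : Fin 3 → ℂ
  t : ℂ

namespace Translations

/-- The components of an element. -/
def toProd (x : Translations) : (Fin 3 → ℂ) × ℂ := (x.p, x.t)

theorem toProd_injective : Function.Injective toProd := fun x y e => by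
  simpa [toProd, Translations.ext_iff] using e

instance : Zero Translations := ⟨⟨0, 0⟩⟩
instance : Add Translations := ⟨fun x y => ⟨x.p + y.p, x.t + y.t⟩⟩
instance : Neg Translations := ⟨fun x => ⟨-x.p, -x.t⟩⟩
instance : Sub Translations := ⟨fun x y => ⟨x.p - y.p, x.t - y.t⟩⟩
instance {R : Type} [SMul R ℂ] : SMul R Translations := ⟨fun c x => ⟨c • x.p, c • x.t⟩⟩

instance : AddCommGroup Translations :=
  toProd_injective.addCommGroup toProd rfl (fun _ _ => rfl) (fun _ => rfl) (fun _ _ => rfl)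
    (fun _ _ => rfl) (fun _ _ => rfl)

instance : Module ℂ Translations :=
  toProd_injective.module ℂ ⟨⟨toProd, rfl⟩, fun _ _ => rfl⟩ (fun _ _ => rfl)

instance : LieRing Translations where
  bracket _ _ := 0
  add_lie _ _ _ := (add_zero _).symm
  lie_add _ _ _ := (add_zero _).symm
  lie_self _ := rfl
  leibniz_lie _ _ _ := (add_zero _).symm

instance : LieAlgebra ℂ Translations where
  lie_smul c _ _ := (smul_zero c).symm

/-- The momenta `P₁, P₂, P₃`. -/
def P (i : Fin 3) : Translations := ⟨Pi.single i 1, 0⟩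

/-- The energy `P₄`. -/
def P4 : Translations := ⟨0, 1⟩

end Translations

/-- The (complexified) Poincaré Lie algebra `io(1,3)`: the element with components `x`, `p`, `t` is
`x + ∑ i, p i • P i + t • P₄`, with `x` in `o(1,3)`. -/
@[ext]
structure Poincare : Type where
  x : Lorentz
  p : Fin 3 → ℂ
  t : ℂ

namespace Poincare

/-- The components of an element. -/
def toProd (x : Poincare) : Lorentz × (Fin 3 → ℂ) × ℂ := (x.x, x.p, x.t)

theorem toProd_injective : Function.Injective toProd := fun x y e => by
  simpa [toProd, Poincare.ext_iff] using e

instance : Zero Poincare := ⟨⟨0, 0, 0⟩⟩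
instance : Add Poincare := ⟨fun x y => ⟨x.x + y.x, x.p + y.p, x.t + y.t⟩⟩
instance : Neg Poincare := ⟨fun x => ⟨-x.x, -x.p, -x.t⟩⟩
instance : Sub Poincare := ⟨fun x y => ⟨x.x - y.x, x.p - y.p, x.t - y.t⟩⟩
instance {R : Type} [SMul R ℂ] : SMul R Poincare := ⟨fun c x => ⟨c • x.x, c • x.p, c • x.t⟩⟩

instance : AddCommGroup Poincare :=
  toProd_injective.addCommGroup toProd rfl (fun _ _ => rfl) (fun _ => rfl) (fun _ _ => rfl)
    (fun _ _ => rfl) (fun _ _ => rfl)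

instance : Module ℂ Poincare :=
  toProd_injective.module ℂ ⟨⟨toProd, rfl⟩, fun _ _ => rfl⟩ (fun _ _ => rfl)

/-- The brackets of `o(1,3)`, together with `[M j, P k] = √-1 ε j k l P l`, `[M j, P₄] = 0`,
`[N j, P k] = - √-1 δ j k P₄`, `[N j, P₄] = - √-1 P j` and `[P μ, P ν] = 0`. -/
instance : Bracket Poincare Poincare where
  bracket a b :=
    { x := ⁅a.x, b.x⁆
      p := fun l => Complex.I * ∑ j, ∑ k, eps j k l * (a.x.m j * b.p k + a.p j * b.x.m k) -
        Complex.I * (a.x.n l * b.t - a.t * b.x.n l)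
      t := -Complex.I * ∑ j, (a.x.n j * b.p j - a.p j * b.x.n j) }

theorem bracket_x (a b : Poincare) : ⁅a, b⁆.x = ⁅a.x, b.x⁆ := rfl
theorem bracket_p (a b : Poincare) (l : Fin 3) : ⁅a, b⁆.p l =
    Complex.I * ∑ j, ∑ k, eps j k l * (a.x.m j * b.p k + a.p j * b.x.m k) -
      Complex.I * (a.x.n l * b.t - a.t * b.x.n l) := rfl
theorem bracket_t (a b : Poincare) : ⁅a, b⁆.t =
    -Complex.I * ∑ j, (a.x.n j * b.p j - a.p j * b.x.n j) := rfl

@[simp] theorem add_x (x y : Poincare) : (x + y).x = x.x + y.x := rfl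
@[simp] theorem add_p (x y : Poincare) (i : Fin 3) : (x + y).p i = x.p i + y.p i := rfl
@[simp] theorem add_t (x y : Poincare) : (x + y).t = x.t + y.t := rfl
@[simp] theorem zero_x : (0 : Poincare).x = 0 := rfl
@[simp] theorem zero_p (i : Fin 3) : (0 : Poincare).p i = 0 := rfl
@[simp] theorem zero_t : (0 : Poincare).t = 0 := rfl
@[simp] theorem smul_x (c : ℂ) (x : Poincare) : (c • x).x = c • x.x := rfl
@[simp] theorem smul_p (c : ℂ) (x : Poincare) (i : Fin 3) : (c • x).p i = c * x.p i := rfl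
@[simp] theorem smul_t (c : ℂ) (x : Poincare) : (c • x).t = c * x.t := rfl

theorem ext' {a b : Poincare} (hx : a.x = b.x) (hp : ∀ l, a.p l = b.p l) (ht : a.t = b.t) :
    a = b := Poincare.ext hx (funext hp) ht

instance : LieRing Poincare where
  add_lie a b c := by
    refine ext' (by simp [bracket_x]) (fun l => ?_) ?_
    · simp [bracket_p, Lorentz.sum_eps]; ring
    · simp [bracket_t, Fin.sum_univ_three]; ring
  lie_add a b c := by
    refine ext' (by simp [bracket_x]) (fun l => ?_) ?_
    · simp [bracket_p, Lorentz.sum_eps]; ring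
    · simp [bracket_t, Fin.sum_univ_three]; ring
  lie_self a := by
    refine ext' (by simp [bracket_x]) (fun l => ?_) ?_
    · simp only [bracket_p, Lorentz.sum_eps, zero_p]; ring
    · simp only [bracket_t, Fin.sum_univ_three, zero_t]; ring
  leibniz_lie a b c := by
    refine ext' (by simp [bracket_x]) (fun l => ?_) ?_
    · simp only [bracket_p, bracket_x, bracket_t, Lorentz.bracket_m, Lorentz.bracket_n,
        Lorentz.sum_eps, add_p]
      fin_cases l <;> simp [Fin.sum_univ_three] <;> ring
    · simp only [bracket_p, bracket_x, bracket_t, Lorentz.bracket_n, Lorentz.sum_eps, add_t]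
      simp [Fin.sum_univ_three]
      ring

instance : LieAlgebra ℂ Poincare where
  lie_smul c a b := by
    refine ext' (by simp [bracket_x]) (fun l => ?_) ?_
    · simp [bracket_p, Lorentz.sum_eps]; ring
    · simp [bracket_t, Fin.sum_univ_three]; ring

/-- The generators of rotations. -/
def M (i : Fin 3) : Poincare := ⟨Lorentz.M i, 0, 0⟩

/-- The generators of boosts. -/
def N (i : Fin 3) : Poincare := ⟨Lorentz.N i, 0, 0⟩

/-- The momenta `P₁, P₂, P₃`. -/
def P (i : Fin 3) : Poincare := ⟨0, Pi.single i 1, 0⟩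

/-- The energy, denoted `P₄` here. -/
def P4 : Poincare := ⟨0, 0, 1⟩

end Poincare

/-! ### Enveloping algebras and the square root series -/

/-- The enveloping algebra of `o(1,3)`. -/
abbrev ULorentz : Type := UniversalEnvelopingAlgebra ℂ Lorentz

/-- The enveloping algebra of the translations. -/
abbrev UTranslations : Type := UniversalEnvelopingAlgebra ℂ Translations

/-- The enveloping algebra of `io(1,3)`. -/
abbrev UPoincare : Type := UniversalEnvelopingAlgebra ℂ Poincare

/-- An element of a Lie algebra, as a generator of its enveloping algebra. -/
abbrev gen {L : Type} [LieRing L] [LieAlgebra ℂ L] (x : L) : UniversalEnvelopingAlgebra ℂ L :=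
  UniversalEnvelopingAlgebra.ι ℂ x

section Xi

variable {U : Type} [Ring U] [Algebra ℂ U] (p : Fin 3 → U) (e : U)

/-- The Lorentzian square `P₁² + P₂² + P₃² - P₄²`. -/
def minkowskiSq : U := ∑ i, p i ^ 2 - e ^ 2

/-- The power series `√(1 - h² P²) = ∑ n, (-1)ⁿ binom(1/2, n) h²ⁿ (P²)ⁿ`. -/
def sqrtSeries : PowerSeries U :=
  PowerSeries.mk fun n =>
    if Even n then ((-1 : ℂ) ^ (n / 2) * Ring.choose (1 / 2 : ℂ) (n / 2)) • minkowskiSq p e ^ (n / 2)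
    else 0

/-- `Ξ = h P₄ + √(1 - h² P²)`. -/
def Xi : PowerSeries U := PowerSeries.X * PowerSeries.C e + sqrtSeries p e

/-- The inverse of `Ξ`, a power series with constant coefficient `1`. -/
def XiInv : PowerSeries U := PowerSeries.invOfUnit (Xi p e) 1

theorem constantCoeff_Xi : PowerSeries.constantCoeff (Xi p e) = ((1 : Uˣ) : U) := by
  rw [← PowerSeries.coeff_zero_eq_constantCoeff_apply]
  simp [Xi, sqrtSeries]

theorem Xi_mul_XiInv : Xi p e * XiInv p e = 1 := PowerSeries.mul_invOfUnit _ _ (constantCoeff_Xi p e)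

theorem XiInv_mul_Xi : XiInv p e * Xi p e = 1 := PowerSeries.invOfUnit_mul _ _ (constantCoeff_Xi p e)

/-- `h P i Ξ⁻¹` for `i = 1, 2, 3`. -/
def hPXiInv (i : Fin 3) : PowerSeries U := PowerSeries.X * PowerSeries.C (p i) * XiInv p e

end Xi

/-! ### The data of the classical basis -/

/-- The momenta in the enveloping algebra of the translations. -/
abbrev pT (i : Fin 3) : UTranslations := gen (Translations.P i)

/-- The energy in the enveloping algebra of the translations. -/
abbrev eT : UTranslations := gen Translations.P4

/-- The momenta in the enveloping algebra of `io(1,3)`. -/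
abbrev pP (i : Fin 3) : UPoincare := gen (Poincare.P i)

/-- The energy in the enveloping algebra of `io(1,3)`. -/
abbrev eP : UPoincare := gen Poincare.P4

/-- `ℋ` is `U(o(1,3))[[h]]` with the primitive coproduct. -/
structure IsPrimitiveLorentz (ℋ : HopfStr ULorentz) : Prop where
  classical : HasClassicalProduct ℋ
  comul_gen : ∀ x : Lorentz, ℋ.comul (const (gen x)) =
    tmul (const (gen x)) (const 1) + tmul (const 1) (const (gen x))

/-- `𝒜` is `U(ab(P₁, …, P₄))[[h]]` with the `κ`-deformed coproduct. -/
structure IsKappaTranslations (𝒜 : HopfStr UTranslations) : Prop where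
  classical : HasClassicalProduct 𝒜
  /-- `Δ(P i) = P i ⊗ Ξ + 1 ⊗ P i` for `i = 1, 2, 3` -/
  comul_P : ∀ i : Fin 3, 𝒜.comul (const (pT i)) =
    tmul (const (pT i)) (ofPS (Xi pT eT)) + tmul (const 1) (const (pT i))
  /-- `Δ(P₄) = P₄ ⊗ Ξ + Ξ⁻¹ ⊗ P₄ + h P m Ξ⁻¹ ⊗ P m`, summed over `m = 1, 2, 3` -/
  comul_P4 : 𝒜.comul (const eT) =
    tmul (const eT) (ofPS (Xi pT eT)) +
      tmul (ofPS (XiInv pT eT)) (const eT) +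
      ∑ m : Fin 3, tmul (ofPS (hPXiInv pT eT m)) (const (pT m))

/-- `act` is the classical right action `f ◁ L` (on generators, `P ◁ L = [P, L]`), extended so that
the translations form a right module algebra. -/
structure IsClassicalAction (ℋ : HopfStr ULorentz) (𝒜 : HopfStr UTranslations)
    (act : Ser (UTranslations ⊗[ℂ] ULorentz) →ₗ[K] Ser UTranslations) : Prop where
  moduleAlgebra : IsRightModuleAlgebra ℋ 𝒜 act
  P_act_M : ∀ k j : Fin 3,
    act (tmul (const (pT k)) (const (gen (Lorentz.M j)))) =
      -∑ l : Fin 3, (Complex.I * eps j k l) • const (pT l)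
  P4_act_M : ∀ j : Fin 3,
    act (tmul (const eT) (const (gen (Lorentz.M j)))) = 0
  P_act_N : ∀ k j : Fin 3,
    act (tmul (const (pT k)) (const (gen (Lorentz.N j)))) =
      if j = k then Complex.I • const eT else 0
  P4_act_N : ∀ j : Fin 3,
    act (tmul (const eT) (const (gen (Lorentz.N j)))) =
      Complex.I • const (pT j)

/-- The values of the coaction `β_κ` on the generators of `o(1,3)`: `β(M i) = 1 ⊗ M i` and
`β(N i) = Ξ⁻¹ ⊗ N i - h ε i j m P j Ξ⁻¹ ⊗ M m`. -/
structure HasKappaValues (β : Ser ULorentz →ₗ[K] Ser (UTranslations ⊗[ℂ] ULorentz)) : Prop where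
  coact_M : ∀ i : Fin 3, β (const (gen (Lorentz.M i))) =
    tmul (const 1) (const (gen (Lorentz.M i)))
  coact_N : ∀ i : Fin 3, β (const (gen (Lorentz.N i))) =
    tmul (ofPS (XiInv pT eT)) (const (gen (Lorentz.N i))) -
      ∑ j : Fin 3, ∑ m : Fin 3,
        eps i j m • tmul (ofPS (hPXiInv pT eT j)) (const (gen (Lorentz.M m)))

/-- `𝒬` is the `κ`-Poincaré Hopf algebra in the classical basis: the algebra `U(io(1,3))[[h]]` with
the `κ`-deformed coproducts, counits and antipodes of the generators `M i`, `N i`, `P μ`. -/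
structure IsKappaPoincare (𝒬 : HopfStr UPoincare) : Prop where
  classical : HasClassicalProduct 𝒬
  comul_M : ∀ i : Fin 3, 𝒬.comul (const (gen (Poincare.M i))) =
    tmul (const (gen (Poincare.M i))) (const 1) + tmul (const 1) (const (gen (Poincare.M i)))
  comul_N : ∀ i : Fin 3, 𝒬.comul (const (gen (Poincare.N i))) =
    tmul (const (gen (Poincare.N i))) (const 1) +
      tmul (ofPS (XiInv pP eP)) (const (gen (Poincare.N i))) -
      ∑ j : Fin 3, ∑ m : Fin 3,
        eps i j m • tmul (ofPS (hPXiInv pP eP j)) (const (gen (Poincare.M m)))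
  comul_P : ∀ i : Fin 3, 𝒬.comul (const (pP i)) =
    tmul (const (pP i)) (ofPS (Xi pP eP)) + tmul (const 1) (const (pP i))
  comul_P4 : 𝒬.comul (const eP) =
    tmul (const eP) (ofPS (Xi pP eP)) +
      tmul (ofPS (XiInv pP eP)) (const eP) +
      ∑ m : Fin 3, tmul (ofPS (hPXiInv pP eP m)) (const (pP m))
  counit_gen : ∀ x : Poincare, 𝒬.counit (const (gen x)) = 0
  antipode_M : ∀ i : Fin 3, 𝒬.antipode (const (gen (Poincare.M i))) =
    -const (gen (Poincare.M i))
  antipode_N : ∀ i : Fin 3, 𝒬.antipode (const (gen (Poincare.N i))) =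
    ofPS (-(Xi pP eP * PowerSeries.C (gen (Poincare.N i))) -
      ∑ j : Fin 3, ∑ m : Fin 3, PowerSeries.X *
        PowerSeries.C (eps i j m • (pP j * gen (Poincare.M m))))
  antipode_P : ∀ i : Fin 3, 𝒬.antipode (const (pP i)) =
    ofPS (-(PowerSeries.C (pP i) * XiInv pP eP))
  antipode_P4 : 𝒬.antipode (const eP) =
    ofPS (-PowerSeries.C eP +
      PowerSeries.X * PowerSeries.C (∑ i : Fin 3, pP i ^ 2) * XiInv pP eP)

end KappaPoincare

end

open scoped TensorProduct
open KappaPoincare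

/-! The basis elements e_k of o(1,3) generate ℋ and are primitive there, and everything is
controlled by them. Let D_k be the derivation of 𝒜 by which e_k acts and write β(e_k) = ∑ a_kl ⊗
e_l. Replacing L by L e_k changes f ◁ L by D_k, and changes β(L) by the operator D_k ⊗ id + ∑ a_kl ⊗
(right multiplication by e_l), called `spread`. Words in the generators are built from 1 by right
multiplication, so two continuous linear maps on ℋ are equal as soon as they agree at 1 and obey the
same recursion (`recursion_ext`).

In this way the module algebra axioms, the comodule coalgebra axioms and Majid's conditions all
follow formally from a few infinitesimal facts, collected in `BicrossData`: the recursions for the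
action and for β, the Leibniz rule for D_k, the formula Δ(D_k f) = (D_k ⊗ id + ∑ a_kl ⊗ D_l) Δ(f),
the vanishing of ε ∘ D_k, and the matrix coalgebra rules Δ(a_kl) = ∑ a_km ⊗ a_ml, ε(a_kl) = δ_kl.
Condition (C) needs only that ℋ is cocommutative and 𝒜 commutative.

The coaction exists because it can be written as an orbit map: an element x of o(1,3) acts on 𝒜 ⊗̂ ℋ
by D_x ⊗ id plus right multiplication by c(x), the prescribed value of β at x, and β is the orbit of
1 ⊗ 1. These operators respect brackets by the Maurer–Cartan equation c([x,y]) = D_y c(x) - D_x c(y)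
+ [c(x), c(y)] (`coactGen_lie`).

The concrete computations rest on two properties of Ξ. It is the root with constant term 1 of the
quadratic equation Ξ² - 2 h P₄ Ξ = 1 - h² P_i P_i, and such a root is unique; hence Δ(Ξ) = Ξ ⊗ Ξ,
S(Ξ) = Ξ⁻¹ and ε(Ξ) = 1. Moreover P² is Lorentz invariant, so D_x Ξ = h D_x P₄.

For the last two parts, multiplication L ⊗ f ↦ L f identifies ℋ ⊗̂ 𝒜 with U(io(1,3))[[h]]. Its
inverse is again an orbit map, for an explicit right action of io(1,3) on ℋ ⊗̂ 𝒜 (`smashEquiv`). The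
coproduct x ↦ x ⊗ 1 + c(x) on o(1,3), together with the coproduct of 𝒜, respects the brackets of
io(1,3) by the Maurer–Cartan equation and the formula for Δ(D_k f). The resulting Hopf algebra is
built from `SmashData`, carried back along the factorisation, and its structure maps are recognised
as those of the bicrossproduct (`SmashData.isBicrossproduct`).

Uniqueness is cheap: product, unit and coproduct determine counit and antipode
(`HopfStr.ext_of_comul`), homomorphisms are determined on generators, and the action and coaction by
their recursions. -/

noncomputable section

namespace KappaPoincare

open Ser
open Finset.HasAntidiagonal (antidiagonal)

set_option linter.unusedSectionVars false

/-! ### Continuous linear maps between modules of series -/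

namespace Ser

section Linear

variable {V W X Y V' W' : Type} [AddCommGroup V] [Module ℂ V] [AddCommGroup W] [Module ℂ W]
  [AddCommGroup X] [Module ℂ X] [AddCommGroup Y] [Module ℂ Y]
  [AddCommGroup V'] [Module ℂ V'] [AddCommGroup W'] [Module ℂ W']

instance : IsScalarTower ℂ K (Ser V) where
  smul_assoc c a v := by
    rw [← C_smul c (a • v), ← mul_smul, PowerSeries.smul_eq_C_mul]

@[simp] theorem coeff_const_zero (v : V) : (const v).coeff 0 = v := rfl

@[simp] theorem coeff_const_succ (v : V) (n : ℕ) : (const v).coeff (n + 1) = 0 := rfl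

theorem coeff_const (v : V) (n : ℕ) : (const v).coeff n = if n = 0 then v else 0 := rfl

theorem coeff_extend (φ : V →ₗ[ℂ] Ser W) (v : Ser V) (n : ℕ) : (extend φ v).coeff n =
    ∑ ij ∈ antidiagonal n, (φ (v.coeff ij.1)).coeff ij.2 := rfl

theorem coeff_tmul (v : Ser V) (w : Ser W) (n : ℕ) : (tmul v w).coeff n =
    ∑ ij ∈ antidiagonal n, v.coeff ij.1 ⊗ₜ[ℂ] w.coeff ij.2 := rfl

theorem sum_antidiagonal_ite_zero {B : Type} [AddCommMonoid B] (n : ℕ) (f : ℕ → B) :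
    ∑ ij ∈ antidiagonal n, (if ij.2 = 0 then f ij.1 else 0) = f n := by
  rw [Finset.sum_eq_single (n, 0)]
  · simp
  · rintro ⟨i, j⟩ hij hne
    have hj : j ≠ 0 := by
      rintro rfl
      exact hne (by simpa using hij)
    simp [hj]
  · simp

theorem sum_antidiagonal_ite_zero' {B : Type} [AddCommMonoid B] (n : ℕ) (f : ℕ → B) :
    ∑ ij ∈ antidiagonal n, (if ij.1 = 0 then f ij.2 else 0) = f n := by
  rw [Finset.sum_eq_single (0, n)]
  · simp
  · rintro ⟨i, j⟩ hij hne
    have hj : i ≠ 0 := by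
      rintro rfl
      exact hne (by simpa using hij)
    simp [hj]
  · simp

@[simp] theorem extend_const (φ : V →ₗ[ℂ] Ser W) (v : V) : extend φ (const v) = φ v := by
  ext n
  rw [coeff_extend, ← sum_antidiagonal_ite_zero' n (fun m => (φ v).coeff m)]
  refine Finset.sum_congr rfl fun ij _ => ?_
  rw [coeff_const]
  split_ifs <;> simp

@[simp] theorem coeff_coeffwise (f : V →ₗ[ℂ] W) (v : Ser V) (n : ℕ) :
    (coeffwise f v).coeff n = f (v.coeff n) := by
  rw [coeffwise, coeff_extend, ← sum_antidiagonal_ite_zero n (fun m => f (v.coeff m))]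
  rfl

@[simp] theorem coeffwise_const (f : V →ₗ[ℂ] W) (v : V) :
    coeffwise f (const v) = const (f v) := by
  simp [coeffwise]

@[simp] theorem coeffwise_id : coeffwise (LinearMap.id : V →ₗ[ℂ] V) = LinearMap.id := by
  ext v n; simp

theorem coeffwise_coeffwise (g : W →ₗ[ℂ] X) (f : V →ₗ[ℂ] W) (v : Ser V) :
    coeffwise g (coeffwise f v) = coeffwise (g ∘ₗ f) v := by
  ext n; simp

/-- The series divided by `h`, without its constant term. -/
def shift (v : Ser V) : Ser V := ⟨fun n => v.coeff (n + 1)⟩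

theorem coeff_X_smul_zero (v : Ser V) : ((PowerSeries.X : K) • v).coeff 0 = 0 := by
  simp [coeff_smul]

theorem coeff_X_smul_succ (v : Ser V) (n : ℕ) :
    ((PowerSeries.X : K) • v).coeff (n + 1) = v.coeff n := by
  rw [coeff_smul, Finset.Nat.sum_antidiagonal_succ, ← sum_antidiagonal_ite_zero' n v.coeff]
  simp [PowerSeries.coeff_X]

theorem const_add_X_smul_shift (v : Ser V) :
    const (v.coeff 0) + (PowerSeries.X : K) • shift v = v := by
  ext n
  cases n with
  | zero => simp [coeff_X_smul_zero]
  | succ n => simp [coeff_X_smul_succ, shift]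

/-- Write v as its constant term plus h times a shifted series and induct on n: the coefficient of
h^n in the image involves only the coefficients of v up to order n. Linearity over `K` thus already
forces h-adic continuity. -/
theorem hom_ext {F G : Ser V →ₗ[K] Ser W} (H : ∀ v, F (const v) = G (const v)) : F = G := by
  refine LinearMap.ext fun v => ?_
  ext n
  induction n generalizing v with
  | zero =>
    rw [← const_add_X_smul_shift v, map_add, map_add, map_smul, map_smul, H]
    simp [coeff_X_smul_zero]
  | succ n ih =>
    rw [← const_add_X_smul_shift v, map_add, map_add, map_smul, map_smul, H, coeff_add, coeff_add,
      coeff_X_smul_succ, coeff_X_smul_succ, ih]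

theorem tmul_add (v : Ser V) (w w' : Ser W) : tmul v (w + w') = tmul v w + tmul v w' :=
  map_add (tmulLeft v) w w'

theorem add_tmul (v v' : Ser V) (w : Ser W) : tmul (v + v') w = tmul v w + tmul v' w :=
  map_add (tmulRight w) v v'

theorem tmul_sub (v : Ser V) (w w' : Ser W) : tmul v (w - w') = tmul v w - tmul v w' :=
  map_sub (tmulLeft v) w w'

theorem sub_tmul (v v' : Ser V) (w : Ser W) : tmul (v - v') w = tmul v w - tmul v' w :=
  map_sub (tmulRight w) v v'

theorem tmul_smul (a : K) (v : Ser V) (w : Ser W) : tmul v (a • w) = a • tmul v w :=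
  map_smul (tmulLeft v) a w

theorem smul_tmul (a : K) (v : Ser V) (w : Ser W) : tmul (a • v) w = a • tmul v w :=
  map_smul (tmulRight w) a v

theorem tmul_csmul (a : ℂ) (v : Ser V) (w : Ser W) : tmul v (a • w) = a • tmul v w :=
  (tmulLeft v).map_smul_of_tower a w

theorem csmul_tmul (a : ℂ) (v : Ser V) (w : Ser W) : tmul (a • v) w = a • tmul v w :=
  (tmulRight w).map_smul_of_tower a v

@[simp] theorem tmul_zero (v : Ser V) : tmul v (0 : Ser W) = 0 := map_zero (tmulLeft v)

@[simp] theorem zero_tmul (w : Ser W) : tmul (0 : Ser V) w = 0 := map_zero (tmulRight w)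

theorem tmul_neg (v : Ser V) (w : Ser W) : tmul v (-w) = -tmul v w := map_neg (tmulLeft v) w

theorem neg_tmul (v : Ser V) (w : Ser W) : tmul (-v) w = -tmul v w := map_neg (tmulRight w) v

theorem tmul_sum {ι : Type} (s : Finset ι) (v : Ser V) (w : ι → Ser W) :
    tmul v (∑ k ∈ s, w k) = ∑ k ∈ s, tmul v (w k) := map_sum (tmulLeft v) w s

theorem sum_tmul {ι : Type} (s : Finset ι) (v : ι → Ser V) (w : Ser W) :
    tmul (∑ k ∈ s, v k) w = ∑ k ∈ s, tmul (v k) w := map_sum (tmulRight w) v s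

@[simp] theorem tmulLeft_apply (v : Ser V) (w : Ser W) : tmulLeft v w = tmul v w := rfl

@[simp] theorem tmulRight_apply (v : Ser V) (w : Ser W) : tmulRight w v = tmul v w := rfl

@[simp] theorem tmul_const_const (v : V) (w : W) :
    tmul (const v) (const w) = const (v ⊗ₜ[ℂ] w) := by
  ext n
  rw [coeff_tmul, coeff_const, ← sum_antidiagonal_ite_zero n
    (fun m => if m = 0 then v ⊗ₜ[ℂ] w else 0)]
  refine Finset.sum_congr rfl fun ij _ => ?_
  rw [coeff_const, coeff_const]
  split_ifs <;> simp

theorem tmul_ext {F G : Ser (V ⊗[ℂ] W) →ₗ[K] Ser X} (H : ∀ v w, F (tmul v w) = G (tmul v w)) :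
    F = G := by
  refine hom_ext fun z => ?_
  induction z using TensorProduct.induction_on with
  | zero => simp
  | tmul v w => rw [← tmul_const_const, H]
  | add z z' hz hz' => rw [map_add, map_add, map_add, hz, hz']

/-- Phrased for functions with a proof of linearity, so that an expression in several variables can
be tested on constants one variable at a time, without being rewritten as a composite of linear
maps. -/
theorem isLinear_ext {f g : Ser V → Ser W} (hf : IsLinearMap K f) (hg : IsLinearMap K g)
    (H : ∀ v, f (const v) = g (const v)) (z : Ser V) : f z = g z :=
  LinearMap.congr_fun (hom_ext (F := hf.mk' f) (G := hg.mk' g) H) z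

theorem isLinear_tmul_ext {f g : Ser (V ⊗[ℂ] W) → Ser X} (hf : IsLinearMap K f)
    (hg : IsLinearMap K g) (H : ∀ v w, f (tmul v w) = g (tmul v w)) (z : Ser (V ⊗[ℂ] W)) :
    f z = g z :=
  LinearMap.congr_fun (tmul_ext (F := hf.mk' f) (G := hg.mk' g) H) z

@[simp] theorem tmap_tmul (f : Ser V →ₗ[K] Ser V') (g : Ser W →ₗ[K] Ser W') (v : Ser V)
    (w : Ser W) : tmap f g (tmul v w) = tmul (f v) (g w) := by
  refine isLinear_ext (f := fun v => tmap f g (tmul v w)) (g := fun v => tmul (f v) (g w))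
    ⟨fun _ _ => by simp [add_tmul], fun _ _ => by simp [smul_tmul]⟩
    ⟨fun _ _ => by simp [add_tmul], fun _ _ => by simp [smul_tmul]⟩ (fun v => ?_) v
  refine isLinear_ext (f := fun w => tmap f g (tmul (const v) w))
    (g := fun w => tmul (f (const v)) (g w))
    ⟨fun _ _ => by simp [tmul_add], fun _ _ => by simp [tmul_smul]⟩
    ⟨fun _ _ => by simp [tmul_add], fun _ _ => by simp [tmul_smul]⟩ (fun w => ?_) w
  simp [tmap]

/-- Reduces every rearrangement of three tensor factors to the case of constants, where it is a
statement about ordinary tensors. -/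
theorem coeffwise_tmul₃ {B : V ⊗[ℂ] (W ⊗[ℂ] X) →ₗ[ℂ] Y} {G : Ser V → Ser W → Ser X → Ser Y}
    (h₁ : ∀ w x, IsLinearMap K fun v => G v w x) (h₂ : ∀ v x, IsLinearMap K fun w => G v w x)
    (h₃ : ∀ v w, IsLinearMap K fun x => G v w x)
    (H : ∀ v w x, const (B (v ⊗ₜ (w ⊗ₜ x))) = G (const v) (const w) (const x)) (v w x) :
    coeffwise B (tmul v (tmul w x)) = G v w x := by
  refine isLinear_ext (f := fun v => coeffwise B (tmul v (tmul w x)))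
    ⟨fun _ _ => by simp [add_tmul], fun _ _ => by simp [smul_tmul]⟩ (h₁ w x) (fun v => ?_) v
  refine isLinear_ext (f := fun w => coeffwise B (tmul (const v) (tmul w x)))
    ⟨fun _ _ => by simp [add_tmul, tmul_add], fun _ _ => by simp [smul_tmul, tmul_smul]⟩
    (h₂ _ x) (fun w => ?_) w
  refine isLinear_ext (f := fun x => coeffwise B (tmul (const v) (tmul (const w) x)))
    ⟨fun _ _ => by simp [tmul_add], fun _ _ => by simp [tmul_smul]⟩
    (h₃ _ _) (fun x => ?_) x
  simp [H]

theorem coeffwise_tmul₃' {B : (V ⊗[ℂ] W) ⊗[ℂ] X →ₗ[ℂ] Y} {G : Ser V → Ser W → Ser X → Ser Y}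
    (h₁ : ∀ w x, IsLinearMap K fun v => G v w x) (h₂ : ∀ v x, IsLinearMap K fun w => G v w x)
    (h₃ : ∀ v w, IsLinearMap K fun x => G v w x)
    (H : ∀ v w x, const (B ((v ⊗ₜ w) ⊗ₜ x)) = G (const v) (const w) (const x)) (v w x) :
    coeffwise B (tmul (tmul v w) x) = G v w x := by
  refine isLinear_ext (f := fun v => coeffwise B (tmul (tmul v w) x))
    ⟨fun _ _ => by simp [add_tmul], fun _ _ => by simp [smul_tmul]⟩ (h₁ w x) (fun v => ?_) v
  refine isLinear_ext (f := fun w => coeffwise B (tmul (tmul (const v) w) x))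
    ⟨fun _ _ => by simp [add_tmul, tmul_add], fun _ _ => by simp [smul_tmul, tmul_smul]⟩
    (h₂ _ x) (fun w => ?_) w
  refine isLinear_ext (f := fun x => coeffwise B (tmul (tmul (const v) (const w)) x))
    ⟨fun _ _ => by simp [tmul_add], fun _ _ => by simp [tmul_smul]⟩
    (h₃ _ _) (fun x => ?_) x
  simp [H]

@[simp] theorem coeffwise_assoc (v : Ser V) (w : Ser W) (x : Ser X) :
    coeffwise (TensorProduct.assoc ℂ V W X).toLinearMap (tmul (tmul v w) x) =
      tmul v (tmul w x) := by
  refine coeffwise_tmul₃' (G := fun v w x => tmul v (tmul w x)) ?_ ?_ ?_ ?_ v w x <;> intros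
  on_goal 4 => simp
  all_goals exact ⟨by intros; simp [add_tmul, tmul_add], by intros; simp [smul_tmul, tmul_smul]⟩

@[simp] theorem coeffwise_assoc_symm (v : Ser V) (w : Ser W) (x : Ser X) :
    coeffwise (TensorProduct.assoc ℂ V W X).symm.toLinearMap (tmul v (tmul w x)) =
      tmul (tmul v w) x := by
  refine coeffwise_tmul₃ (G := fun v w x => tmul (tmul v w) x) ?_ ?_ ?_ ?_ v w x <;> intros
  on_goal 4 => simp
  all_goals exact ⟨by intros; simp [add_tmul, tmul_add], by intros; simp [smul_tmul, tmul_smul]⟩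

@[simp] theorem coeffwise_leftComm (v : Ser V) (w : Ser W) (x : Ser X) :
    coeffwise (TensorProduct.leftComm ℂ V W X).toLinearMap (tmul v (tmul w x)) =
      tmul w (tmul v x) := by
  refine coeffwise_tmul₃ (G := fun v w x => tmul w (tmul v x)) ?_ ?_ ?_ ?_ v w x <;> intros
  on_goal 4 => simp
  all_goals exact ⟨by intros; simp [add_tmul, tmul_add], by intros; simp [smul_tmul, tmul_smul]⟩

@[simp] theorem coeffwise_rightComm (v : Ser V) (w : Ser W) (x : Ser X) :
    coeffwise (TensorProduct.rightComm ℂ V W X).toLinearMap (tmul (tmul v w) x) =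
      tmul (tmul v x) w := by
  refine coeffwise_tmul₃' (G := fun v w x => tmul (tmul v x) w) ?_ ?_ ?_ ?_ v w x <;> intros
  on_goal 4 => simp
  all_goals exact ⟨by intros; simp [add_tmul, tmul_add], by intros; simp [smul_tmul, tmul_smul]⟩

@[simp] theorem coeffwise_comm (v : Ser V) (w : Ser W) :
    coeffwise (TensorProduct.comm ℂ V W).toLinearMap (tmul v w) = tmul w v := by
  refine isLinear_ext (f := fun v => coeffwise (TensorProduct.comm ℂ V W).toLinearMap (tmul v w))
    (g := fun v => tmul w v)
    ⟨fun _ _ => by simp [add_tmul], fun _ _ => by simp [smul_tmul]⟩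
    ⟨fun _ _ => by simp [tmul_add], fun _ _ => by simp [tmul_smul]⟩ (fun v => ?_) v
  refine isLinear_ext
    (f := fun w => coeffwise (TensorProduct.comm ℂ V W).toLinearMap (tmul (const v) w))
    (g := fun w => tmul w (const v))
    ⟨fun _ _ => by simp [tmul_add], fun _ _ => by simp [tmul_smul]⟩
    ⟨fun _ _ => by simp [add_tmul], fun _ _ => by simp [smul_tmul]⟩ (fun w => ?_) w
  simp

@[simp] theorem coeffwise_tttComm (v : Ser V) (w : Ser W) (x : Ser X) (y : Ser Y) :
    coeffwise (TensorProduct.tensorTensorTensorComm ℂ V W X Y).toLinearMap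
      (tmul (tmul v w) (tmul x y)) = tmul (tmul v x) (tmul w y) := by
  refine isLinear_ext (f := fun y => coeffwise
      (TensorProduct.tensorTensorTensorComm ℂ V W X Y).toLinearMap (tmul (tmul v w) (tmul x y)))
    (g := fun y => tmul (tmul v x) (tmul w y))
    ⟨fun _ _ => by simp [tmul_add], fun _ _ => by simp [tmul_smul]⟩
    ⟨fun _ _ => by simp [tmul_add], fun _ _ => by simp [tmul_smul]⟩ (fun y => ?_) y
  -- With the fourth factor frozen at a constant `y`, only three factors vary and the three-variable
  -- reduction applies.
  have := coeffwise_tmul₃' (B := (TensorProduct.tensorTensorTensorComm ℂ V W X Y).toLinearMap ∘ₗ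
    TensorProduct.map LinearMap.id ((TensorProduct.mk ℂ X Y).flip y))
    (G := fun v w x => tmul (tmul v x) (tmul w (const y))) (by
      intros; exact ⟨by intros; simp [add_tmul], by intros; simp [smul_tmul]⟩) (by
      intros; exact ⟨by intros; simp [add_tmul, tmul_add],
        by intros; simp [smul_tmul, tmul_smul]⟩) (by
      intros; exact ⟨by intros; simp [add_tmul, tmul_add],
        by intros; simp [smul_tmul, tmul_smul]⟩) (by intros; simp) v w x
  rw [← this, ← coeffwise_coeffwise]
  congr 1
  refine isLinear_ext (f := fun x => tmul (tmul v w) (tmul x (const y)))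
    (g := fun x => coeffwise (TensorProduct.map LinearMap.id ((TensorProduct.mk ℂ X Y).flip y))
      (tmul (tmul v w) x))
    ⟨fun _ _ => by simp [add_tmul, tmul_add], fun _ _ => by simp [smul_tmul, tmul_smul]⟩
    ⟨fun _ _ => by simp [tmul_add], fun _ _ => by simp [tmul_smul]⟩ (fun x => ?_) x
  refine isLinear_ext (f := fun z => tmul z (tmul (const x) (const y)))
    (g := fun z => coeffwise (TensorProduct.map LinearMap.id ((TensorProduct.mk ℂ X Y).flip y))
      (tmul z (const x)))
    ⟨fun _ _ => by simp [add_tmul], fun _ _ => by simp [smul_tmul]⟩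
    ⟨fun _ _ => by simp [add_tmul], fun _ _ => by simp [smul_tmul]⟩ (fun z => ?_) _
  simp

theorem coeffwise_tensorMap (f : V →ₗ[ℂ] V') (g : W →ₗ[ℂ] W') :
    coeffwise (TensorProduct.map f g) = tmap (coeffwise f) (coeffwise g) := by
  refine hom_ext fun z => ?_
  induction z using TensorProduct.induction_on with
  | zero => simp
  | tmul v w =>
    rw [← tmul_const_const, tmap_tmul]
    simp
  | add z z' hz hz' => rw [map_add, map_add, map_add, hz, hz']

theorem coeffwise_map_tmul (f : V →ₗ[ℂ] V') (g : W →ₗ[ℂ] W') (v : Ser V) (w : Ser W) :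
    coeffwise (TensorProduct.map f g) (tmul v w) = tmul (coeffwise f v) (coeffwise g w) := by
  rw [coeffwise_tensorMap, tmap_tmul]

@[simp] theorem coeffwise_shuffle {U : Type} [AddCommGroup U] [Module ℂ U]
    (u : Ser U) (v : Ser V) (w : Ser W) (x : Ser X) (y : Ser Y) :
    coeffwise (shuffle U V W X Y).toLinearMap (tmul (tmul u v) (tmul w (tmul x y))) =
      tmul (tmul (tmul u w) x) (tmul v y) := by
  have : (shuffle U V W X Y).toLinearMap =
      (TensorProduct.assoc ℂ (U ⊗[ℂ] W) X (V ⊗[ℂ] Y)).symm.toLinearMap ∘ₗ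
        TensorProduct.map LinearMap.id (TensorProduct.leftComm ℂ V X Y).toLinearMap ∘ₗ
          (TensorProduct.tensorTensorTensorComm ℂ U V W (X ⊗[ℂ] Y)).toLinearMap := rfl
  rw [this, ← coeffwise_coeffwise, ← coeffwise_coeffwise]
  simp [coeffwise_map_tmul]

theorem tmap_comp_apply {V'' W'' : Type} [AddCommGroup V''] [Module ℂ V''] [AddCommGroup W'']
    [Module ℂ W''] (f' : Ser V' →ₗ[K] Ser V'') (g' : Ser W' →ₗ[K] Ser W'')
    (f : Ser V →ₗ[K] Ser V') (g : Ser W →ₗ[K] Ser W') (z : Ser (V ⊗[ℂ] W)) :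
    tmap f' g' (tmap f g z) = tmap (f' ∘ₗ f) (g' ∘ₗ g) z :=
  LinearMap.congr_fun (f := tmap f' g' ∘ₗ tmap f g) (tmul_ext (by simp)) z

@[simp] theorem tmap_id : tmap (LinearMap.id : Ser V →ₗ[K] Ser V) (LinearMap.id : Ser W →ₗ[K] _) =
    LinearMap.id :=
  tmul_ext (by simp)

end Linear

/-! ### The algebra U[[h]] and tensor products of such algebras -/

section Algebra

variable {U V W B : Type} [Ring U] [Algebra ℂ U] [Ring V] [Algebra ℂ V] [Ring W] [Algebra ℂ W]
  [Ring B] [Algebra ℂ B]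

scoped instance {U : Type} [Ring U] : Mul (Ser U) :=
  ⟨fun v w => ⟨fun n => ∑ ij ∈ antidiagonal n, v.coeff ij.1 * w.coeff ij.2⟩⟩

scoped instance {U : Type} [Ring U] : One (Ser U) := ⟨⟨fun n => if n = 0 then 1 else 0⟩⟩

theorem coeff_mul {U : Type} [Ring U] (v w : Ser U) (n : ℕ) :
    (v * w).coeff n = ∑ ij ∈ antidiagonal n, v.coeff ij.1 * w.coeff ij.2 := rfl

theorem coeff_one {U : Type} [Ring U] (n : ℕ) :
    (1 : Ser U).coeff n = if n = 0 then 1 else 0 := rfl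

scoped instance {U : Type} [Ring U] : Ring (Ser U) where
  __ := Ser.instAddCommGroup
  mul_assoc a b c := by
    ext n
    simp only [coeff_mul, Finset.sum_mul, Finset.mul_sum, mul_assoc]
    exact sum_triple n (fun i j k => a.coeff i * (b.coeff j * c.coeff k))
  one_mul a := by
    ext n
    simp only [coeff_mul, coeff_one, ite_mul, one_mul, zero_mul]
    exact sum_antidiagonal_ite_zero' n a.coeff
  mul_one a := by
    ext n
    simp only [coeff_mul, coeff_one, mul_ite, mul_one, mul_zero]
    exact sum_antidiagonal_ite_zero n a.coeff
  left_distrib a b c := by ext n; simp [coeff_mul, mul_add, Finset.sum_add_distrib]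
  right_distrib a b c := by ext n; simp [coeff_mul, add_mul, Finset.sum_add_distrib]
  zero_mul a := by ext n; simp [coeff_mul]
  mul_zero a := by ext n; simp [coeff_mul]

scoped instance {U : Type} [CommRing U] : CommRing (Ser U) where
  mul_comm a b := by
    ext n
    rw [coeff_mul, coeff_mul, ← Finset.Nat.sum_antidiagonal_swap]
    simp [mul_comm]

theorem mul_eq_coeffwise (v w : Ser U) : v * w = coeffwise (LinearMap.mul' ℂ U) (tmul v w) := by
  ext n
  simp [coeff_mul, coeff_tmul]

theorem const_one : (const 1 : Ser U) = 1 := rfl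

scoped instance : Algebra ℂ (Ser U) := Algebra.ofModule
  (fun c v w => by ext n; simp [coeff_mul, Finset.smul_sum])
  (fun c v w => by ext n; simp [coeff_mul, Finset.smul_sum])

scoped instance : Algebra K (Ser U) := Algebra.ofModule
  (fun a v w => by simp only [mul_eq_coeffwise, smul_tmul, map_smul])
  (fun a v w => by simp only [mul_eq_coeffwise, tmul_smul, map_smul])

attribute [scoped instance high] AddCommGroup.toAddCommMonoid TensorProduct.addCommGroup
  Ser.instAddCommGroup Ser.instModuleK Ser.instModuleComplex

-- The tensor product is spelled out with the additive structures that `tmul` and `tmap` use, so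
-- that the ring structure lies on the very module underlying the completed tensor product.
scoped instance instRingTensor : Ring (@TensorProduct ℂ _ U V AddCommGroup.toAddCommMonoid
    AddCommGroup.toAddCommMonoid Algebra.toModule Algebra.toModule) :=
  Algebra.TensorProduct.instRing

scoped instance instAlgebraTensor : Algebra ℂ (@TensorProduct ℂ _ U V
    AddCommGroup.toAddCommMonoid AddCommGroup.toAddCommMonoid Algebra.toModule Algebra.toModule) :=
  Algebra.TensorProduct.instAlgebra

theorem const_mul (u v : U) : (const (u * v) : Ser U) = const u * const v := by
  rw [mul_eq_coeffwise]; simp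

theorem tmul_mul_tmul (u u' : Ser U) (v v' : Ser V) :
    tmul u v * tmul u' v' = tmul (u * u') (v * v') := by
  refine isLinear_ext (f := fun u => tmul u v * tmul u' v') (g := fun u => tmul (u * u') (v * v'))
    ⟨fun _ _ => by simp [add_tmul, add_mul], fun _ _ => by simp [smul_tmul]⟩
    ⟨fun _ _ => by simp [add_tmul, add_mul], fun _ _ => by simp [smul_tmul]⟩ (fun u => ?_) u
  refine isLinear_ext (f := fun u' => tmul (const u) v * tmul u' v')
    (g := fun u' => tmul (const u * u') (v * v'))
    ⟨fun _ _ => by simp [add_tmul, mul_add], fun _ _ => by simp [smul_tmul]⟩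
    ⟨fun _ _ => by simp [add_tmul, mul_add], fun _ _ => by simp [smul_tmul]⟩ (fun u' => ?_) u'
  refine isLinear_ext (f := fun v => tmul (const u) v * tmul (const u') v')
    (g := fun v => tmul (const u * const u') (v * v'))
    ⟨fun _ _ => by simp [tmul_add, add_mul], fun _ _ => by simp [tmul_smul]⟩
    ⟨fun _ _ => by simp [tmul_add, add_mul], fun _ _ => by simp [tmul_smul]⟩ (fun v => ?_) v
  refine isLinear_ext (f := fun v' => tmul (const u) (const v) * tmul (const u') v')
    (g := fun v' => tmul (const u * const u') (const v * v'))
    ⟨fun _ _ => by simp [tmul_add, mul_add], fun _ _ => by simp [tmul_smul]⟩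
    ⟨fun _ _ => by simp [tmul_add, mul_add], fun _ _ => by simp [tmul_smul]⟩ (fun v' => ?_) v'
  simp [← const_mul]

theorem one_tmul_one : tmul (1 : Ser U) (1 : Ser V) = 1 := by
  rw [← const_one, ← const_one, tmul_const_const, ← Algebra.TensorProduct.one_def, const_one]

end Algebra

end Ser

/-! ### Scalars, algebra homomorphisms, and recursion along generators -/

namespace Ser

section Scalars

variable {V W : Type} [AddCommGroup V] [Module ℂ V] [AddCommGroup W] [Module ℂ W]

/-- A series with complex coefficients, as a scalar. -/
def toK (z : Ser ℂ) : K := PowerSeries.mk z.coeff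

theorem coeffwise_lid_tmul (z : Ser ℂ) (v : Ser V) :
    coeffwise (TensorProduct.lid ℂ V).toLinearMap (tmul z v) = toK z • v := by
  ext n
  simp [coeff_tmul, coeff_smul, toK]

theorem coeffwise_rid_tmul (v : Ser V) (z : Ser ℂ) :
    coeffwise (TensorProduct.rid ℂ V).toLinearMap (tmul v z) = toK z • v := by
  ext n
  rw [coeff_smul, ← Finset.Nat.sum_antidiagonal_swap]
  simp [coeff_tmul, toK]

@[simp] theorem toK_zero : toK 0 = 0 := by
  ext n; simp [toK]

@[simp] theorem toK_one : toK 1 = 1 := by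
  ext n; simp [toK, PowerSeries.coeff_one, coeff_one]

@[simp] theorem toK_mul (z w : Ser ℂ) : toK (z * w) = toK z * toK w := by
  ext n; simp [toK, PowerSeries.coeff_mul, coeff_mul]

@[simp] theorem toK_smul (a : K) (z : Ser ℂ) : toK (a • z) = a * toK z := by
  ext n; simp [toK, PowerSeries.coeff_mul, coeff_smul]

theorem smul_one_eq (z : Ser ℂ) : toK z • (1 : Ser ℂ) = z := by
  ext n
  simp only [coeff_smul, coeff_one, toK, PowerSeries.coeff_mk, smul_eq_mul, mul_ite, mul_one,
    mul_zero]
  exact sum_antidiagonal_ite_zero n z.coeff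

end Scalars

section Algebra

variable {U V W B C : Type} [Ring U] [Algebra ℂ U] [Ring V] [Algebra ℂ V] [Ring W] [Algebra ℂ W]
  [Ring B] [Algebra ℂ B] [Ring C] [Algebra ℂ C]

/-- The `K`-linear extension of the product of `U`. -/
abbrev mulMap (U : Type) [Ring U] [Algebra ℂ U] : Ser (U ⊗[ℂ] U) →ₗ[K] Ser U :=
  coeffwise (LinearMap.mul' ℂ U)

@[simp] theorem mulMap_tmul (v w : Ser U) : mulMap U (tmul v w) = v * w :=
  (mul_eq_coeffwise v w).symm

/-- A map between algebras of series preserves units and products. -/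
structure IsAlg (F : Ser U → Ser B) : Prop where
  one : F 1 = 1
  mul : ∀ a b, F (a * b) = F a * F b

namespace IsAlg

theorem of_const {F : Ser U →ₗ[K] Ser B} (one : F 1 = 1)
    (mul : ∀ u v : U, F (const u * const v) = F (const u) * F (const v)) : IsAlg F := by
  refine ⟨one, fun a b => ?_⟩
  refine isLinear_ext (f := fun a => F (a * b)) (g := fun a => F a * F b)
    ⟨fun _ _ => by simp [add_mul], fun _ _ => by simp⟩
    ⟨fun _ _ => by simp [add_mul], fun _ _ => by simp⟩ (fun u => ?_) a
  refine isLinear_ext (f := fun b => F (const u * b)) (g := fun b => F (const u) * F b)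
    ⟨fun _ _ => by simp [mul_add], fun _ _ => by simp⟩
    ⟨fun _ _ => by simp [mul_add], fun _ _ => by simp⟩ (fun v => ?_) b
  exact mul u v

theorem of_tmul {F : Ser (U ⊗[ℂ] V) →ₗ[K] Ser B} (one : F (tmul 1 1) = 1)
    (mul : ∀ u v u' v', F (tmul (u * u') (v * v')) = F (tmul u v) * F (tmul u' v')) : IsAlg F := by
  refine ⟨by rw [← one_tmul_one, one], fun a b => ?_⟩
  refine isLinear_tmul_ext (f := fun a => F (a * b)) (g := fun a => F a * F b)
    ⟨fun _ _ => by simp [add_mul], fun _ _ => by simp⟩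
    ⟨fun _ _ => by simp [add_mul], fun _ _ => by simp⟩ (fun u v => ?_) a
  refine isLinear_tmul_ext (f := fun b => F (tmul u v * b)) (g := fun b => F (tmul u v) * F b)
    ⟨fun _ _ => by simp [mul_add], fun _ _ => by simp⟩
    ⟨fun _ _ => by simp [mul_add], fun _ _ => by simp⟩ (fun u' v' => ?_) b
  rw [tmul_mul_tmul, mul]

theorem id : IsAlg (LinearMap.id : Ser U →ₗ[K] Ser U) := ⟨rfl, fun _ _ => rfl⟩

theorem comp {F : Ser U →ₗ[K] Ser V} {G : Ser V →ₗ[K] Ser W} (hG : IsAlg G) (hF : IsAlg F) :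
    IsAlg (G ∘ₗ F) := ⟨by simp [hF.one, hG.one], fun a b => by simp [hF.mul, hG.mul]⟩

theorem tmap {F : Ser U →ₗ[K] Ser V} {G : Ser W →ₗ[K] Ser B} (hF : IsAlg F) (hG : IsAlg G) :
    IsAlg (tmap F G) :=
  of_tmul (by rw [tmap_tmul, hF.one, hG.one, one_tmul_one]) fun a b c d => by
    rw [tmap_tmul, tmap_tmul, tmap_tmul, hF.mul, hG.mul, tmul_mul_tmul]

theorem coeffwise (f : U →ₐ[ℂ] V) : IsAlg (coeffwise f.toLinearMap) :=
  of_const (by simp [← const_one]) (by simp [← const_mul])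

theorem assoc : IsAlg (Ser.coeffwise (TensorProduct.assoc ℂ U V W).toLinearMap) := by
  have h : (TensorProduct.assoc ℂ U V W).toLinearMap =
      (Algebra.TensorProduct.assoc ℂ ℂ ℂ U V W).toAlgHom.toLinearMap :=
    TensorProduct.ext_threefold fun _ _ _ => rfl
  rw [h]
  exact coeffwise (Algebra.TensorProduct.assoc ℂ ℂ ℂ U V W).toAlgHom

theorem lid : IsAlg (Ser.coeffwise (TensorProduct.lid ℂ U).toLinearMap) :=
  of_tmul (by simp [coeffwise_lid_tmul]) fun a b c d => by
    rw [coeffwise_lid_tmul, coeffwise_lid_tmul, coeffwise_lid_tmul, toK_mul, smul_mul_smul_comm]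

theorem rid : IsAlg (Ser.coeffwise (TensorProduct.rid ℂ U).toLinearMap) :=
  of_tmul (by simp [coeffwise_rid_tmul]) fun a b c d => by
    rw [coeffwise_rid_tmul, coeffwise_rid_tmul, coeffwise_rid_tmul, toK_mul, smul_mul_smul_comm]

theorem comm : IsAlg (Ser.coeffwise (TensorProduct.comm ℂ U V).toLinearMap) :=
  of_tmul (by rw [coeffwise_comm, one_tmul_one]) (by simp [tmul_mul_tmul])

theorem mulMap {A : Type} [CommRing A] [Algebra ℂ A] : IsAlg (mulMap A) :=
  of_tmul (by simp) (by intros; simp [mul_mul_mul_comm])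

end IsAlg

/-- Words in the generators span, and each word grows from 1 by multiplication on the right, which
is the side on which right actions and the coaction are recursive. -/
theorem right_induction {ι : Type} {e : ι → U} (he : Algebra.adjoin ℂ (Set.range e) = ⊤)
    {p : U → Prop} (one : p 1) (mul : ∀ u k, p u → p (u * e k)) (zero : p 0)
    (add : ∀ u v, p u → p v → p (u + v)) (smul : ∀ (c : ℂ) u, p u → p (c • u)) (u : U) : p u := by
  have hu : u ∈ Subalgebra.toSubmodule (Algebra.adjoin ℂ (Set.range e)) := by
    rw [he]; trivial
  rw [Algebra.adjoin_eq_span] at hu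
  induction hu using Submodule.span_induction with
  | mem x hx =>
    induction hx using Submonoid.closure_induction_right with
    | one => exact one
    | mul_right x hx y hy h =>
      obtain ⟨k, rfl⟩ := hy
      exact mul x k h
  | zero => exact zero
  | add x y _ _ hx hy => exact add x y hx hy
  | smul c x _ hx => exact smul c x hx

theorem adjoin_ext {X : Type} [AddCommGroup X] [Module ℂ X] {ι : Type} {e : ι → U}
    (he : Algebra.adjoin ℂ (Set.range e) = ⊤) {F G : Ser U →ₗ[K] Ser X} (one : F 1 = G 1)
    (mul : ∀ k u, F (const u) = G (const u) →
      F (const u * const (e k)) = G (const u * const (e k))) : F = G := by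
  refine hom_ext fun u => ?_
  refine right_induction he (p := fun u => F (const u) = G (const u)) one
    (fun u k h => ?_) (by simp) (fun u v hu hv => by simp [hu, hv]) (fun c u hu => ?_) u
  · rw [const_mul, mul k u h]
  · rw [map_smul const, F.map_smul_of_tower, G.map_smul_of_tower, hu]

/-- Right multiplication by generators reaches everything from 1, so a map is determined by its
value there and by the rules `T k` describing how it changes at each multiplication. Most identities
below are proved by exhibiting rules `T k` common to both sides; these need not even be linear. -/
theorem recursion_ext {X : Type} [AddCommGroup X] [Module ℂ X] {ι : Type} {e : ι → U}
    (he : Algebra.adjoin ℂ (Set.range e) = ⊤) {F G : Ser U →ₗ[K] Ser X} (one : F 1 = G 1)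
    (T : ι → Ser X → Ser X) (hF : ∀ k u, F (u * const (e k)) = T k (F u))
    (hG : ∀ k u, G (u * const (e k)) = T k (G u)) : F = G :=
  adjoin_ext he one fun k u h => by rw [hF, hG, h]

theorem IsAlg.ext {ι : Type} {e : ι → U}
    (he : Algebra.adjoin ℂ (Set.range e) = ⊤) {F G : Ser U →ₗ[K] Ser B} (hF : IsAlg F)
    (hG : IsAlg G) (h : ∀ k, F (const (e k)) = G (const (e k))) : F = G :=
  recursion_ext he (by rw [hF.one, hG.one]) (fun k v => v * F (const (e k)))
    (fun k u => hF.mul _ _) (fun k u => by rw [hG.mul, h])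

end Algebra

end Ser

/-! ### Hopf structures with the product of U, and their uniqueness -/

section Builder

variable {U : Type} [Ring U] [Algebra ℂ U]

/-- A topological Hopf algebra structure on the algebra `U[[h]]`. -/
def HopfStr.ofRing (Δ : Ser U →ₗ[K] Ser (U ⊗[ℂ] U)) (ε : Ser U →ₗ[K] Ser ℂ) (S : Ser U →ₗ[K] Ser U)
    (hΔ : IsAlg Δ) (hε : IsAlg ε)
    (coassoc : coeffwise (TensorProduct.assoc ℂ U U U).toLinearMap ∘ₗ
      tmap Δ LinearMap.id ∘ₗ Δ = tmap LinearMap.id Δ ∘ₗ Δ)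
    (counit_comul : coeffwise (TensorProduct.lid ℂ U).toLinearMap ∘ₗ
      tmap ε LinearMap.id ∘ₗ Δ = LinearMap.id)
    (comul_counit : coeffwise (TensorProduct.rid ℂ U).toLinearMap ∘ₗ
      tmap LinearMap.id ε ∘ₗ Δ = LinearMap.id)
    (antipode_left : ∀ v, mulMap U (tmap S LinearMap.id (Δ v)) = toK (ε v) • 1)
    (antipode_right : ∀ v, mulMap U (tmap LinearMap.id S (Δ v)) = toK (ε v) • 1) : HopfStr U where
  mul := mulMap U
  one := const 1
  comul := Δ
  counit := ε
  antipode := S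
  mul_assoc := by
    refine tmul_ext fun z w => ?_
    refine isLinear_tmul_ext
      (f := fun z => (mulMap U ∘ₗ tmap (mulMap U) LinearMap.id) (tmul z w))
      (g := fun z => (mulMap U ∘ₗ tmap LinearMap.id (mulMap U) ∘ₗ
        coeffwise (TensorProduct.assoc ℂ U U U).toLinearMap) (tmul z w))
      ⟨fun _ _ => by simp [add_tmul], fun _ _ => by simp [smul_tmul]⟩
      ⟨fun _ _ => by simp [add_tmul], fun _ _ => by simp [smul_tmul]⟩ (fun u v => ?_) z
    simp [_root_.mul_assoc]
  one_mul v := by rw [const_one]; simp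
  mul_one v := by rw [const_one]; simp
  coassoc := coassoc
  counit_comul := counit_comul
  comul_counit := comul_counit
  comul_mul := by
    refine tmul_ext fun v w => ?_
    simp only [LinearMap.comp_apply, mulMap_tmul, hΔ.mul, tmap_tmul]
    generalize Δ v = z
    generalize Δ w = z'
    refine isLinear_tmul_ext (f := fun z => z * z') (g := fun z => tmap (mulMap U) (mulMap U)
        (coeffwise (TensorProduct.tensorTensorTensorComm ℂ U U U U).toLinearMap (tmul z z')))
      ⟨fun _ _ => by simp [add_mul], fun _ _ => by simp⟩
      ⟨fun _ _ => by simp [add_tmul], fun _ _ => by simp [smul_tmul]⟩ (fun u v => ?_) z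
    refine isLinear_tmul_ext (f := fun z' => tmul u v * z')
      (g := fun z' => tmap (mulMap U) (mulMap U)
        (coeffwise (TensorProduct.tensorTensorTensorComm ℂ U U U U).toLinearMap
          (tmul (tmul u v) z')))
      ⟨fun _ _ => by simp [mul_add], fun _ _ => by simp⟩
      ⟨fun _ _ => by simp [tmul_add], fun _ _ => by simp [tmul_smul]⟩ (fun u' v' => ?_) z'
    simp [tmul_mul_tmul]
  comul_one := by rw [const_one, hΔ.one, one_tmul_one]
  counit_mul := tmul_ext fun v w => by simp [hε.mul]
  counit_one := hε.one
  antipode_left v := by rw [antipode_left, const_one, coeffwise_lid_tmul]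
  antipode_right v := by rw [antipode_right, const_one, coeffwise_lid_tmul]

end Builder

namespace HopfStr

variable {V : Type} [AddCommGroup V] [Module ℂ V]

/-- Apply one counit to each leg of the common coproduct: collapsing either leg first leaves the
other counit, so both equal (ε' ⊗ ε) Δ. -/
theorem counit_eq_of_comul_eq {𝒱 𝒲 : HopfStr V} (h : 𝒱.comul = 𝒲.comul) :
    𝒱.counit = 𝒲.counit := by
  refine LinearMap.ext fun v => ?_
  have h₁ := LinearMap.congr_fun 𝒱.comul_counit v
  have h₂ := LinearMap.congr_fun 𝒲.counit_comul v
  have key : ∀ z : Ser (V ⊗[ℂ] V),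
      𝒲.counit (coeffwise (TensorProduct.rid ℂ V).toLinearMap (tmap LinearMap.id 𝒱.counit z)) =
      𝒱.counit (coeffwise (TensorProduct.lid ℂ V).toLinearMap (tmap 𝒲.counit LinearMap.id z)) := by
    refine LinearMap.congr_fun (f := 𝒲.counit ∘ₗ coeffwise (TensorProduct.rid ℂ V).toLinearMap ∘ₗ
      tmap LinearMap.id 𝒱.counit) (g := 𝒱.counit ∘ₗ
        coeffwise (TensorProduct.lid ℂ V).toLinearMap ∘ₗ tmap 𝒲.counit LinearMap.id)
      (tmul_ext fun a b => ?_)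
    simp only [LinearMap.comp_apply, tmap_tmul, coeffwise_lid_tmul, coeffwise_rid_tmul, map_smul,
      LinearMap.id_apply]
    rw [← smul_one_eq (𝒲.counit a), ← smul_one_eq (𝒱.counit b), toK_smul, toK_smul, smul_smul,
      smul_smul]
    simp [mul_comm]
  have := key (𝒱.comul v)
  simp only [LinearMap.comp_apply, LinearMap.id_apply] at h₁ h₂
  rw [h₁, h, h₂] at this
  exact this.symm

/-- An antipode is a convolution inverse of the identity, and inverses are unique: S = S * (id * S')
= (S * id) * S' = S'. -/
theorem antipode_eq_of_comul_eq {𝒱 𝒲 : HopfStr V} (hm : 𝒱.mul = 𝒲.mul) (h1 : 𝒱.one = 𝒲.one)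
    (h : 𝒱.comul = 𝒲.comul) : 𝒱.antipode = 𝒲.antipode := by
  have hε := counit_eq_of_comul_eq h
  refine LinearMap.ext fun v => ?_
  -- Associativity of the triple convolution S * id * S', before any coproduct is inserted.
  have key : ∀ z : Ser ((V ⊗[ℂ] V) ⊗[ℂ] V),
      𝒱.mul (tmap 𝒱.antipode (𝒱.mul ∘ₗ tmap LinearMap.id 𝒲.antipode)
        (coeffwise (TensorProduct.assoc ℂ V V V).toLinearMap z)) =
      𝒱.mul (tmap (𝒱.mul ∘ₗ tmap 𝒱.antipode LinearMap.id) 𝒲.antipode z) := by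
    refine LinearMap.congr_fun
      (f := 𝒱.mul ∘ₗ tmap 𝒱.antipode (𝒱.mul ∘ₗ tmap LinearMap.id 𝒲.antipode) ∘ₗ
        coeffwise (TensorProduct.assoc ℂ V V V).toLinearMap)
      (g := 𝒱.mul ∘ₗ tmap (𝒱.mul ∘ₗ tmap 𝒱.antipode LinearMap.id) 𝒲.antipode)
      (tmul_ext fun z c => ?_)
    refine isLinear_tmul_ext
      (f := fun z => (𝒱.mul ∘ₗ tmap 𝒱.antipode (𝒱.mul ∘ₗ tmap LinearMap.id 𝒲.antipode) ∘ₗ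
        coeffwise (TensorProduct.assoc ℂ V V V).toLinearMap) (tmul z c))
      (g := fun z => (𝒱.mul ∘ₗ tmap (𝒱.mul ∘ₗ tmap 𝒱.antipode LinearMap.id) 𝒲.antipode) (tmul z c))
      ⟨fun _ _ => by simp [add_tmul], fun _ _ => by simp [smul_tmul]⟩
      ⟨fun _ _ => by simp [add_tmul], fun _ _ => by simp [smul_tmul]⟩ (fun a b => ?_) z
    have := LinearMap.congr_fun 𝒱.mul_assoc (tmul (tmul (𝒱.antipode a) b) (𝒲.antipode c))
    simp only [LinearMap.comp_apply, tmap_tmul, coeffwise_assoc, LinearMap.id_apply] at this ⊢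
    exact this.symm
  have k := key (tmap 𝒱.comul LinearMap.id (𝒱.comul v))
  have ca := LinearMap.congr_fun 𝒱.coassoc v
  simp only [LinearMap.comp_apply] at ca
  rw [ca, tmap_comp_apply, tmap_comp_apply] at k
  have e1 : (𝒱.mul ∘ₗ tmap LinearMap.id 𝒲.antipode) ∘ₗ 𝒱.comul =
      coeffwise (TensorProduct.lid ℂ V).toLinearMap ∘ₗ tmulRight 𝒱.one ∘ₗ 𝒱.counit := by
    refine LinearMap.ext fun w => ?_
    have := 𝒲.antipode_right w
    rw [← hm, ← h, ← h1, ← hε] at this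
    exact this
  have e2 : (𝒱.mul ∘ₗ tmap 𝒱.antipode LinearMap.id) ∘ₗ 𝒱.comul =
      coeffwise (TensorProduct.lid ℂ V).toLinearMap ∘ₗ tmulRight 𝒱.one ∘ₗ 𝒱.counit := LinearMap.ext fun w => 𝒱.antipode_left w
  rw [e1, e2] at k
  have l1 : ∀ z : Ser (V ⊗[ℂ] V), 𝒱.mul (tmap (𝒱.antipode ∘ₗ LinearMap.id)
      (coeffwise (TensorProduct.lid ℂ V).toLinearMap ∘ₗ tmulRight 𝒱.one ∘ₗ 𝒱.counit) z) =
      𝒱.antipode (coeffwise (TensorProduct.rid ℂ V).toLinearMap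
        (tmap LinearMap.id 𝒱.counit z)) := fun z => by
    refine LinearMap.congr_fun (f := 𝒱.mul ∘ₗ tmap (𝒱.antipode ∘ₗ LinearMap.id)
      (coeffwise (TensorProduct.lid ℂ V).toLinearMap ∘ₗ tmulRight 𝒱.one ∘ₗ 𝒱.counit))
      (g := 𝒱.antipode ∘ₗ coeffwise (TensorProduct.rid ℂ V).toLinearMap ∘ₗ
        tmap LinearMap.id 𝒱.counit) (tmul_ext fun a b => ?_) z
    simp [coeffwise_lid_tmul, coeffwise_rid_tmul, tmul_smul, 𝒱.mul_one]
  have l2 : ∀ z : Ser (V ⊗[ℂ] V), 𝒱.mul (tmap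
      (coeffwise (TensorProduct.lid ℂ V).toLinearMap ∘ₗ tmulRight 𝒱.one ∘ₗ 𝒱.counit)
      (𝒲.antipode ∘ₗ LinearMap.id) z) =
      𝒲.antipode (coeffwise (TensorProduct.lid ℂ V).toLinearMap
        (tmap 𝒱.counit LinearMap.id z)) := fun z => by
    refine LinearMap.congr_fun (f := 𝒱.mul ∘ₗ tmap
      (coeffwise (TensorProduct.lid ℂ V).toLinearMap ∘ₗ tmulRight 𝒱.one ∘ₗ 𝒱.counit)
      (𝒲.antipode ∘ₗ LinearMap.id))
      (g := 𝒲.antipode ∘ₗ coeffwise (TensorProduct.lid ℂ V).toLinearMap ∘ₗ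
        tmap 𝒱.counit LinearMap.id) (tmul_ext fun a b => ?_) z
    simp [coeffwise_lid_tmul, smul_tmul, 𝒱.one_mul]
  rw [l1, l2] at k
  have h₁ := LinearMap.congr_fun 𝒱.comul_counit v
  have h₂ := LinearMap.congr_fun 𝒱.counit_comul v
  simp only [LinearMap.comp_apply, LinearMap.id_apply] at h₁ h₂
  rwa [h₁, h₂] at k

/-- Counit and antipode come for free, so each uniqueness claim for a Hopf structure reduces to its
product, unit and coproduct. -/
theorem ext_of_comul {𝒱 𝒲 : HopfStr V} (hm : 𝒱.mul = 𝒲.mul) (h1 : 𝒱.one = 𝒲.one)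
    (h : 𝒱.comul = 𝒲.comul) : 𝒱 = 𝒲 := by
  have hε := counit_eq_of_comul_eq h
  have hS := antipode_eq_of_comul_eq hm h1 h
  cases 𝒱
  cases 𝒲
  simp only at hm h1 h hε hS
  subst hm h1 h hε hS
  rfl

end HopfStr

namespace HasClassicalProduct

variable {U : Type} [Ring U] [Algebra ℂ U] {𝒰 : HopfStr U}

theorem mul_tmul
    (h : HasClassicalProduct 𝒰) (v w : Ser U) : 𝒰.mul (tmul v w) = v * w := by
  rw [h.1, mulMap_tmul]

theorem isAlg_comul
    (h : HasClassicalProduct 𝒰) : IsAlg 𝒰.comul := by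
  have h1 := 𝒰.comul_one
  rw [h.2, const_one, one_tmul_one] at h1
  refine ⟨h1, fun a b => ?_⟩
  have := LinearMap.congr_fun 𝒰.comul_mul (tmul a b)
  simp only [LinearMap.comp_apply, h.mul_tmul, tmap_tmul] at this
  rw [this, h.1]
  generalize 𝒰.comul a = z
  generalize 𝒰.comul b = z'
  refine isLinear_tmul_ext (g := fun z => z * z') (f := fun z => tmap (mulMap U) (mulMap U)
      (coeffwise (TensorProduct.tensorTensorTensorComm ℂ U U U U).toLinearMap (tmul z z')))
    ⟨fun _ _ => by simp [add_tmul], fun _ _ => by simp [smul_tmul]⟩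
    ⟨fun _ _ => by simp [add_mul], fun _ _ => by simp⟩ (fun u v => ?_) z
  refine isLinear_tmul_ext (g := fun z' => tmul u v * z')
    (f := fun z' => tmap (mulMap U) (mulMap U)
      (coeffwise (TensorProduct.tensorTensorTensorComm ℂ U U U U).toLinearMap
        (tmul (tmul u v) z')))
    ⟨fun _ _ => by simp [tmul_add], fun _ _ => by simp [tmul_smul]⟩
    ⟨fun _ _ => by simp [mul_add], fun _ _ => by simp⟩ (fun u' v' => ?_) z'
  simp [tmul_mul_tmul]

theorem isAlg_counit (h : HasClassicalProduct 𝒰) : IsAlg 𝒰.counit := by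
  refine ⟨by rw [← const_one, ← h.2, 𝒰.counit_one]; rfl, fun a b => ?_⟩
  have := LinearMap.congr_fun 𝒰.counit_mul (tmul a b)
  simpa only [LinearMap.comp_apply, h.mul_tmul, tmap_tmul, mulMap_tmul] using this

theorem ext {𝒰' : HopfStr U}
    (h : HasClassicalProduct 𝒰) (h' : HasClassicalProduct 𝒰') {ι : Type} {e : ι → U}
    (he : Algebra.adjoin ℂ (Set.range e) = ⊤)
    (H : ∀ k, 𝒰.comul (const (e k)) = 𝒰'.comul (const (e k))) : 𝒰 = 𝒰' :=
  HopfStr.ext_of_comul (h.1.trans h'.1.symm) (h.2.trans h'.2.symm)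
    (h.isAlg_comul.ext he h'.isAlg_comul H)

end HasClassicalProduct

/-! ### Matched actions and coactions given on primitive generators -/

namespace Ser

section Comm

variable {A B : Type} [CommRing A] [Algebra ℂ A] [CommRing B] [Algebra ℂ B]

scoped instance instCommRingTensor : CommRing (@TensorProduct ℂ _ A B AddCommGroup.toAddCommMonoid
      AddCommGroup.toAddCommMonoid Algebra.toModule Algebra.toModule) where
  __ := Ser.instRingTensor
  mul_comm := mul_comm

end Comm

section Spread

variable {A X Y ι : Type} [CommRing A] [Algebra ℂ A] [AddCommGroup X] [Module ℂ X]
  [AddCommGroup Y] [Module ℂ Y] [Fintype ι]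

/-- The map `f ⊗ x ↦ D f ⊗ x + ∑ l, c l f ⊗ T l x`, through which a generator of `H` with coaction
`∑ l, c l ⊗ e l` acts on `A ⊗̂ X`, where `D` is its action on `A` and `T l` the action of `e l`
on `X`. -/
def spread (D : Ser A →ₗ[K] Ser A) (c : ι → Ser A) (T : ι → Ser X →ₗ[K] Ser X) :
    Ser (A ⊗[ℂ] X) →ₗ[K] Ser (A ⊗[ℂ] X) :=
  tmap D LinearMap.id + ∑ l, tmap (LinearMap.mulLeft K (c l)) (T l)

theorem spread_tmul (D : Ser A →ₗ[K] Ser A) (c : ι → Ser A) (T : ι → Ser X →ₗ[K] Ser X)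
    (f : Ser A) (x : Ser X) :
    spread D c T (tmul f x) = tmul (D f) x + ∑ l, tmul (c l * f) (T l x) := by
  simp [spread]

/-- The coefficients `c l` touch only the first factor, so a map of second factors that intertwines
the operators `T l` intertwines the whole step. This turns iterated coactions into recursions. -/
theorem tmap_spread (D : Ser A →ₗ[K] Ser A) (c : ι → Ser A) {T : ι → Ser X →ₗ[K] Ser X}
    {T' : ι → Ser Y →ₗ[K] Ser Y} {G : Ser X →ₗ[K] Ser Y} (h : ∀ l x, G (T l x) = T' l (G x))
    (z : Ser (A ⊗[ℂ] X)) :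
    tmap LinearMap.id G (spread D c T z) = spread D c T' (tmap LinearMap.id G z) := by
  refine LinearMap.congr_fun (f := tmap LinearMap.id G ∘ₗ spread D c T)
    (g := spread D c T' ∘ₗ tmap LinearMap.id G) (tmul_ext fun f x => ?_) z
  simp [spread_tmul, h]

end Spread

end Ser

section Bicross

variable {H A ι : Type} [Ring H] [Algebra ℂ H] [CommRing A] [Algebra ℂ A] [Fintype ι]
  [DecidableEq ι]

/-- The map `(f ⊗ x) ⊗ (M ⊗ (g ⊗ N)) ↦ (f ◁ M) g ⊗ G (x ⊗ N)`. -/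
def crossMap {X Y : Type} [AddCommGroup X] [Module ℂ X] [AddCommGroup Y] [Module ℂ Y]
    (act : Ser (A ⊗[ℂ] H) →ₗ[K] Ser A) (G : Ser (X ⊗[ℂ] H) →ₗ[K] Ser Y) :
    Ser ((A ⊗[ℂ] X) ⊗[ℂ] (H ⊗[ℂ] (A ⊗[ℂ] H))) →ₗ[K] Ser (A ⊗[ℂ] Y) :=
  tmap (mulMap A ∘ₗ tmap act LinearMap.id) G ∘ₗ coeffwise (shuffle A X H A H).toLinearMap

theorem crossMap_tmul {X Y : Type} [AddCommGroup X] [Module ℂ X] [AddCommGroup Y] [Module ℂ Y]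
    (act : Ser (A ⊗[ℂ] H) →ₗ[K] Ser A) (G : Ser (X ⊗[ℂ] H) →ₗ[K] Ser Y) (f g : Ser A) (x : Ser X)
    (M N : Ser H) : crossMap act G (tmul (tmul f x) (tmul M (tmul g N))) =
      tmul (act (tmul f M) * g) (G (tmul x N)) := by
  simp [crossMap]

/-- The data of an action and a coaction of a Hopf algebra `H`, generated by primitive elements
`e k`, on a commutative Hopf algebra `A`: the generator `e k` acts on `A` by the derivation `D k`
and has the coaction `∑ l, a k l ⊗ e l`. -/
structure BicrossData (ℋ : HopfStr H) (𝒜 : HopfStr A) (act : Ser (A ⊗[ℂ] H) →ₗ[K] Ser A)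
    (β : Ser H →ₗ[K] Ser (A ⊗[ℂ] H)) (e : ι → H) (D : ι → Ser A →ₗ[K] Ser A)
    (a : ι → ι → Ser A) : Prop where
  adjoin_e : Algebra.adjoin ℂ (Set.range e) = ⊤
  classical_H : HasClassicalProduct ℋ
  classical_A : HasClassicalProduct 𝒜
  comul_e : ∀ k, ℋ.comul (const (e k)) = tmul (const (e k)) 1 + tmul 1 (const (e k))
  counit_e : ∀ k, ℋ.counit (const (e k)) = 0
  D_mul : ∀ k f g, D k (f * g) = D k f * g + f * D k g
  act_one : ∀ f, act (tmul f 1) = f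
  act_mul_e : ∀ f L k, act (tmul f (L * const (e k))) = D k (act (tmul f L))
  coact_one : β 1 = tmul 1 1
  coact_mul_e : ∀ L k, β (L * const (e k)) =
    spread (D k) (a k) (fun l => LinearMap.mulRight K (const (e l))) (β L)
  comul_D : ∀ k f, 𝒜.comul (D k f) = spread (D k) (a k) D (𝒜.comul f)
  counit_D : ∀ k f, 𝒜.counit (D k f) = 0
  comul_a : ∀ k l, 𝒜.comul (a k l) = ∑ m, tmul (a k m) (a m l)
  counit_a : ∀ k l, toK (𝒜.counit (a k l)) = if k = l then 1 else 0

end Bicross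

namespace BicrossData

attribute [local simp] tmul_add add_tmul tmul_smul smul_tmul mul_add add_mul

variable {H A ι : Type} [Ring H] [Algebra ℂ H] [CommRing A] [Algebra ℂ A] [Fintype ι]
  [DecidableEq ι]
  {ℋ : HopfStr H} {𝒜 : HopfStr A} {act : Ser (A ⊗[ℂ] H) →ₗ[K] Ser A}
  {β : Ser H →ₗ[K] Ser (A ⊗[ℂ] H)} {e : ι → H} {D : ι → Ser A →ₗ[K] Ser A}
  {a : ι → ι → Ser A} (d : BicrossData ℋ 𝒜 act β e D a)

include d

theorem D_one (k : ι) : D k 1 = 0 := by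
  have := d.D_mul k 1 1
  simpa using this

theorem comul_mul_e (L : Ser H) (k : ι) : ℋ.comul (L * const (e k)) =
    ℋ.comul L * (tmul (const (e k)) 1 + tmul 1 (const (e k))) := by
  rw [d.classical_H.isAlg_comul.mul, d.comul_e]

theorem comul_one_H : ℋ.comul 1 = tmul 1 1 := by
  rw [d.classical_H.isAlg_comul.one, one_tmul_one]

theorem comul_one_A : 𝒜.comul 1 = tmul 1 1 := by
  rw [d.classical_A.isAlg_comul.one, one_tmul_one]

theorem counit_mul_e (L : Ser H) (k : ι) : ℋ.counit (L * const (e k)) = 0 := by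
  rw [d.classical_H.isAlg_counit.mul, d.counit_e, mul_zero]

/-- Induction along the coproduct of `ℋ`: the generator `e k` acts on `X`-valued functions of
`L₁ ⊗ L₂` by `S k`. -/
theorem comul_recursion {X : Type} [AddCommGroup X] [Module ℂ X] {F : Ser (H ⊗[ℂ] H) →ₗ[K] Ser X}
    {S : Ser X →ₗ[K] Ser X} {k : ι}
    (h : ∀ L M, F (tmul (L * const (e k)) M) + F (tmul L (M * const (e k))) = S (F (tmul L M)))
    (L : Ser H) : (F ∘ₗ ℋ.comul) (L * const (e k)) = S ((F ∘ₗ ℋ.comul) L) := by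
  rw [LinearMap.comp_apply, d.comul_mul_e]
  refine LinearMap.congr_fun (f := F ∘ₗ LinearMap.mulRight K
    (tmul (const (e k)) 1 + tmul 1 (const (e k)))) (g := S ∘ₗ F) (tmul_ext fun L M => ?_) _
  rw [LinearMap.comp_apply, LinearMap.mulRight_apply, mul_add, tmul_mul_tmul, tmul_mul_tmul,
    mul_one, mul_one, map_add, h, LinearMap.comp_apply]

/-- In each nontrivial axiom both sides, as functions of an element of ℋ, obey the recursion with
step `D k`. Compatibility with products is the Leibniz rule paired with primitivity of `e k`. -/
theorem isRightModuleAlgebra : IsRightModuleAlgebra ℋ 𝒜 act where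
  act_act f L M := by
    rw [d.classical_H.mul_tmul]
    refine LinearMap.congr_fun (f := act ∘ₗ tmulLeft (act (tmul f L)))
      (g := act ∘ₗ tmulLeft f ∘ₗ LinearMap.mulLeft K L)
      (recursion_ext d.adjoin_e ?_ (fun k => D k) (fun k u => ?_) (fun k u => ?_)) M
    · simp [d.act_one]
    · simp [d.act_mul_e]
    · simp [← mul_assoc, d.act_mul_e]
  act_one f := by rw [d.classical_H.2, const_one, d.act_one]
  mul_act f g L := by
    rw [d.classical_A.mul_tmul, d.classical_A.1]
    refine LinearMap.congr_fun (f := act ∘ₗ tmulLeft (f * g))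
      (g := (mulMap A ∘ₗ tmap act act ∘ₗ
        coeffwise (TensorProduct.tensorTensorTensorComm ℂ A A H H).toLinearMap ∘ₗ
          tmulLeft (tmul f g)) ∘ₗ ℋ.comul)
      (recursion_ext d.adjoin_e ?_ (fun k => D k) (fun k u => ?_)
        (fun k u => d.comul_recursion (fun L M => ?_) u)) L
    · simp [d.act_one, d.comul_one_H]
    · simp [d.act_mul_e]
    · simp [d.act_mul_e, d.D_mul]
  one_act L := by
    rw [d.classical_A.2, const_one]
    refine LinearMap.congr_fun (f := act ∘ₗ tmulLeft 1)
      (g := coeffwise (TensorProduct.lid ℂ A).toLinearMap ∘ₗ tmulRight 1 ∘ₗ ℋ.counit)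
      (recursion_ext d.adjoin_e ?_ (fun k => D k) (fun k u => ?_) (fun k u => ?_)) L
    · simp [d.act_one, d.classical_H.isAlg_counit.one, coeffwise_lid_tmul]
    · simp [d.act_mul_e]
    · simp [d.counit_mul_e, coeffwise_lid_tmul, d.D_one]

/-- The step for (Δ ⊗ id) β: `comul_D` rewrites Δ(D_k f) and `comul_a` splits Δ(a_kl), and together
they give exactly the nested step that also governs (id ⊗ β) β. -/
theorem assoc_comul_spread (k : ι) (b : Ser (A ⊗[ℂ] H)) :
    coeffwise (TensorProduct.assoc ℂ A A H).toLinearMap (tmap 𝒜.comul LinearMap.id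
      (spread (D k) (a k) (fun l => LinearMap.mulRight K (const (e l))) b)) =
    spread (D k) (a k) (fun l => spread (D l) (a l) fun m => LinearMap.mulRight K (const (e m)))
      (coeffwise (TensorProduct.assoc ℂ A A H).toLinearMap (tmap 𝒜.comul LinearMap.id b)) := by
  refine LinearMap.congr_fun (f := coeffwise (TensorProduct.assoc ℂ A A H).toLinearMap ∘ₗ
    tmap 𝒜.comul LinearMap.id ∘ₗ
      spread (D k) (a k) (fun l => LinearMap.mulRight K (const (e l))))
    (g := spread (D k) (a k)
      (fun l => spread (D l) (a l) fun m => LinearMap.mulRight K (const (e m))) ∘ₗ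
      coeffwise (TensorProduct.assoc ℂ A A H).toLinearMap ∘ₗ tmap 𝒜.comul LinearMap.id)
    (tmul_ext fun f M => ?_) b
  simp only [LinearMap.comp_apply, spread_tmul, map_add, map_sum, tmap_tmul, LinearMap.id_apply,
    LinearMap.mulRight_apply, d.comul_D, d.classical_A.isAlg_comul.mul, d.comul_a]
  generalize 𝒜.comul f = z
  refine isLinear_tmul_ext (f := fun z => coeffwise (TensorProduct.assoc ℂ A A H).toLinearMap
      (tmul (spread (D k) (a k) D z) M) + ∑ l, coeffwise (TensorProduct.assoc ℂ A A H).toLinearMap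
        (tmul ((∑ m, tmul (a k m) (a m l)) * z) (M * const (e l))))
    (g := fun z => spread (D k) (a k)
      (fun l => spread (D l) (a l) fun m => LinearMap.mulRight K (const (e m)))
      (coeffwise (TensorProduct.assoc ℂ A A H).toLinearMap (tmul z M))) ?_ ?_
      (fun f₁ f₂ => ?_) z
  · constructor <;> intros <;> simp [Finset.sum_add_distrib, Finset.smul_sum]; abel
  · constructor <;> intros <;> simp
  · simp only [spread_tmul, Finset.sum_mul, tmul_mul_tmul, add_tmul, sum_tmul, map_add, map_sum,
      coeffwise_assoc, tmul_add, tmul_sum, Finset.sum_add_distrib, LinearMap.mulRight_apply,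
      add_assoc]
    -- The intermediate index of the matrix coproduct is summed inside on one side and outside on
    -- the other.
    rw [Finset.sum_comm]

theorem coact_coassoc : tmap LinearMap.id β ∘ₗ β =
    coeffwise (TensorProduct.assoc ℂ A A H).toLinearMap ∘ₗ tmap 𝒜.comul LinearMap.id ∘ₗ β := by
  refine recursion_ext d.adjoin_e ?_ (fun k => spread (D k) (a k)
    (fun l => spread (D l) (a l) fun m => LinearMap.mulRight K (const (e m))))
    (fun k L => ?_) (fun k L => ?_)
  · simp [d.coact_one, d.comul_one_A]
  · simp only [LinearMap.comp_apply, d.coact_mul_e]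
    exact tmap_spread _ _ (fun l M => d.coact_mul_e M l) _
  · simp only [LinearMap.comp_apply, d.coact_mul_e]
    exact d.assoc_comul_spread k _

/-- Letting a generator act on one of two factors at a time is its action on the product: D_k is a
derivation, 𝒜 is commutative, and the coproduct of the primitive `e l` is the sum of its two
placements. -/
theorem mul_coact_spread (k : ι) (b c : Ser (A ⊗[ℂ] H)) :
    tmap (mulMap A) LinearMap.id
        (coeffwise (TensorProduct.tensorTensorTensorComm ℂ A H A H).toLinearMap
          (tmul (spread (D k) (a k) (fun l => LinearMap.mulRight K (const (e l))) b) c)) +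
      tmap (mulMap A) LinearMap.id
        (coeffwise (TensorProduct.tensorTensorTensorComm ℂ A H A H).toLinearMap
          (tmul b (spread (D k) (a k) (fun l => LinearMap.mulRight K (const (e l))) c))) =
    spread (D k) (a k) (fun l => LinearMap.mulRight K (ℋ.comul (const (e l))))
      (tmap (mulMap A) LinearMap.id
        (coeffwise (TensorProduct.tensorTensorTensorComm ℂ A H A H).toLinearMap (tmul b c))) := by
  refine isLinear_tmul_ext (f := fun b => tmap (mulMap A) LinearMap.id
        (coeffwise (TensorProduct.tensorTensorTensorComm ℂ A H A H).toLinearMap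
          (tmul (spread (D k) (a k) (fun l => LinearMap.mulRight K (const (e l))) b) c)) +
      tmap (mulMap A) LinearMap.id
        (coeffwise (TensorProduct.tensorTensorTensorComm ℂ A H A H).toLinearMap
          (tmul b (spread (D k) (a k) (fun l => LinearMap.mulRight K (const (e l))) c))))
    (g := fun b => spread (D k) (a k) (fun l => LinearMap.mulRight K (ℋ.comul (const (e l))))
      (tmap (mulMap A) LinearMap.id
        (coeffwise (TensorProduct.tensorTensorTensorComm ℂ A H A H).toLinearMap (tmul b c))))
    ?_ ?_ (fun f L => ?_) b
  · constructor <;> intros <;> simp; abel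
  · constructor <;> intros <;> simp
  refine isLinear_tmul_ext (f := fun c => tmap (mulMap A) LinearMap.id
        (coeffwise (TensorProduct.tensorTensorTensorComm ℂ A H A H).toLinearMap (tmul
          (spread (D k) (a k) (fun l => LinearMap.mulRight K (const (e l))) (tmul f L)) c)) +
      tmap (mulMap A) LinearMap.id
        (coeffwise (TensorProduct.tensorTensorTensorComm ℂ A H A H).toLinearMap (tmul (tmul f L)
          (spread (D k) (a k) (fun l => LinearMap.mulRight K (const (e l))) c))))
    (g := fun c => spread (D k) (a k) (fun l => LinearMap.mulRight K (ℋ.comul (const (e l))))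
      (tmap (mulMap A) LinearMap.id
        (coeffwise (TensorProduct.tensorTensorTensorComm ℂ A H A H).toLinearMap
          (tmul (tmul f L) c)))) ?_ ?_ (fun g M => ?_) c
  · constructor <;> intros <;> simp; abel
  · constructor <;> intros <;> simp
  simp only [spread_tmul, add_tmul, tmul_add, sum_tmul, tmul_sum, map_add, map_sum,
    coeffwise_tttComm, tmap_tmul, mulMap_tmul, LinearMap.id_apply, d.D_mul, d.comul_e,
    tmul_mul_tmul, mul_add, mul_one, Finset.sum_add_distrib, LinearMap.mulRight_apply, mul_assoc,
    mul_left_comm f]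
  abel

theorem coact_comul : tmap LinearMap.id ℋ.comul ∘ₗ β = tmap 𝒜.mul LinearMap.id ∘ₗ
    coeffwise (TensorProduct.tensorTensorTensorComm ℂ A H A H).toLinearMap ∘ₗ
      tmap β β ∘ₗ ℋ.comul := by
  rw [d.classical_A.1]
  refine recursion_ext d.adjoin_e ?_ (fun k => spread (D k) (a k)
    (fun l => LinearMap.mulRight K (ℋ.comul (const (e l))))) (fun k L => ?_)
    (fun k L => d.comul_recursion (F := tmap (mulMap A) LinearMap.id ∘ₗ
      coeffwise (TensorProduct.tensorTensorTensorComm ℂ A H A H).toLinearMap ∘ₗ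
      tmap β β) (fun L M => ?_) L)
  · simp [d.coact_one, d.comul_one_H]
  · simp only [LinearMap.comp_apply, d.coact_mul_e]
    exact tmap_spread _ _ (fun l M => d.classical_H.isAlg_comul.mul _ _) _
  · simp only [LinearMap.comp_apply, tmap_tmul, d.coact_mul_e]
    exact d.mul_coact_spread k _ _

theorem isLeftComoduleCoalgebra : IsLeftComoduleCoalgebra ℋ 𝒜 β where
  coassoc := d.coact_coassoc
  counit_coact := by
    refine recursion_ext d.adjoin_e ?_ (fun k z => z * const (e k)) (fun k L => ?_)
      (fun k L => rfl)
    · simp [d.coact_one, d.classical_A.isAlg_counit.one, coeffwise_lid_tmul]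
    · simp only [LinearMap.comp_apply, d.coact_mul_e]
      refine LinearMap.congr_fun (f := coeffwise (TensorProduct.lid ℂ H).toLinearMap ∘ₗ
          tmap 𝒜.counit LinearMap.id ∘ₗ
            spread (D k) (a k) (fun l => LinearMap.mulRight K (const (e l))))
        (g := LinearMap.mulRight K (const (e k)) ∘ₗ coeffwise (TensorProduct.lid ℂ H).toLinearMap ∘ₗ
          tmap 𝒜.counit LinearMap.id) (tmul_ext fun f M => ?_) _
      simp [spread_tmul, d.counit_D, d.classical_A.isAlg_counit.mul, coeffwise_lid_tmul,
        d.counit_a]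
  coact_counit L := by
    rw [d.classical_A.2, const_one]
    refine LinearMap.congr_fun (f := coeffwise (TensorProduct.rid ℂ A).toLinearMap ∘ₗ
      tmap LinearMap.id ℋ.counit ∘ₗ β)
      (g := coeffwise (TensorProduct.lid ℂ A).toLinearMap ∘ₗ tmulRight 1 ∘ₗ ℋ.counit)
      (recursion_ext d.adjoin_e ?_ (fun k => D k) (fun k L => ?_) (fun k L => ?_)) L
    · simp [d.coact_one, d.classical_H.isAlg_counit.one, coeffwise_lid_tmul, coeffwise_rid_tmul]
    · simp only [LinearMap.comp_apply, d.coact_mul_e]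
      refine LinearMap.congr_fun (f := coeffwise (TensorProduct.rid ℂ A).toLinearMap ∘ₗ
          tmap LinearMap.id ℋ.counit ∘ₗ
            spread (D k) (a k) (fun l => LinearMap.mulRight K (const (e l))))
        (g := D k ∘ₗ coeffwise (TensorProduct.rid ℂ A).toLinearMap ∘ₗ
          tmap LinearMap.id ℋ.counit) (tmul_ext fun f M => ?_) _
      simp [spread_tmul, d.counit_mul_e, coeffwise_rid_tmul]
    · simp [d.counit_mul_e, coeffwise_lid_tmul, d.D_one]
  coact_comul := d.coact_comul

/-- The common core of conditions (A) and (B): the first summand lets `e k` act through the module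
structure, the second through its coaction, and Leibniz merges them into one step. Taking `G` to be
the product of ℋ gives (B), taking it to be the action gives (A). -/
theorem crossMap_spread {X : Type} [AddCommGroup X] [Module ℂ X] {Y : Type} [AddCommGroup Y]
    [Module ℂ Y] (T : ι → Ser Y →ₗ[K] Ser Y) (G : Ser (X ⊗[ℂ] H) →ₗ[K] Ser Y)
    (hG : ∀ x M l, G (tmul x (M * const (e l))) = T l (G (tmul x M)))
    (k : ι) (b : Ser (A ⊗[ℂ] X)) (M : Ser H) (c : Ser (A ⊗[ℂ] H)) :
    crossMap act G (tmul b (tmul (M * const (e k)) c)) +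
      crossMap act G (tmul b (tmul M
        (spread (D k) (a k) (fun l => LinearMap.mulRight K (const (e l))) c))) =
    spread (D k) (a k) T (crossMap act G (tmul b (tmul M c))) := by
  refine isLinear_tmul_ext (f := fun b => crossMap act G (tmul b (tmul (M * const (e k)) c)) +
      crossMap act G (tmul b (tmul M
        (spread (D k) (a k) (fun l => LinearMap.mulRight K (const (e l))) c))))
    (g := fun b => spread (D k) (a k) T (crossMap act G (tmul b (tmul M c)))) ?_ ?_
    (fun f x => ?_) b
  · constructor <;> intros <;> simp; abel
  · constructor <;> intros <;> simp
  refine isLinear_tmul_ext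
    (f := fun c => crossMap act G (tmul (tmul f x) (tmul (M * const (e k)) c)) +
      crossMap act G (tmul (tmul f x) (tmul M
        (spread (D k) (a k) (fun l => LinearMap.mulRight K (const (e l))) c))))
    (g := fun c => spread (D k) (a k) T (crossMap act G (tmul (tmul f x) (tmul M c)))) ?_ ?_
    (fun g N => ?_) c
  · constructor <;> intros <;> simp; abel
  · constructor <;> intros <;> simp
  simp only [spread_tmul, tmul_add, tmul_sum, map_add, map_sum, crossMap_tmul,
    LinearMap.mulRight_apply, d.act_mul_e, d.D_mul, add_tmul, add_assoc, hG, mul_left_comm]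

theorem crossMap_one {X : Type} [AddCommGroup X] [Module ℂ X]
    (G : Ser (X ⊗[ℂ] H) →ₗ[K] Ser X) (hG : ∀ x, G (tmul x 1) = x) (b : Ser (A ⊗[ℂ] X)) :
    crossMap act G (tmul b (tmul 1 (tmul 1 1))) = b := by
  refine LinearMap.congr_fun (f := crossMap act G ∘ₗ tmulRight (tmul 1 (tmul 1 1)))
    (g := LinearMap.id) (tmul_ext fun f x => ?_) b
  simp [crossMap_tmul, d.act_one, hG]

theorem isMultiplicativeCoaction : IsMultiplicativeCoaction ℋ 𝒜 act β where
  coact_mul L M := by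
    rw [d.classical_H.mul_tmul, d.classical_H.1, d.classical_A.1]
    refine LinearMap.congr_fun (f := β ∘ₗ LinearMap.mulLeft K L)
      (g := (crossMap act (mulMap H) ∘ₗ tmulLeft (β L) ∘ₗ tmap LinearMap.id β) ∘ₗ ℋ.comul)
      (recursion_ext d.adjoin_e ?_
        (fun k => spread (D k) (a k) (fun l => LinearMap.mulRight K (const (e l))))
        (fun k M => ?_) (fun k M => d.comul_recursion (fun M N => ?_) M)) M
    · simp [d.comul_one_H, d.coact_one, d.crossMap_one (mulMap H) (by simp)]
    · simp [← mul_assoc, d.coact_mul_e]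
    · simp only [LinearMap.comp_apply, tmulLeft_apply, tmap_tmul, LinearMap.id_apply,
        d.coact_mul_e]
      exact d.crossMap_spread _ (mulMap H) (fun x M l => by simp [mul_assoc]) k _ _ _
  coact_one := by
    rw [d.classical_H.2, d.classical_A.2, const_one, const_one, d.coact_one]

/-- The flip and the coproduct are homomorphisms and agree on primitive generators. Needed for
condition (C). -/
theorem comul_cocommutative (L : Ser H) :
    coeffwise (TensorProduct.comm ℂ H H).toLinearMap (ℋ.comul L) = ℋ.comul L := by
  refine LinearMap.congr_fun
    (f := coeffwise (TensorProduct.comm ℂ H H).toLinearMap ∘ₗ ℋ.comul)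
    (IsAlg.ext d.adjoin_e (IsAlg.comm.comp d.classical_H.isAlg_comul)
      d.classical_H.isAlg_comul fun k => ?_) L
  simp only [LinearMap.comp_apply, d.comul_e, map_add, coeffwise_comm]
  exact add_comm _ _

theorem majidCompatible : MajidCompatible ℋ 𝒜 act β where
  toIsMultiplicativeCoaction := d.isMultiplicativeCoaction
  comul_act f L := by
    rw [d.classical_A.1]
    refine LinearMap.congr_fun (f := 𝒜.comul ∘ₗ act ∘ₗ tmulLeft f)
      (g := (crossMap act act ∘ₗ tmulLeft (𝒜.comul f) ∘ₗ tmap LinearMap.id β) ∘ₗ ℋ.comul)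
      (recursion_ext d.adjoin_e ?_ (fun k => spread (D k) (a k) D) (fun k M => ?_)
        (fun k M => d.comul_recursion (fun M N => ?_) M)) L
    · simp [d.act_one, d.comul_one_H, d.coact_one, d.crossMap_one act d.act_one]
    · simp [d.act_mul_e, d.comul_D]
    · simp only [LinearMap.comp_apply, tmulLeft_apply, tmap_tmul, LinearMap.id_apply,
        d.coact_mul_e]
      exact d.crossMap_spread D act d.act_mul_e k _ _ _
  counit_act f L := by
    refine LinearMap.congr_fun (f := 𝒜.counit ∘ₗ act ∘ₗ tmulLeft f)
      (g := coeffwise (LinearMap.mul' ℂ ℂ) ∘ₗ tmulLeft (𝒜.counit f) ∘ₗ ℋ.counit)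
      (recursion_ext d.adjoin_e ?_ (fun k z => 0) (fun k L => ?_) (fun k L => ?_)) L
    · simp [d.act_one, d.classical_H.isAlg_counit.one]
    · simp [d.act_mul_e, d.counit_D]
    · simp [d.counit_mul_e]
  coact_act f L := by
    rw [d.classical_A.1]
    -- The two sides of (C) differ by exchanging L₁ and L₂. Cocommutativity undoes the exchange, and
    -- what remains is commutativity of 𝒜 in the first leg.
    conv_rhs => rw [← d.comul_cocommutative]
    generalize ℋ.comul L = z
    refine LinearMap.congr_fun (f := tmap (mulMap A) LinearMap.id ∘ₗ
        coeffwise (TensorProduct.rightComm ℂ A H A).toLinearMap ∘ₗ tmap LinearMap.id act ∘ₗ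
          coeffwise (TensorProduct.leftComm ℂ A (A ⊗[ℂ] H) H).toLinearMap ∘ₗ
            tmulLeft f ∘ₗ tmap β LinearMap.id)
      (g := tmap (mulMap A) LinearMap.id ∘ₗ
        coeffwise (TensorProduct.assoc ℂ A A H).symm.toLinearMap ∘ₗ tmap act LinearMap.id ∘ₗ
          coeffwise (TensorProduct.assoc ℂ A H (A ⊗[ℂ] H)).symm.toLinearMap ∘ₗ
            tmulLeft f ∘ₗ tmap LinearMap.id β ∘ₗ
              coeffwise (TensorProduct.comm ℂ H H).toLinearMap) (tmul_ext fun L M => ?_) z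
    simp only [LinearMap.comp_apply, tmulLeft_apply, tmap_tmul, coeffwise_comm,
      coeffwise_leftComm, LinearMap.id_apply, coeffwise_assoc_symm]
    generalize β L = b
    refine LinearMap.congr_fun (f := tmap (mulMap A) LinearMap.id ∘ₗ
        coeffwise (TensorProduct.rightComm ℂ A H A).toLinearMap ∘ₗ tmulRight (act (tmul f M)))
      (g := tmap (mulMap A) LinearMap.id ∘ₗ
        coeffwise (TensorProduct.assoc ℂ A A H).symm.toLinearMap ∘ₗ tmulLeft (act (tmul f M)))
      (tmul_ext fun g N => ?_) b
    simp [mul_comm]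

end BicrossData

/-! ### Power series identities: the square root and Ξ -/

namespace Ser

section PowerSeriesMap

variable {U B : Type} [Ring U] [Algebra ℂ U] [Ring B] [Algebra ℂ B]

theorem coeff_ofPS (f : PowerSeries U) (n : ℕ) : (ofPS f).coeff n = PowerSeries.coeff n f := rfl

theorem ofPS_mul (f g : PowerSeries U) : ofPS (f * g) = ofPS f * ofPS g := by
  ext n; simp [coeff_ofPS, coeff_mul, PowerSeries.coeff_mul]

theorem ofPS_add (f g : PowerSeries U) : ofPS (f + g) = ofPS f + ofPS g := by
  ext n; simp [coeff_ofPS]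

theorem ofPS_neg (f : PowerSeries U) : ofPS (-f) = -ofPS f := by
  ext n; exact map_neg (PowerSeries.coeff n) f

theorem ofPS_sub (f g : PowerSeries U) : ofPS (f - g) = ofPS f - ofPS g := by
  rw [sub_eq_add_neg, ofPS_add, ofPS_neg, sub_eq_add_neg]

theorem ofPS_one : ofPS (1 : PowerSeries U) = 1 := by
  ext n; simp [coeff_ofPS, coeff_one, PowerSeries.coeff_one]

theorem ofPS_pow (f : PowerSeries U) (n : ℕ) : ofPS (f ^ n) = ofPS f ^ n := by
  induction n with
  | zero => rw [pow_zero, pow_zero, ofPS_one]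
  | succ n ih => rw [pow_succ, pow_succ, ofPS_mul, ih]

theorem ofPS_C (u : U) : ofPS (PowerSeries.C u) = const u := by
  ext n; simp [coeff_ofPS, coeff_const, PowerSeries.coeff_C]

theorem ofPS_sum {ι : Type} (s : Finset ι) (f : ι → PowerSeries U) :
    ofPS (∑ i ∈ s, f i) = ∑ i ∈ s, ofPS (f i) := by
  ext n; simp [coeff_ofPS, coeff_sum]

/-- The formal parameter as an element of `U[[h]]`. -/
def hSer (U : Type) [Ring U] [Algebra ℂ U] : Ser U := (PowerSeries.X : K) • 1

theorem hSer_mul (v : Ser U) : hSer U * v = (PowerSeries.X : K) • v := by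
  rw [hSer, smul_mul_assoc, one_mul]

theorem ofPS_X : ofPS (PowerSeries.X : PowerSeries U) = hSer U := by
  ext n
  cases n with
  | zero => simp [coeff_ofPS, hSer, coeff_X_smul_zero]
  | succ n => simp [coeff_ofPS, hSer, coeff_X_smul_succ, coeff_one, PowerSeries.coeff_X]

theorem coeffwise_ofPS (f : U →ₐ[ℂ] B) (g : PowerSeries U) :
    coeffwise f.toLinearMap (ofPS g) = ofPS (PowerSeries.map (f : U →+* B) g) := by
  ext n; simp [coeff_ofPS]

theorem coeff_zero_mul (a b : Ser U) : (a * b).coeff 0 = a.coeff 0 * b.coeff 0 := by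
  simp [coeff_mul]

theorem coeff_zero_map {V W : Type} [AddCommGroup V] [Module ℂ V] [AddCommGroup W] [Module ℂ W]
    (F : Ser V →ₗ[K] Ser W) (v : Ser V) :
    (F v).coeff 0 = (F (const (v.coeff 0))).coeff 0 := by
  conv_lhs => rw [← const_add_X_smul_shift v]
  rw [map_add, map_smul, coeff_add, coeff_X_smul_zero, add_zero]

/-- If all lower coefficients of d vanish, the coefficient of h^n in v d is v₀ d_n, and v₀ is
invertible. The ring may be noncommutative. -/
theorem eq_zero_of_mul_eq_zero {v d : Ser U} (hv : IsUnit (v.coeff 0)) (h : v * d = 0) : d = 0 := by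
  ext n
  induction n using Nat.strong_induction_on with
  | _ n ih =>
    have hn : (v * d).coeff n = 0 := by rw [h, coeff_zero]
    rw [coeff_mul, Finset.sum_eq_single (0, n)] at hn
    · exact (hv.mul_right_eq_zero).1 hn
    · rintro ⟨i, j⟩ hij hne
      have hj : j < n := by
        have := Finset.HasAntidiagonal.mem_antidiagonal.1 hij
        have hi : i ≠ 0 := by
          rintro rfl
          exact hne (by simpa using hij)
        simp only at this
        omega
      rw [ih j hj, coeff_zero, mul_zero]
    · intro hn
      simp at hn

theorem isUnit_two : IsUnit (2 : U) := by
  have : (2 : U) = algebraMap ℂ U 2 := (map_ofNat (algebraMap ℂ U) 2).symm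
  rw [this]
  exact (IsUnit.mk0 (2 : ℂ) two_ne_zero).map _

/-- In (a + b)(a - b) = 0 the first factor has constant term 2, which is invertible, so it cancels.
-/
theorem eq_of_sq_eq_sq {A : Type} [CommRing A] [Algebra ℂ A] {a b : Ser A} (ha : a.coeff 0 = 1)
    (hb : b.coeff 0 = 1) (h : a ^ 2 = b ^ 2) : a = b := by
  refine sub_eq_zero.1 (eq_zero_of_mul_eq_zero (v := a + b) ?_ (by linear_combination h))
  rw [coeff_add, ha, hb, one_add_one_eq_two]
  exact isUnit_two

end PowerSeriesMap

end Ser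

section Sqrt

variable {U B : Type} [Ring U] [Algebra ℂ U] [Ring B] [Algebra ℂ B] (p : Fin 3 → U) (e : U)

/-- Only powers of the single element P² occur, so commutativity of U is not needed. The
coefficients are handled by the Vandermonde identity for binomial coefficients of 1/2. -/
theorem sqrtSeries_sq :
    sqrtSeries p e ^ 2 = 1 - PowerSeries.X ^ 2 * PowerSeries.C (minkowskiSq p e) := by
  have hc : ∀ n, PowerSeries.coeff n (sqrtSeries p e) = if Even n then
      ((-1 : ℂ) ^ (n / 2) * Ring.choose (1 / 2 : ℂ) (n / 2)) • minkowskiSq p e ^ (n / 2) else 0 :=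
    fun n => by rw [sqrtSeries, PowerSeries.coeff_mk]
  have hr : ∀ n, PowerSeries.coeff n (1 - PowerSeries.X ^ 2 * PowerSeries.C (minkowskiSq p e)) =
      (if n = 0 then 1 else 0) - (if n = 2 then minkowskiSq p e else 0) := fun n => by
    rw [map_sub, PowerSeries.coeff_one, PowerSeries.coeff_mul_C, PowerSeries.coeff_X_pow]
    split_ifs <;> simp
  ext n
  rw [hr, pow_two, PowerSeries.coeff_mul]
  rcases Nat.even_or_odd n with hn | hn
  · obtain ⟨k, rfl⟩ := hn
    -- In even total degree, a pair of odd indices contributes nothing, so the sum runs over pairs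
    -- of halves.
    have h1 : ∑ ij ∈ antidiagonal (k + k), PowerSeries.coeff ij.1 (sqrtSeries p e) *
        PowerSeries.coeff ij.2 (sqrtSeries p e) =
        ∑ ij ∈ antidiagonal k, PowerSeries.coeff (2 * ij.1) (sqrtSeries p e) *
          PowerSeries.coeff (2 * ij.2) (sqrtSeries p e) := by
      symm
      refine Finset.sum_of_injOn (fun ij => (2 * ij.1, 2 * ij.2)) ?_ ?_ ?_ ?_
      · rintro ⟨a, b⟩ _ ⟨c, d⟩ _ h
        simp only [Prod.mk.injEq] at h ⊢
        omega
      · rintro ⟨a, b⟩ h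
        simp only [Finset.mem_coe, Finset.HasAntidiagonal.mem_antidiagonal] at h ⊢
        omega
      · rintro ⟨a, b⟩ h h'
        rw [hc a]
        by_cases ha : Even a
        · exfalso
          obtain ⟨c, rfl⟩ := ha
          rw [Finset.HasAntidiagonal.mem_antidiagonal] at h
          simp only at h
          refine h' ⟨(c, k - c), ?_, ?_⟩
          · simp only [Finset.mem_coe, Finset.HasAntidiagonal.mem_antidiagonal]
            omega
          · simp only [Prod.mk.injEq]
            omega
        · rw [if_neg ha, zero_mul]
      · simp
    rw [h1]
    have h2 : ∀ ij ∈ antidiagonal k, PowerSeries.coeff (2 * ij.1) (sqrtSeries p e) *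
          PowerSeries.coeff (2 * ij.2) (sqrtSeries p e) =
        ((-1 : ℂ) ^ k * (Ring.choose (1 / 2 : ℂ) ij.1 * Ring.choose (1 / 2 : ℂ) ij.2)) •
          minkowskiSq p e ^ k := by
      rintro ⟨a, b⟩ h
      rw [Finset.HasAntidiagonal.mem_antidiagonal] at h
      simp only at h
      subst h
      rw [hc, hc, if_pos (even_two_mul _), if_pos (even_two_mul _), smul_mul_smul_comm]
      simp only [Nat.mul_div_cancel_left _ two_pos, pow_add]
      congr 1
      ring
    rw [Finset.sum_congr rfl h2, ← Finset.sum_smul, ← Finset.mul_sum,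
      ← Ring.add_choose_eq k (Commute.all _ _), show (1 / 2 : ℂ) + 1 / 2 = ((1 : ℕ) : ℂ) by norm_num,
      Ring.choose_natCast]
    -- By Vandermonde the sum is binom(1, k): it is 1 for k = 0 and k = 1 and vanishes afterwards.
    -- The term k = 1 carries the sign -1.
    rcases k with _ | _ | k
    · simp
    · simp
    · rw [Nat.choose_eq_zero_of_lt (by omega), if_neg (by omega), if_neg (by omega)]
      simp
  · rw [Finset.sum_eq_zero, if_neg, if_neg, sub_zero]
    · rintro rfl; exact absurd hn (by decide)
    · rintro rfl; exact absurd hn (by decide)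
    · rintro ⟨a, b⟩ h
      rw [Finset.HasAntidiagonal.mem_antidiagonal] at h
      simp only at h
      subst h
      rw [hc a, hc b]
      by_cases ha : Even a
      · have hb : ¬ Even b := fun hb => Nat.not_even_iff_odd.2 hn (ha.add hb)
        rw [if_neg hb, mul_zero]
      · rw [if_neg ha, zero_mul]

theorem map_sqrtSeries (f : U →ₐ[ℂ] B) : PowerSeries.map (f : U →+* B) (sqrtSeries p e) =
    sqrtSeries (fun i => f (p i)) (f e) := by
  ext n
  simp only [sqrtSeries, PowerSeries.coeff_map, PowerSeries.coeff_mk]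
  split_ifs
  · simp [minkowskiSq]
  · simp

theorem map_Xi (f : U →ₐ[ℂ] B) : PowerSeries.map (f : U →+* B) (Xi p e) =
    Xi (fun i => f (p i)) (f e) := by
  simp [Xi, map_sqrtSeries]

theorem map_XiInv (f : U →ₐ[ℂ] B) : PowerSeries.map (f : U →+* B) (XiInv p e) =
    XiInv (fun i => f (p i)) (f e) := by
  refine left_inv_eq_right_inv (a := Xi (fun i => f (p i)) (f e)) ?_ (Xi_mul_XiInv _ _)
  rw [← map_Xi, ← map_mul, XiInv_mul_Xi, map_one]

theorem map_hPXiInv (f : U →ₐ[ℂ] B) (i : Fin 3) :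
    PowerSeries.map (f : U →+* B) (hPXiInv p e i) = hPXiInv (fun i => f (p i)) (f e) i := by
  simp [hPXiInv, map_XiInv]

/-- The series `√(1 - h² P²)`, `Ξ` and `Ξ⁻¹` as elements of `U[[h]]`. -/
abbrev sqrtSer : Ser U := ofPS (sqrtSeries p e)

theorem ofPS_Xi : ofPS (Xi p e) = hSer U * const e + sqrtSer p e := by
  rw [Xi, ofPS_add, ofPS_mul, ofPS_X, ofPS_C]

theorem ofPS_hPXiInv (i : Fin 3) :
    ofPS (hPXiInv p e i) = hSer U * const (p i) * ofPS (XiInv p e) := by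
  rw [hPXiInv, ofPS_mul, ofPS_mul, ofPS_X, ofPS_C]

theorem Xi_mul_XiInv_ser : ofPS (Xi p e) * ofPS (XiInv p e) = 1 := by
  rw [← ofPS_mul, Xi_mul_XiInv, ofPS_one]

theorem const_pow (u : U) (n : ℕ) : (const (u ^ n) : Ser U) = const u ^ n := by
  induction n with
  | zero => rw [pow_zero, pow_zero, const_one]
  | succ n ih => rw [pow_succ, pow_succ, const_mul, ih]

theorem sqrtSer_sq : sqrtSer p e ^ 2 =
    1 - hSer U ^ 2 * (const (p 0) ^ 2 + const (p 1) ^ 2 + const (p 2) ^ 2 - const e ^ 2) := by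
  rw [← ofPS_pow, sqrtSeries_sq, ofPS_sub, ofPS_one, ofPS_mul, ofPS_pow, ofPS_X, ofPS_C,
    minkowskiSq, Fin.sum_univ_three, map_sub, map_add, map_add, const_pow, const_pow, const_pow,
    const_pow]

theorem coeff_zero_sqrtSer : (sqrtSer p e).coeff 0 = 1 := by
  rw [coeff_ofPS, sqrtSeries, PowerSeries.coeff_mk]
  simp

theorem coeff_zero_Xi : (ofPS (Xi p e)).coeff 0 = 1 := by
  rw [ofPS_Xi, coeff_add, coeff_zero_sqrtSer, hSer_mul, coeff_X_smul_zero, zero_add]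

theorem coeff_zero_XiInv : (ofPS (XiInv p e)).coeff 0 = 1 := by
  have := congrArg (fun z => z.coeff 0) (Xi_mul_XiInv_ser p e)
  simpa only [coeff_zero_mul, coeff_zero_Xi, one_mul, coeff_one, if_true] using this

end Sqrt

/-! ### Enveloping algebras: universal property and generation -/

section Lift

attribute [local instance 100] LieRing.ofAssociativeRing

variable {L R B : Type} [LieRing L] [LieAlgebra ℂ L] [Ring R] [Algebra ℂ R] [Ring B] [Algebra ℂ B]

/-- The algebra homomorphism out of an enveloping algebra with given values on generators. -/
def liftAlg (f : L →ₗ[ℂ] R) (hf : ∀ x y, f ⁅x, y⁆ = f x * f y - f y * f x) :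
    UniversalEnvelopingAlgebra ℂ L →ₐ[ℂ] R :=
  UniversalEnvelopingAlgebra.lift ℂ
    { f with map_lie' := fun {x y} => (hf x y).trans (LieRing.of_associative_ring_bracket _ _).symm }

@[simp] theorem liftAlg_gen (f : L →ₗ[ℂ] R) (hf : ∀ x y, f ⁅x, y⁆ = f x * f y - f y * f x) (x : L) :
    liftAlg f hf (gen x) = f x := by
  rw [liftAlg, gen, UniversalEnvelopingAlgebra.lift_ι_apply]
  rfl

theorem gen_lie (x y : L) : gen ⁅x, y⁆ = gen x * gen y - gen y * gen x := by
  rw [gen, LieHom.map_lie, LieRing.of_associative_ring_bracket]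

theorem gen_add (x y : L) : gen (x + y) = gen x + gen y := map_add _ _ _

theorem gen_sub (x y : L) : gen (x - y) = gen x - gen y := map_sub _ _ _

theorem gen_neg (x : L) : gen (-x) = -gen x := map_neg _ _

theorem gen_smul (c : ℂ) (x : L) : gen (c • x) = c • gen x := map_smul _ _ _

theorem gen_zero : gen (0 : L) = 0 := map_zero _

theorem gen_sum {ι : Type} (s : Finset ι) (x : ι → L) : gen (∑ i ∈ s, x i) = ∑ i ∈ s, gen (x i) :=
  map_sum _ _ _

variable (L) in
/-- The inclusion of a Lie algebra in its enveloping algebra, as a linear map. -/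
def genMap : L →ₗ[ℂ] UniversalEnvelopingAlgebra ℂ L where
  toFun := gen
  map_add' := gen_add
  map_smul' := gen_smul

theorem genMap_apply (x : L) : genMap L x = gen x := rfl

/-- The inclusion of L into the generated subalgebra S extends to the enveloping algebra; followed
by S ⊆ U it is the identity on generators, hence everywhere, so S is all of U. -/
theorem adjoin_gen : Algebra.adjoin ℂ (Set.range (gen : L → UniversalEnvelopingAlgebra ℂ L)) =
    ⊤ := by
  refine eq_top_iff.2 fun u _ => ?_
  set S := Algebra.adjoin ℂ (Set.range (gen : L → UniversalEnvelopingAlgebra ℂ L))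
  have hS : ∀ x : L, gen x ∈ S := fun x => Algebra.subset_adjoin ⟨x, rfl⟩
  let f : L →ₗ[ℂ] S := LinearMap.codRestrict (Subalgebra.toSubmodule S)
    (UniversalEnvelopingAlgebra.ι ℂ : L →ₗ⁅ℂ⁆ _).toLinearMap hS
  have hf : ∀ x y, f ⁅x, y⁆ = f x * f y - f y * f x := fun x y => Subtype.ext (gen_lie x y)
  have : S.val.comp (liftAlg f hf) = AlgHom.id ℂ _ := by
    refine UniversalEnvelopingAlgebra.hom_ext ℂ (LieHom.ext fun x => ?_)
    change S.val (liftAlg f hf (gen x)) = gen x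
    rw [liftAlg_gen]
    rfl
  have h := AlgHom.congr_fun this u
  rw [AlgHom.comp_apply, AlgHom.id_apply] at h
  rw [← h]
  exact (liftAlg f hf u).2

theorem adjoin_gen_of_span {ι : Type} {e : ι → L} (he : ⊤ ≤ Submodule.span ℂ (Set.range e)) :
    Algebra.adjoin ℂ (Set.range fun k => gen (e k)) = ⊤ := by
  refine eq_top_iff.2 ?_
  rw [← adjoin_gen]
  refine Algebra.adjoin_le ?_
  rintro _ ⟨x, rfl⟩
  have hx : x ∈ Submodule.span ℂ (Set.range e) := he trivial
  induction hx using Submodule.span_induction with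
  | mem x hx =>
    obtain ⟨k, rfl⟩ := hx
    exact Algebra.subset_adjoin ⟨k, rfl⟩
  | zero => rw [gen, map_zero]; exact zero_mem _
  | add x y _ _ hx hy => rw [gen, map_add]; exact add_mem hx hy
  | smul c x _ hx => rw [gen, map_smul]; exact Subalgebra.smul_mem _ hx c

/-- The homomorphism from the series over an enveloping algebra to an algebra of series with given
values on generators. -/
def liftSer (f : L →ₗ[ℂ] Ser B) (hf : ∀ x y, f ⁅x, y⁆ = f x * f y - f y * f x) :
    Ser (UniversalEnvelopingAlgebra ℂ L) →ₗ[K] Ser B :=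
  extend (liftAlg f hf).toLinearMap

@[simp] theorem liftSer_gen (f : L →ₗ[ℂ] Ser B) (hf : ∀ x y, f ⁅x, y⁆ = f x * f y - f y * f x)
    (x : L) : liftSer f hf (const (gen x)) = f x := by
  rw [liftSer, extend_const, AlgHom.toLinearMap_apply, liftAlg_gen]

theorem isAlg_liftSer (f : L →ₗ[ℂ] Ser B) (hf : ∀ x y, f ⁅x, y⁆ = f x * f y - f y * f x) :
    IsAlg (liftSer f hf) :=
  .of_const (by rw [← const_one, liftSer, extend_const]; simp) fun u v => by
    rw [← const_mul, liftSer, extend_const, extend_const, extend_const]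
    simp

end Lift

/-! ### Bases and the classical action of o(1,3) on the momenta -/

section Coordinates

theorem Lorentz.ext_comp {x y : Lorentz} (hm : ∀ i, x.m i = y.m i) (hn : ∀ i, x.n i = y.n i) :
    x = y := Lorentz.ext (funext hm) (funext hn)

theorem Translations.ext_comp {x y : Translations} (hp : ∀ i, x.p i = y.p i) (ht : x.t = y.t) :
    x = y := Translations.ext (funext hp) ht

@[simp] theorem Translations.add_p (x y : Translations) (i : Fin 3) :
    (x + y).p i = x.p i + y.p i := rfl
@[simp] theorem Translations.add_t (x y : Translations) : (x + y).t = x.t + y.t := rfl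
@[simp] theorem Translations.sub_p (x y : Translations) (i : Fin 3) :
    (x - y).p i = x.p i - y.p i := rfl
@[simp] theorem Translations.sub_t (x y : Translations) : (x - y).t = x.t - y.t := rfl
@[simp] theorem Translations.zero_p (i : Fin 3) : (0 : Translations).p i = 0 := rfl
@[simp] theorem Translations.zero_t : (0 : Translations).t = 0 := rfl
@[simp] theorem Translations.smul_p (c : ℂ) (x : Translations) (i : Fin 3) :
    (c • x).p i = c * x.p i := rfl
@[simp] theorem Translations.smul_t (c : ℂ) (x : Translations) : (c • x).t = c * x.t := rfl
@[simp] theorem Lorentz.M_m (i k : Fin 3) : (Lorentz.M i).m k = if k = i then 1 else 0 := by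
  simp [Lorentz.M, Pi.single_apply]
@[simp] theorem Lorentz.M_n (i k : Fin 3) : (Lorentz.M i).n k = 0 := rfl
@[simp] theorem Lorentz.N_m (i k : Fin 3) : (Lorentz.N i).m k = 0 := rfl
@[simp] theorem Lorentz.N_n (i k : Fin 3) : (Lorentz.N i).n k = if k = i then 1 else 0 := by
  simp [Lorentz.N, Pi.single_apply]
@[simp] theorem Translations.P_p (i k : Fin 3) :
    (Translations.P i).p k = if k = i then 1 else 0 := by simp [Translations.P, Pi.single_apply]
@[simp] theorem Translations.P_t (i : Fin 3) : (Translations.P i).t = 0 := rfl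
@[simp] theorem Translations.P4_p (k : Fin 3) : Translations.P4.p k = 0 := rfl
@[simp] theorem Translations.P4_t : Translations.P4.t = 1 := rfl

/-- The basis `M i`, `N i` of the Lorentz algebra. -/
def lorentzGen : Fin 3 ⊕ Fin 3 → Lorentz := Sum.elim Lorentz.M Lorentz.N

/-- The basis `P i`, `P₄` of the translations. -/
def transGen : Fin 3 ⊕ Unit → Translations := Sum.elim Translations.P fun _ => Translations.P4

theorem Lorentz.eq_sum (x : Lorentz) :
    x = ∑ i, x.m i • Lorentz.M i + ∑ i, x.n i • Lorentz.N i := by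
  refine Lorentz.ext_comp (fun i => ?_) (fun i => ?_) <;> fin_cases i <;>
    simp [Fin.sum_univ_three]

theorem Translations.eq_sum (x : Translations) :
    x = ∑ i, x.p i • Translations.P i + x.t • Translations.P4 := by
  refine Translations.ext_comp (fun i => ?_) ?_
  · fin_cases i <;> simp [Fin.sum_univ_three]
  · simp [Fin.sum_univ_three]

theorem lorentz_span : ⊤ ≤ Submodule.span ℂ (Set.range lorentzGen) := fun x _ => by
  rw [x.eq_sum]
  refine add_mem (sum_mem fun i _ => Submodule.smul_mem _ _ (Submodule.subset_span ⟨.inl i, rfl⟩))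
    (sum_mem fun i _ => Submodule.smul_mem _ _ (Submodule.subset_span ⟨.inr i, rfl⟩))

theorem trans_span : ⊤ ≤ Submodule.span ℂ (Set.range transGen) := fun x _ => by
  rw [x.eq_sum]
  refine add_mem (sum_mem fun i _ => Submodule.smul_mem _ _ (Submodule.subset_span ⟨.inl i, rfl⟩))
    (Submodule.smul_mem _ _ (Submodule.subset_span ⟨.inr (), rfl⟩))

/-- The elements `M i`, `N i` as generators of the enveloping algebra. -/
abbrev eL (k : Fin 3 ⊕ Fin 3) : ULorentz := gen (lorentzGen k)

theorem eL_inl (i : Fin 3) : eL (.inl i) = gen (Lorentz.M i) := rfl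

theorem eL_inr (i : Fin 3) : eL (.inr i) = gen (Lorentz.N i) := rfl

theorem adjoin_eL : Algebra.adjoin ℂ (Set.range eL) = ⊤ := adjoin_gen_of_span lorentz_span

theorem adjoin_transGen : Algebra.adjoin ℂ (Set.range fun k => (gen (transGen k) : UTranslations)) = ⊤ :=
  adjoin_gen_of_span trans_span

/-- The right action of the Lorentz algebra on the translations. -/
def ract : Lorentz →ₗ[ℂ] Translations →ₗ[ℂ] Translations :=
  LinearMap.mk₂ ℂ (fun x q =>
    { p := fun l => Complex.I * ∑ j, ∑ k, eps j k l * (q.p j * x.m k) + Complex.I * (q.t * x.n l)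
      t := Complex.I * ∑ j, q.p j * x.n j })
    (fun x x' q => Translations.ext_comp
      (fun l => by simp only [Lorentz.sum_eps, Translations.add_p, Lorentz.add_m, Lorentz.add_n]; ring)
      (by simp [Fin.sum_univ_three]; ring))
    (fun c x q => Translations.ext_comp
      (fun l => by simp only [Lorentz.sum_eps, Translations.smul_p, Lorentz.smul_m, Lorentz.smul_n]; ring)
      (by simp [Fin.sum_univ_three]; ring))
    (fun x q q' => Translations.ext_comp
      (fun l => by simp only [Lorentz.sum_eps, Translations.add_p, Translations.add_t]; ring)
      (by simp [Fin.sum_univ_three]; ring))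
    (fun c x q => Translations.ext_comp
      (fun l => by simp only [Lorentz.sum_eps, Translations.smul_p, Translations.smul_t]; ring)
      (by simp [Fin.sum_univ_three]; ring))

theorem ract_p (x : Lorentz) (q : Translations) (l : Fin 3) : (ract x q).p l =
    Complex.I * ∑ j, ∑ k, eps j k l * (q.p j * x.m k) + Complex.I * (q.t * x.n l) := rfl
theorem ract_t (x : Lorentz) (q : Translations) :
    (ract x q).t = Complex.I * ∑ j, q.p j * x.n j := rfl

/-- The order on the right is the one for a right action: `y` applied after `x` comes with the plus
sign. -/
theorem ract_lie (x y : Lorentz) (q : Translations) :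
    ract ⁅x, y⁆ q = ract y (ract x q) - ract x (ract y q) := by
  refine Translations.ext_comp (fun l => ?_) ?_
  · simp only [ract_p, ract_t, Lorentz.bracket_m, Lorentz.bracket_n, Lorentz.sum_eps,
      Translations.sub_p]
    fin_cases l <;> simp [Fin.sum_univ_three] <;> ring
  · simp only [ract_p, ract_t, Lorentz.bracket_n, Lorentz.sum_eps, Translations.sub_t]
    simp [Fin.sum_univ_three]
    ring

end Coordinates

/-! ### Commutativity of the translations and the action by derivations -/

section Trans

theorem UTranslations.mul_comm (u v : UTranslations) : u * v = v * u := by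
  have hgen : ∀ x y : Translations, (gen x : UTranslations) * gen y = gen y * gen x := fun x y => by
    have := gen_lie x y
    rw [show ⁅x, y⁆ = 0 from rfl, gen, map_zero] at this
    exact (sub_eq_zero.1 this.symm)
  have key : ∀ (y : Translations) (u : UTranslations), u * gen y = gen y * u := fun y u => by
    refine right_induction adjoin_gen (p := fun u => u * gen y = gen y * u) (by simp)
      (fun u k h => ?_) (by simp) (fun u v hu hv => by rw [add_mul, hu, hv, mul_add])
      (fun c u hu => by rw [smul_mul_assoc, hu, mul_smul_comm]) u
    rw [mul_assoc, hgen, ← mul_assoc, h, mul_assoc]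
  refine right_induction adjoin_gen (p := fun v => u * v = v * u) (by simp)
    (fun v k h => ?_) (by simp) (fun u v hu hv => by rw [mul_add, hu, hv, add_mul])
    (fun c u hu => by rw [mul_smul_comm, hu, smul_mul_assoc]) v
  rw [← mul_assoc, h, mul_assoc, key, mul_assoc]

namespace Ser

scoped instance instCommRingUTranslations : CommRing UTranslations where
  __ := (inferInstance : Ring UTranslations)
  mul_comm := UTranslations.mul_comm

end Ser

/-- The homomorphism `u ↦ u + D u ε` to the dual numbers, for the derivation `D` which extends a
linear map. -/
def dualLift (δ : Translations →ₗ[ℂ] Translations) :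
    UTranslations →ₐ[ℂ] TrivSqZeroExt UTranslations UTranslations :=
  liftAlg ((TrivSqZeroExt.inlAlgHom ℂ UTranslations UTranslations).toLinearMap ∘ₗ
      genMap Translations +
    (TrivSqZeroExt.inrHom UTranslations UTranslations).restrictScalars ℂ ∘ₗ
      genMap Translations ∘ₗ δ)
    -- Dual numbers over a commutative algebra commute, so the relations of the abelian Lie algebra
    -- hold automatically.
    (fun x y => by rw [_root_.mul_comm, sub_self, show ⁅x, y⁆ = 0 from rfl, map_zero])

theorem dualLift_gen (δ : Translations →ₗ[ℂ] Translations) (x : Translations) :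
    dualLift δ (gen x) = TrivSqZeroExt.inl (gen x) + TrivSqZeroExt.inr (gen (δ x)) := by
  rw [dualLift, liftAlg_gen]
  rfl

/-- With the identity as first component, multiplicativity of the map to dual numbers says precisely
that the second component satisfies the Leibniz rule. -/
theorem fst_dualLift (δ : Translations →ₗ[ℂ] Translations) (u : UTranslations) :
    (dualLift δ u).fst = u := by
  refine right_induction adjoin_gen (p := fun u => (dualLift δ u).fst = u) (by simp)
    (fun u k h => ?_) (by simp) (fun u v hu hv => by simp [hu, hv])
    (fun c u hu => by simp [hu]) u
  rw [map_mul, TrivSqZeroExt.fst_mul, h, dualLift_gen]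
  simp

/-- The derivation of the enveloping algebra of the translations which extends a linear map. -/
def derivationOf (δ : Translations →ₗ[ℂ] Translations) :
    Derivation ℂ UTranslations UTranslations :=
  Derivation.mk' ((TrivSqZeroExt.sndHom UTranslations UTranslations).restrictScalars ℂ ∘ₗ
    (dualLift δ).toLinearMap) fun a b => by
      simp [TrivSqZeroExt.snd_mul, fst_dualLift, _root_.mul_comm b]

@[simp] theorem derivationOf_gen (δ : Translations →ₗ[ℂ] Translations) (x : Translations) :
    derivationOf δ (gen x) = gen (δ x) := by
  change (dualLift δ (gen x)).snd = _
  rw [dualLift_gen]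
  simp

theorem derivation_ext {d d' : Derivation ℂ UTranslations UTranslations}
    (h : ∀ x : Translations, d (gen x) = d' (gen x)) : d = d' :=
  Derivation.ext_of_adjoin_eq_top _ adjoin_gen (by rintro _ ⟨x, rfl⟩; exact h x)

/-- The right action of the Lorentz algebra by derivations of the enveloping algebra. -/
def lorentzDer : Lorentz →ₗ[ℂ] Derivation ℂ UTranslations UTranslations where
  toFun x := derivationOf (ract x)
  map_add' x y := derivation_ext fun q => by
    rw [Derivation.add_apply, derivationOf_gen, derivationOf_gen, derivationOf_gen, map_add,
      LinearMap.add_apply, gen_add]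
  map_smul' c x := derivation_ext fun q => by
    rw [Derivation.smul_apply, derivationOf_gen, derivationOf_gen, map_smul, LinearMap.smul_apply,
      gen_smul, RingHom.id_apply]

theorem lorentzDer_gen (x : Lorentz) (q : Translations) :
    lorentzDer x (gen q) = gen (ract x q) := derivationOf_gen _ _

/-- A commutator of derivations is a derivation, so only generators need comparing, where `ract_lie`
applies. The reversal reflects the right action. -/
theorem lorentzDer_lie (x y : Lorentz) :
    lorentzDer ⁅x, y⁆ = ⁅lorentzDer y, lorentzDer x⁆ :=
  derivation_ext fun q => by
    rw [Derivation.commutator_apply, lorentzDer_gen, lorentzDer_gen, lorentzDer_gen, lorentzDer_gen,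
      lorentzDer_gen, ract_lie, gen_sub]

/-- The right action of the Lorentz algebra on series. -/
def DL (x : Lorentz) : Ser UTranslations →ₗ[K] Ser UTranslations :=
  coeffwise (lorentzDer x).toLinearMap

theorem DL_const (x : Lorentz) (u : UTranslations) : DL x (const u) = const (lorentzDer x u) :=
  coeffwise_const _ _

theorem DL_mul (x : Lorentz) (u v : Ser UTranslations) : DL x (u * v) = DL x u * v + u * DL x v := by
  refine isLinear_ext (f := fun u => DL x (u * v)) (g := fun u => DL x u * v + u * DL x v) ?_ ?_
    (fun u => ?_) u
  · constructor <;> intros <;> simp [add_mul]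
  · constructor <;> intros <;> simp [add_mul]; abel
  refine isLinear_ext (f := fun v => DL x (const u * v))
    (g := fun v => DL x (const u) * v + const u * DL x v) ?_ ?_ (fun v => ?_) v
  · constructor <;> intros <;> simp [mul_add]
  · constructor <;> intros <;> simp [mul_add]; abel
  simp [← const_mul, DL_const, _root_.mul_comm]
  exact add_comm _ _

theorem DL_add (x y : Lorentz) : DL (x + y) = DL x + DL y :=
  hom_ext fun u => by simp [DL_const]

theorem DL_smul (c : ℂ) (x : Lorentz) (f : Ser UTranslations) : DL (c • x) f = c • DL x f := by
  ext n; simp [DL]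

theorem DL_lie (x y : Lorentz) (f : Ser UTranslations) :
    DL ⁅x, y⁆ f = DL y (DL x f) - DL x (DL y f) := by
  refine LinearMap.congr_fun (f := DL ⁅x, y⁆) (g := DL y ∘ₗ DL x - DL x ∘ₗ DL y)
    (hom_ext fun u => ?_) f
  simp [DL_const, lorentzDer_lie, Derivation.commutator_apply]

end Trans

/-! ### The κ-deformed Hopf algebra of translations -/

section LinearLifts

variable {V : Type} [AddCommGroup V] [Module ℂ V]

/-- The linear map on the translations with given values on the basis. -/
def transLift (a : Fin 3 → V) (b : V) : Translations →ₗ[ℂ] V where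
  toFun x := ∑ i, x.p i • a i + x.t • b
  map_add' x y := by simp [add_smul, Finset.sum_add_distrib]; abel
  map_smul' c x := by simp [mul_smul, Finset.smul_sum]

@[simp] theorem transLift_P (a : Fin 3 → V) (b : V) (i : Fin 3) :
    transLift a b (Translations.P i) = a i := by simp [transLift]

@[simp] theorem transLift_P4 (a : Fin 3 → V) (b : V) : transLift a b Translations.P4 = b := by
  simp [transLift]

end LinearLifts

section Tensor

variable {U V : Type} [Ring U] [Algebra ℂ U] [Ring V] [Algebra ℂ V]

theorem Ser.IsAlg.map_hSer {F : Ser U →ₗ[K] Ser V} (hF : IsAlg F) : F (hSer U) = hSer V := by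
  rw [hSer, map_smul, hF.one, hSer]

theorem Ser.IsAlg.map_pow {F : Ser U →ₗ[K] Ser V} (hF : IsAlg F) (v : Ser U) (n : ℕ) :
    F (v ^ n) = F v ^ n := by
  induction n with
  | zero => rw [pow_zero, pow_zero, hF.one]
  | succ n ih => rw [pow_succ, pow_succ, hF.mul, ih]

variable (U V) in
/-- The homomorphism `u ↦ u ⊗ 1`. -/
def inlHom : Ser U →+* Ser (U ⊗[ℂ] V) where
  toFun u := tmul u 1
  map_one' := one_tmul_one
  map_mul' u u' := by rw [tmul_mul_tmul, mul_one]
  map_zero' := zero_tmul _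
  map_add' u u' := add_tmul _ _ _

variable (U V) in
/-- The homomorphism `v ↦ 1 ⊗ v`. -/
def inrHom : Ser V →+* Ser (U ⊗[ℂ] V) where
  toFun v := tmul 1 v
  map_one' := one_tmul_one
  map_mul' u u' := by rw [tmul_mul_tmul, mul_one]
  map_zero' := tmul_zero _
  map_add' u u' := tmul_add _ _ _

theorem tmul_eq_mul (u : Ser U) (v : Ser V) : tmul u v = inlHom U V u * inrHom U V v := by
  change _ = tmul u 1 * tmul 1 v
  rw [tmul_mul_tmul, mul_one, one_mul]

theorem inlHom_hSer : inlHom U V (hSer U) = hSer _ := by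
  change tmul _ _ = _
  rw [hSer, smul_tmul, one_tmul_one, hSer]

theorem inrHom_hSer : inrHom U V (hSer V) = hSer _ := by
  change tmul _ _ = _
  rw [hSer, tmul_smul, one_tmul_one, hSer]

/-- The unit map `ℂ[[h]] → U[[h]]`. -/
def unitMap (U : Type) [Ring U] [Algebra ℂ U] : Ser ℂ →ₗ[K] Ser U :=
  coeffwise (Algebra.ofId ℂ U).toLinearMap

theorem isAlg_unitMap : IsAlg (unitMap U) := .coeffwise _

theorem unitMap_apply (z : Ser ℂ) : unitMap U z = toK z • 1 := by
  conv_lhs => rw [← smul_one_eq z, map_smul, isAlg_unitMap.one]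

end Tensor

section XiRelations

variable {A B : Type} [CommRing A] [Algebra ℂ A] [CommRing B] [Algebra ℂ B] (p : Fin 3 → A) (e : A)

/-- Squaring Ξ - h P₄ = √(1 - h² P²), the terms h² P₄² on the two sides cancel, leaving a quadratic
equation free of square roots. -/
theorem Xi_sq : ofPS (Xi p e) ^ 2 - 2 * hSer A * const e * ofPS (Xi p e) =
    1 - hSer A ^ 2 * (const (p 0) ^ 2 + const (p 1) ^ 2 + const (p 2) ^ 2) := by
  have h := sqrtSer_sq p e
  rw [ofPS_Xi]
  linear_combination h

theorem Xi_eq : ofPS (Xi p e) = 2 * hSer A * const e +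
    (1 - hSer A ^ 2 * (const (p 0) ^ 2 + const (p 1) ^ 2 + const (p 2) ^ 2)) *
      ofPS (XiInv p e) := by
  linear_combination ofPS (XiInv p e) * Xi_sq p e +
    (2 * hSer A * const e - ofPS (Xi p e)) * Xi_mul_XiInv_ser p e

/-- The quadratic equation of Ξ divided by Ξ². This form drives the antipode of Ξ, the Maurer–Cartan
equation and the coproduct of D_x P₄. -/
theorem XiInv_sq : 1 = 2 * hSer A * const e * ofPS (XiInv p e) +
    (1 - hSer A ^ 2 * (const (p 0) ^ 2 + const (p 1) ^ 2 + const (p 2) ^ 2)) *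
      ofPS (XiInv p e) ^ 2 := by
  linear_combination ofPS (XiInv p e) * Xi_eq p e - Xi_mul_XiInv_ser p e

/-- A homomorphism sends `Ξ` to any series with constant coefficient one which satisfies the
quadratic equation of `Ξ`. -/
theorem Ser.IsAlg.map_Xi {F : Ser A →ₗ[K] Ser B} (hF : IsAlg F) {x : Ser B} (hx : x.coeff 0 = 1)
    (h : x ^ 2 - 2 * hSer B * F (const e) * x =
      1 - hSer B ^ 2 * (F (const (p 0)) ^ 2 + F (const (p 1)) ^ 2 + F (const (p 2)) ^ 2)) :
    F (ofPS (Xi p e)) = x := by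
  -- Completing the square turns the hypothesis on `x` into equality of the squares of the two
  -- sides; both have constant term 1, so they coincide.
  have hs : F (sqrtSer p e) = x - hSer B * F (const e) := by
    refine eq_of_sq_eq_sq ?_ ?_ ?_
    · rw [coeff_zero_map, coeff_zero_sqrtSer, const_one, hF.one, coeff_one, if_pos rfl]
    · rw [sub_eq_add_neg, coeff_add, hx, ← mul_neg, hSer_mul, coeff_X_smul_zero, add_zero]
    · rw [← hF.map_pow, sqrtSer_sq]
      simp only [map_sub, map_add, hF.one, hF.mul, hF.map_pow, hF.map_hSer]
      linear_combination -h
  rw [ofPS_Xi, map_add, hF.mul, hF.map_hSer, hs]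
  ring

theorem Ser.IsAlg.map_XiInv {F : Ser A →ₗ[K] Ser B} (hF : IsAlg F) {x y : Ser B}
    (hx : F (ofPS (Xi p e)) = x) (hy : x * y = 1) : F (ofPS (XiInv p e)) = y := by
  refine left_inv_eq_right_inv (a := x) ?_ hy
  rw [← hx, ← hF.mul, mul_comm, Xi_mul_XiInv_ser, hF.one]

end XiRelations

section KappaHopf

/-- The momenta, the energy, `Ξ` and `Ξ⁻¹` as series over the translations. -/
abbrev pS (i : Fin 3) : Ser UTranslations := const (pT i)
/-- The energy as a series. -/
abbrev eS : Ser UTranslations := const eT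
/-- The series `Ξ`. -/
abbrev xS : Ser UTranslations := ofPS (Xi pT eT)
/-- The series `Ξ⁻¹`. -/
abbrev yS : Ser UTranslations := ofPS (XiInv pT eT)
/-- The square `P₁² + P₂² + P₃²`. -/
abbrev ppS : Ser UTranslations := pS 0 ^ 2 + pS 1 ^ 2 + pS 2 ^ 2

/-- The homomorphism from the series over the translations to a commutative algebra of series with
given values on the basis. -/
def transHom {B : Type} [CommRing B] [Algebra ℂ B] (a : Fin 3 → Ser B) (b : Ser B) :
    Ser UTranslations →ₗ[K] Ser B :=
  liftSer (transLift a b)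
    (fun x y => by rw [mul_comm, sub_self, show ⁅x, y⁆ = 0 from rfl, map_zero])

section

variable {B : Type} [CommRing B] [Algebra ℂ B] (a : Fin 3 → Ser B) (b : Ser B)

theorem isAlg_transHom : IsAlg (transHom a b) := isAlg_liftSer _ _

theorem transHom_P (i : Fin 3) : transHom a b (pS i) = a i := by
  rw [transHom, liftSer_gen, transLift_P]

theorem transHom_P4 : transHom a b eS = b := by rw [transHom, liftSer_gen, transLift_P4]

theorem Ser.IsAlg.ext_trans {B : Type} [Ring B] [Algebra ℂ B] {F G : Ser UTranslations →ₗ[K] Ser B}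
    (hF : IsAlg F) (hG : IsAlg G) (hP : ∀ i, F (pS i) = G (pS i)) (hE : F eS = G eS) : F = G :=
  hF.ext adjoin_transGen hG fun k => k.casesOn hP fun _ => hE

end

/-- The `κ`-deformed coproduct of the translations. -/
def transComul : Ser UTranslations →ₗ[K] Ser (UTranslations ⊗[ℂ] UTranslations) :=
  transHom (fun i => tmul (pS i) xS + tmul 1 (pS i))
    (tmul eS xS + tmul yS eS + ∑ m, tmul (hSer _ * pS m * yS) (pS m))

theorem isAlg_transComul : IsAlg transComul := isAlg_transHom _ _

theorem transComul_P (i : Fin 3) : transComul (pS i) = tmul (pS i) xS + tmul 1 (pS i) :=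
  transHom_P _ _ i

theorem transComul_P4 : transComul eS =
    tmul eS xS + tmul yS eS + ∑ m, tmul (hSer _ * pS m * yS) (pS m) := transHom_P4 _ _

/-- The counit of the translations. -/
def transCounit : Ser UTranslations →ₗ[K] Ser ℂ := transHom 0 0

theorem isAlg_transCounit : IsAlg transCounit := isAlg_transHom _ _

theorem transCounit_P (i : Fin 3) : transCounit (pS i) = 0 := transHom_P _ _ i

theorem transCounit_P4 : transCounit eS = 0 := transHom_P4 _ _

/-- The antipode of the translations. -/
def transAntipode : Ser UTranslations →ₗ[K] Ser UTranslations :=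
  transHom (fun i => -(pS i * yS)) (-eS + hSer _ * ppS * yS)

theorem isAlg_transAntipode : IsAlg transAntipode := isAlg_transHom _ _

theorem transAntipode_P (i : Fin 3) : transAntipode (pS i) = -(pS i * yS) := transHom_P _ _ i

theorem transAntipode_P4 : transAntipode eS = -eS + hSer _ * ppS * yS := transHom_P4 _ _

/-- By `map_Xi` it is enough that Ξ ⊗ Ξ solves the quadratic equation with the momenta replaced by
their coproducts. This follows from the equation of Ξ in each leg and from ΞΞ⁻¹ = 1 in the first. -/
theorem transComul_Xi : transComul xS = tmul xS xS := by
  refine isAlg_transComul.map_Xi _ _ ?_ ?_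
  · rw [coeff_tmul]
    simp [coeff_zero_Xi, Algebra.TensorProduct.one_def]
  · simp only [transComul_P, transComul_P4, Fin.sum_univ_three]
    have h1 := congrArg (inlHom UTranslations UTranslations) (Xi_sq pT eT)
    have h2 := congrArg (inrHom UTranslations UTranslations) (Xi_sq pT eT)
    have h3 := congrArg (inlHom UTranslations UTranslations) (Xi_mul_XiInv_ser pT eT)
    simp only [tmul_eq_mul, map_sub, map_mul, map_add, map_one, map_pow, map_ofNat, inlHom_hSer,
      inrHom_hSer] at h1 h2 h3 ⊢
    generalize inlHom UTranslations UTranslations xS = X at *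
    generalize inrHom UTranslations UTranslations xS = X' at *
    generalize inlHom UTranslations UTranslations yS = Y at *
    generalize inrHom UTranslations UTranslations yS = Y' at *
    linear_combination X' ^ 2 * h1 + h2 - (2 * hSer _ * X' * inrHom UTranslations UTranslations eS
      + 2 * hSer _ ^ 2 * X' * (inlHom UTranslations UTranslations (pS 0) *
          inrHom UTranslations UTranslations (pS 0) +
        inlHom UTranslations UTranslations (pS 1) * inrHom UTranslations UTranslations (pS 1) +
        inlHom UTranslations UTranslations (pS 2) * inrHom UTranslations UTranslations (pS 2))) * h3

theorem transComul_XiInv : transComul yS = tmul yS yS :=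
  isAlg_transComul.map_XiInv _ _ transComul_Xi (by
    rw [tmul_mul_tmul, Xi_mul_XiInv_ser, one_tmul_one])

theorem transCounit_Xi : transCounit xS = 1 := by
  refine isAlg_transCounit.map_Xi _ _ (by rw [coeff_one, if_pos rfl]) ?_
  simp only [transCounit_P, transCounit_P4]
  ring

theorem transCounit_XiInv : transCounit yS = 1 :=
  isAlg_transCounit.map_XiInv _ _ transCounit_Xi (mul_one 1)

/-- After substituting the antipodes of the momenta, the quadratic equation required of Ξ⁻¹ is
exactly `XiInv_sq`. -/
theorem transAntipode_Xi : transAntipode xS = yS := by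
  refine isAlg_transAntipode.map_Xi _ _ (coeff_zero_XiInv _ _) ?_
  simp only [transAntipode_P, transAntipode_P4]
  linear_combination -XiInv_sq pT eT

theorem transAntipode_XiInv : transAntipode yS = xS :=
  isAlg_transAntipode.map_XiInv _ _ transAntipode_Xi (by rw [mul_comm, Xi_mul_XiInv_ser])

/-- Both sides are homomorphisms, so generators suffice. For P₄ one uses that Ξ^{±1} is group-like
and that h P_m Ξ⁻¹ is skew-primitive: its coproduct is h P_m Ξ⁻¹ ⊗ 1 + Ξ⁻¹ ⊗ h P_m Ξ⁻¹. -/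
theorem transComul_coassoc :
    coeffwise (TensorProduct.assoc ℂ UTranslations UTranslations UTranslations).toLinearMap ∘ₗ
      tmap transComul LinearMap.id ∘ₗ transComul = tmap LinearMap.id transComul ∘ₗ transComul := by
  refine (IsAlg.assoc.comp ((isAlg_transComul.tmap .id).comp isAlg_transComul)).ext_trans
    ((IsAlg.id.tmap isAlg_transComul).comp isAlg_transComul) (fun i => ?_) ?_
  · simp only [LinearMap.comp_apply, transComul_P, map_add, tmap_tmul, LinearMap.id_apply,
      add_tmul, tmul_add, coeffwise_assoc, transComul_Xi, isAlg_transComul.one, ← one_tmul_one]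
    abel
  · simp only [LinearMap.comp_apply, transComul_P, transComul_P4, map_add, map_sum, tmap_tmul,
      LinearMap.id_apply, add_tmul, tmul_add, coeffwise_assoc, transComul_Xi, transComul_XiInv,
      isAlg_transComul.mul, isAlg_transComul.map_hSer]
    simp only [hSer_mul, smul_mul_assoc, add_mul, tmul_mul_tmul, smul_tmul, tmul_smul, map_smul,
      add_tmul, map_add, coeffwise_assoc, one_mul, Xi_mul_XiInv_ser, sum_tmul, tmul_sum,
      map_sum, Finset.sum_add_distrib, smul_add]
    abel

theorem transCounit_comul : coeffwise (TensorProduct.lid ℂ UTranslations).toLinearMap ∘ₗ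
    tmap transCounit LinearMap.id ∘ₗ transComul = LinearMap.id :=
  (IsAlg.lid.comp ((isAlg_transCounit.tmap .id).comp isAlg_transComul)).ext_trans .id
    (fun i => by
      simp only [LinearMap.comp_apply, transComul_P, map_add, tmap_tmul, LinearMap.id_apply,
        transCounit_P, isAlg_transCounit.one, coeffwise_lid_tmul, toK_zero, toK_one, zero_smul,
        zero_add, one_smul])
    (by
      simp only [LinearMap.comp_apply, transComul_P4, map_add, map_sum, tmap_tmul,
        LinearMap.id_apply, transCounit_P4, transCounit_P, transCounit_XiInv, mul_zero, zero_mul,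
        isAlg_transCounit.mul, coeffwise_lid_tmul, toK_zero, toK_one, zero_smul,
        Finset.sum_const_zero, zero_add, add_zero, one_smul])

theorem transComul_counit : coeffwise (TensorProduct.rid ℂ UTranslations).toLinearMap ∘ₗ
    tmap LinearMap.id transCounit ∘ₗ transComul = LinearMap.id :=
  (IsAlg.rid.comp ((IsAlg.id.tmap isAlg_transCounit).comp isAlg_transComul)).ext_trans .id
    (fun i => by
      simp only [LinearMap.comp_apply, transComul_P, map_add, tmap_tmul, LinearMap.id_apply,
        transCounit_P, transCounit_Xi, coeffwise_rid_tmul, toK_zero, toK_one, zero_smul, add_zero,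
        one_smul])
    (by
      simp only [LinearMap.comp_apply, transComul_P4, map_add, map_sum, tmap_tmul,
        LinearMap.id_apply, transCounit_P4, transCounit_P, transCounit_Xi, coeffwise_rid_tmul,
        toK_zero, toK_one, zero_smul, Finset.sum_const_zero, add_zero, one_smul])

/-- For a commutative algebra both the product and the antipode are homomorphisms, so the antipode
axiom may be checked on the momenta. -/
theorem transAntipode_left : mulMap UTranslations ∘ₗ tmap transAntipode LinearMap.id ∘ₗ transComul =
    unitMap UTranslations ∘ₗ transCounit := by
  refine (IsAlg.mulMap.comp ((isAlg_transAntipode.tmap .id).comp isAlg_transComul)).ext_trans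
    (isAlg_unitMap.comp isAlg_transCounit) (fun i => ?_) ?_
  · simp only [LinearMap.comp_apply, transComul_P, map_add, tmap_tmul, LinearMap.id_apply,
      transAntipode_P, isAlg_transAntipode.one, mulMap_tmul, transCounit_P, map_zero]
    linear_combination -pS i * Xi_mul_XiInv_ser pT eT
  · simp only [LinearMap.comp_apply, transComul_P4, map_add, tmap_tmul,
      LinearMap.id_apply, isAlg_transAntipode.mul, transAntipode_P4, transAntipode_P,
      transAntipode_XiInv, isAlg_transAntipode.map_hSer, mulMap_tmul, transCounit_P4,
      map_zero, Fin.sum_univ_three]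
    ring

theorem transAntipode_right :
    mulMap UTranslations ∘ₗ tmap LinearMap.id transAntipode ∘ₗ transComul =
      unitMap UTranslations ∘ₗ transCounit := by
  refine (IsAlg.mulMap.comp ((IsAlg.id.tmap isAlg_transAntipode).comp isAlg_transComul)).ext_trans
    (isAlg_unitMap.comp isAlg_transCounit) (fun i => ?_) ?_
  · simp only [LinearMap.comp_apply, transComul_P, map_add, tmap_tmul, LinearMap.id_apply,
      transAntipode_P, transAntipode_Xi, mulMap_tmul, transCounit_P, map_zero]
    ring
  · simp only [LinearMap.comp_apply, transComul_P4, map_add, tmap_tmul,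
      LinearMap.id_apply, transAntipode_P4, transAntipode_P, transAntipode_Xi, mulMap_tmul,
      transCounit_P4, map_zero, Fin.sum_univ_three]
    ring

/-- The `κ`-deformed Hopf algebra of translations. -/
def transHopf : HopfStr UTranslations :=
  .ofRing transComul transCounit transAntipode isAlg_transComul isAlg_transCounit
    transComul_coassoc transCounit_comul transComul_counit
    (fun v => (LinearMap.congr_fun transAntipode_left v).trans (unitMap_apply _))
    (fun v => (LinearMap.congr_fun transAntipode_right v).trans (unitMap_apply _))

theorem isKappaTranslations : IsKappaTranslations transHopf where
  classical := ⟨rfl, rfl⟩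
  comul_P := transComul_P
  comul_P4 := by
    simp only [ofPS_hPXiInv]
    exact transComul_P4

theorem IsKappaTranslations.eq_transHopf {𝒜 : HopfStr UTranslations} (h : IsKappaTranslations 𝒜) :
    𝒜 = transHopf := by
  refine h.classical.ext isKappaTranslations.classical adjoin_transGen fun k => ?_
  rcases k with i | _
  · exact (h.comul_P i).trans (isKappaTranslations.comul_P i).symm
  · exact h.comul_P4.trans isKappaTranslations.comul_P4.symm

end KappaHopf

/-! ### The primitive Hopf structure of an enveloping algebra -/

section Generic

variable {U ι : Type} [Ring U] [Algebra ℂ U] {e : ι → U} (he : Algebra.adjoin ℂ (Set.range e) = ⊤)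
  {Δ : Ser U →ₗ[K] Ser (U ⊗[ℂ] U)} {ε : Ser U →ₗ[K] Ser ℂ} {S : Ser U →ₗ[K] Ser U}
  (hΔ : IsAlg Δ) (hε : IsAlg ε)
  (Δe : ∀ k, Δ (const (e k)) = tmul (const (e k)) 1 + tmul 1 (const (e k)))
  (εe : ∀ k, ε (const (e k)) = 0) (S1 : S 1 = 1) (Smul : ∀ u v, S (u * v) = S v * S u)
  (Se : ∀ k, S (const (e k)) = -const (e k))

include he hΔ hε Δe εe S1 Smul Se

/-- Here S reverses products, so the left side is not visibly a homomorphism. Instead, multiplying u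
by e_k replaces z = S(u₁) u₂ by z e_k - e_k z; on the scalar side this commutator and ε(u e_k) both
vanish. -/
theorem antipode_left_of_primitive : mulMap U ∘ₗ tmap S LinearMap.id ∘ₗ Δ = unitMap U ∘ₗ ε := by
  refine recursion_ext he ?_
      (fun k z => z * const (e k) - const (e k) * z) (fun k u => ?_) (fun k u => ?_)
  · simp [hΔ.one, hε.one, ← one_tmul_one, S1, isAlg_unitMap.one]
  · simp only [LinearMap.comp_apply, hΔ.mul, Δe]
    generalize Δ u = z
    refine isLinear_tmul_ext
      (f := fun z => mulMap U (tmap S LinearMap.id (z * (tmul (const (e k)) 1 + tmul 1 (const (e k))))))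
      (g := fun z => mulMap U (tmap S LinearMap.id z) * const (e k) -
        const (e k) * mulMap U (tmap S LinearMap.id z)) ?_ ?_ (fun u v => ?_) z
    · exact ⟨fun _ _ => by simp only [add_mul, map_add],
        fun _ _ => by simp only [smul_mul_assoc, map_smul]⟩
    · exact ⟨fun _ _ => by simp only [map_add, add_mul, mul_add]; abel,
        fun _ _ => by simp only [smul_mul_assoc, mul_smul_comm, map_smul, smul_sub]⟩
    simp only [mul_add, tmul_mul_tmul, mul_one,
      map_add, tmap_tmul, LinearMap.id_apply, mulMap_tmul, Smul, Se, mul_assoc, neg_mul]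
    abel
  · simp only [LinearMap.comp_apply, hε.mul, εe, mul_zero,
      map_zero, unitMap_apply, smul_mul_assoc, mul_smul_comm, one_mul, mul_one, sub_self]

/-- The two terms u₁ e_k S(u₂) and u₁ S(u₂ e_k) = -u₁ e_k S(u₂) cancel, so the recursion step is
zero on both sides. -/
theorem antipode_right_of_primitive : mulMap U ∘ₗ tmap LinearMap.id S ∘ₗ Δ = unitMap U ∘ₗ ε := by
  refine recursion_ext he ?_ (fun k z => 0) (fun k u => ?_) (fun k u => ?_)
  · simp [hΔ.one, hε.one, ← one_tmul_one, S1, isAlg_unitMap.one]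
  · simp only [LinearMap.comp_apply, hΔ.mul, Δe]
    generalize Δ u = z
    refine isLinear_tmul_ext
      (f := fun z => mulMap U (tmap LinearMap.id S (z * (tmul (const (e k)) 1 + tmul 1 (const (e k))))))
      (g := fun z => 0) ?_ ?_ (fun u v => ?_) z
    · exact ⟨fun _ _ => by simp only [add_mul, map_add],
        fun _ _ => by simp only [smul_mul_assoc, map_smul]⟩
    · exact ⟨fun _ _ => (add_zero _).symm, fun _ _ => (smul_zero _).symm⟩
    simp only [mul_add, tmul_mul_tmul, mul_one,
      map_add, tmap_tmul, LinearMap.id_apply, mulMap_tmul, Smul, Se,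
      mul_assoc, neg_mul, mul_neg, add_neg_cancel]
  · simp only [LinearMap.comp_apply, hε.mul, εe, mul_zero, map_zero]

end Generic

section Primitive

variable (L : Type) [LieRing L] [LieAlgebra ℂ L]

local notation "𝒰" => UniversalEnvelopingAlgebra ℂ L

attribute [local instance 100] LieRing.ofAssociativeRing

/-- The primitive coproduct on an enveloping algebra. -/
def primComul : Ser 𝒰 →ₗ[K] Ser (𝒰 ⊗[ℂ] 𝒰) :=
  coeffwise (liftAlg
    ((TensorProduct.mk ℂ 𝒰 𝒰).flip 1 ∘ₗ genMap L + TensorProduct.mk ℂ 𝒰 𝒰 1 ∘ₗ genMap L)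
    (fun x y => by
      simp only [LinearMap.add_apply, LinearMap.comp_apply, genMap_apply, gen_lie, map_sub,
        LinearMap.flip_apply, TensorProduct.mk_apply, mul_add, add_mul,
        Algebra.TensorProduct.tmul_mul_tmul, mul_one, one_mul]
      abel)).toLinearMap

theorem isAlg_primComul : IsAlg (primComul L) := .coeffwise _

variable {L} in
theorem primComul_gen (x : L) : primComul L (const (gen x)) =
    tmul (const (gen x)) 1 + tmul 1 (const (gen x)) := by
  rw [primComul, coeffwise_const, AlgHom.toLinearMap_apply, liftAlg_gen, LinearMap.add_apply,
    map_add, ← const_one, tmul_const_const, tmul_const_const]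
  rfl

/-- The counit of an enveloping algebra. -/
def primCounit : Ser 𝒰 →ₗ[K] Ser ℂ := coeffwise (liftAlg (0 : L →ₗ[ℂ] ℂ) (by simp)).toLinearMap

theorem isAlg_primCounit : IsAlg (primCounit L) := .coeffwise _

variable {L} in
theorem primCounit_gen (x : L) : primCounit L (const (gen x)) = 0 := by
  rw [primCounit, coeffwise_const, AlgHom.toLinearMap_apply, liftAlg_gen, LinearMap.zero_apply,
    map_zero]

/-- The antipode of an enveloping algebra. -/
def primAntipode : Ser 𝒰 →ₗ[K] Ser 𝒰 :=
  coeffwise ((MulOpposite.opLinearEquiv ℂ).symm.toLinearMap ∘ₗ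
    (liftAlg (-((MulOpposite.opLinearEquiv ℂ).toLinearMap ∘ₗ genMap L)) (fun x y => by
      simp only [LinearMap.neg_apply, LinearMap.comp_apply, genMap_apply, gen_lie, map_sub,
        LinearEquiv.coe_coe, MulOpposite.coe_opLinearEquiv, neg_mul_neg, neg_sub,
        MulOpposite.op_mul])).toLinearMap)

theorem primAntipode_one : primAntipode L 1 = 1 := by
  rw [← const_one, primAntipode, coeffwise_const]
  simp

variable {L} in
theorem primAntipode_gen (x : L) : primAntipode L (const (gen x)) = -const (gen x) := by
  rw [primAntipode, coeffwise_const, LinearMap.comp_apply, AlgHom.toLinearMap_apply, liftAlg_gen,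
    ← map_neg]
  rfl

theorem primAntipode_mul (u v : Ser 𝒰) :
    primAntipode L (u * v) = primAntipode L v * primAntipode L u := by
  refine isLinear_ext (f := fun u => primAntipode L (u * v))
    (g := fun u => primAntipode L v * primAntipode L u) ?_ ?_ (fun u => ?_) u
  · constructor <;> intros <;> simp [add_mul]
  · constructor <;> intros <;> simp [mul_add]
  refine isLinear_ext (f := fun v => primAntipode L (const u * v))
    (g := fun v => primAntipode L v * primAntipode L (const u)) ?_ ?_ (fun v => ?_) v
  · constructor <;> intros <;> simp [mul_add]
  · constructor <;> intros <;> simp [add_mul]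
  rw [← const_mul, primAntipode, coeffwise_const, coeffwise_const, coeffwise_const, ← const_mul]
  simp

theorem primAntipode_left :
    mulMap 𝒰 ∘ₗ tmap (primAntipode L) LinearMap.id ∘ₗ primComul L = unitMap 𝒰 ∘ₗ primCounit L :=
  antipode_left_of_primitive adjoin_gen (isAlg_primComul L) (isAlg_primCounit L) primComul_gen
    primCounit_gen (primAntipode_one L) (primAntipode_mul L) primAntipode_gen

theorem primAntipode_right :
    mulMap 𝒰 ∘ₗ tmap LinearMap.id (primAntipode L) ∘ₗ primComul L = unitMap 𝒰 ∘ₗ primCounit L :=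
  antipode_right_of_primitive adjoin_gen (isAlg_primComul L) (isAlg_primCounit L) primComul_gen
    primCounit_gen (primAntipode_one L) (primAntipode_mul L) primAntipode_gen

/-- The Hopf algebra structure of an enveloping algebra. -/
def primHopf : HopfStr 𝒰 :=
  .ofRing (primComul L) (primCounit L) (primAntipode L) (isAlg_primComul L) (isAlg_primCounit L)
    ((IsAlg.assoc.comp (((isAlg_primComul L).tmap .id).comp (isAlg_primComul L))).ext adjoin_gen
      ((IsAlg.id.tmap (isAlg_primComul L)).comp (isAlg_primComul L)) fun x => by
        simp only [LinearMap.comp_apply, primComul_gen, map_add, tmap_tmul, LinearMap.id_apply,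
          (isAlg_primComul L).one, add_tmul, tmul_add, ← one_tmul_one, coeffwise_assoc]
        abel)
    ((IsAlg.lid.comp (((isAlg_primCounit L).tmap .id).comp (isAlg_primComul L))).ext adjoin_gen
      .id fun x => by
        simp only [LinearMap.comp_apply, primComul_gen, map_add, tmap_tmul, LinearMap.id_apply,
          (isAlg_primCounit L).one, primCounit_gen, coeffwise_lid_tmul, toK_zero, toK_one,
          zero_smul, one_smul, zero_add])
    ((IsAlg.rid.comp ((IsAlg.id.tmap (isAlg_primCounit L)).comp (isAlg_primComul L))).ext adjoin_gen
      .id fun x => by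
        simp only [LinearMap.comp_apply, primComul_gen, map_add, tmap_tmul, LinearMap.id_apply,
          (isAlg_primCounit L).one, primCounit_gen, coeffwise_rid_tmul, toK_zero, toK_one,
          zero_smul, one_smul, add_zero])
    (fun v => (LinearMap.congr_fun (primAntipode_left L) v).trans (unitMap_apply _))
    (fun v => (LinearMap.congr_fun (primAntipode_right L) v).trans (unitMap_apply _))

theorem primHopf_classical : HasClassicalProduct (primHopf L) := ⟨rfl, rfl⟩

end Primitive

/-- The Hopf algebra structure of the enveloping algebra of the Lorentz algebra. -/
abbrev lorentzHopf : HopfStr ULorentz := primHopf Lorentz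

theorem isPrimitiveLorentz : IsPrimitiveLorentz lorentzHopf where
  classical := primHopf_classical _
  comul_gen := primComul_gen

theorem IsPrimitiveLorentz.eq_lorentzHopf {ℋ : HopfStr ULorentz} (h : IsPrimitiveLorentz ℋ) :
    ℋ = lorentzHopf :=
  h.classical.ext (primHopf_classical _) adjoin_gen fun x =>
    (h.comul_gen x).trans (primComul_gen x).symm

/-! ### Orbit maps of right Lie algebra actions, and the classical action -/

section Orbit

variable {L X : Type} [LieRing L] [LieAlgebra ℂ L] [AddCommGroup X] [Module ℂ X]

/-- The antihomomorphism from an enveloping algebra which extends a right action. -/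
def orbitHom (T : L →ₗ[ℂ] Module.End K (Ser X)) (hT : ∀ x y, T ⁅x, y⁆ = T y * T x - T x * T y) :
    UniversalEnvelopingAlgebra ℂ L →ₐ[ℂ] (Module.End K (Ser X))ᵐᵒᵖ :=
  liftAlg ((MulOpposite.opLinearEquiv ℂ).toLinearMap ∘ₗ T) (fun x y => by
    simp only [LinearMap.comp_apply, LinearEquiv.coe_coe, MulOpposite.coe_opLinearEquiv,
      ← MulOpposite.op_mul, ← MulOpposite.op_sub, hT])

theorem orbitHom_gen (T : L →ₗ[ℂ] Module.End K (Ser X))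
    (hT : ∀ x y, T ⁅x, y⁆ = T y * T x - T x * T y) (x : L) :
    orbitHom T hT (gen x) = MulOpposite.op (T x) :=
  liftAlg_gen _ _ x

/-- The map `u ↦ v ◁ u` for a right action of a Lie algebra on a module of series. -/
def orbit (T : L →ₗ[ℂ] Module.End K (Ser X)) (hT : ∀ x y, T ⁅x, y⁆ = T y * T x - T x * T y)
    (v : Ser X) : Ser (UniversalEnvelopingAlgebra ℂ L) →ₗ[K] Ser X :=
  extend
    { toFun := fun u => (orbitHom T hT u).unop v
      map_add' := fun _ _ => by rw [map_add]; rfl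
      map_smul' := fun _ _ => by rw [map_smul]; rfl }

variable (T : L →ₗ[ℂ] Module.End K (Ser X)) (hT : ∀ x y, T ⁅x, y⁆ = T y * T x - T x * T y)
  (v : Ser X)

theorem orbit_one : orbit T hT v 1 = v := by
  rw [← const_one, orbit, extend_const]
  simp

/-- Because the extension reverses products, the last letter of a word acts last. Together with
`orbit_one` this is the recursion that characterises the orbit map. -/
theorem orbit_mul_gen (u : Ser (UniversalEnvelopingAlgebra ℂ L)) (x : L) :
    orbit T hT v (u * const (gen x)) = T x (orbit T hT v u) := by
  refine isLinear_ext (f := fun u => orbit T hT v (u * const (gen x)))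
    (g := fun u => T x (orbit T hT v u)) ?_ ?_ (fun u => ?_) u
  · exact ⟨fun _ _ => by simp only [add_mul, map_add],
      fun _ _ => by simp only [smul_mul_assoc, map_smul]⟩
  · exact ⟨fun _ _ => by simp only [map_add], fun _ _ => by simp only [map_smul]⟩
  rw [← const_mul, orbit, extend_const, extend_const]
  simp only [LinearMap.coe_mk, AddHom.coe_mk]
  rw [map_mul, orbitHom_gen]
  rfl

end Orbit

section Action

/-- The classical right action on the enveloping algebra of the translations. -/
def actHom : ULorentz →ₐ[ℂ] (Module.End ℂ UTranslations)ᵐᵒᵖ :=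
  liftAlg { toFun := fun x => MulOpposite.op (lorentzDer x).toLinearMap
            map_add' := fun x y => by rw [map_add]; rfl
            map_smul' := fun c x => by rw [map_smul]; rfl }
    (fun x y => by
      refine congrArg MulOpposite.op (LinearMap.ext fun u => ?_)
      change lorentzDer ⁅x, y⁆ u = _
      rw [lorentzDer_lie, Derivation.commutator_apply]
      rfl)

/-- The classical right action of the Lorentz algebra on series over the translations. -/
def classicalAct : Ser (UTranslations ⊗[ℂ] ULorentz) →ₗ[K] Ser UTranslations :=
  coeffwise (TensorProduct.lift (LinearMap.mk₂ ℂ (fun f u => (actHom u).unop f)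
    (fun _ _ _ => map_add _ _ _) (fun _ _ _ => map_smul _ _ _)
    (fun _ _ _ => by rw [map_add]; rfl) (fun _ _ _ => by rw [map_smul]; rfl)))

theorem classicalAct_const (f : UTranslations) (u : ULorentz) :
    classicalAct (tmul (const f) (const u)) = const ((actHom u).unop f) := by
  rw [classicalAct, tmul_const_const, coeffwise_const, TensorProduct.lift.tmul]
  rfl

theorem classicalAct_one (f : Ser UTranslations) : classicalAct (tmul f 1) = f := by
  refine LinearMap.congr_fun (f := classicalAct ∘ₗ tmulRight 1) (g := LinearMap.id)
    (hom_ext fun f => ?_) f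
  rw [LinearMap.comp_apply, tmulRight_apply, ← const_one, classicalAct_const, map_one]
  rfl

theorem classicalAct_mul_gen (f : Ser UTranslations) (u : Ser ULorentz) (x : Lorentz) :
    classicalAct (tmul f (u * const (gen x))) = DL x (classicalAct (tmul f u)) := by
  refine isLinear_ext (f := fun f => classicalAct (tmul f (u * const (gen x))))
    (g := fun f => DL x (classicalAct (tmul f u))) ?_ ?_ (fun f => ?_) f
  · exact ⟨fun _ _ => by simp only [add_tmul, map_add],
      fun _ _ => by simp only [smul_tmul, map_smul]⟩
  · exact ⟨fun _ _ => by simp only [add_tmul, map_add],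
      fun _ _ => by simp only [smul_tmul, map_smul]⟩
  refine isLinear_ext (f := fun u => classicalAct (tmul (const f) (u * const (gen x))))
    (g := fun u => DL x (classicalAct (tmul (const f) u))) ?_ ?_ (fun u => ?_) u
  · exact ⟨fun _ _ => by simp only [add_mul, tmul_add, map_add],
      fun _ _ => by simp only [smul_mul_assoc, tmul_smul, map_smul]⟩
  · exact ⟨fun _ _ => by simp only [tmul_add, map_add],
      fun _ _ => by simp only [tmul_smul, map_smul]⟩
  rw [← const_mul, classicalAct_const, classicalAct_const, DL_const, map_mul, actHom, liftAlg_gen]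
  rfl

theorem classicalAct_gen (f : Ser UTranslations) (x : Lorentz) :
    classicalAct (tmul f (const (gen x))) = DL x f := by
  have := classicalAct_mul_gen f 1 x
  rwa [one_mul, classicalAct_one] at this

end Action

/-! ### Lorentz derivatives of the momenta and of Ξ -/

section Derivatives

/-- The scalars, as constant series. -/
abbrev cS (z : ℂ) : Ser UTranslations := algebraMap ℂ _ z

theorem const_gen_trans (q : Translations) : (const (gen q) : Ser UTranslations) =
    cS (q.p 0) * pS 0 + cS (q.p 1) * pS 1 + cS (q.p 2) * pS 2 + cS q.t * eS := by
  conv_lhs => rw [q.eq_sum, Fin.sum_univ_three]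
  rw [gen_add, gen_add, gen_add, gen_smul, gen_smul, gen_smul, gen_smul]
  simp only [map_add, LinearMap.map_smul const]
  simp only [Algebra.smul_def]

theorem DL_P (x : Lorentz) (k : Fin 3) : DL x (pS k) =
    cS Complex.I * (cS (x.m (k + 1)) * pS (k + 2) - cS (x.m (k + 2)) * pS (k + 1) +
      cS (x.n k) * eS) := by
  rw [DL_const, lorentzDer_gen, const_gen_trans]
  simp only [ract_p, ract_t]
  fin_cases k <;> simp [Fin.sum_univ_three, eps, -UniversalEnvelopingAlgebra.ι_apply] <;> ring_nf <;>
    simp [-UniversalEnvelopingAlgebra.ι_apply, map_ofNat] <;> ring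

theorem DL_P4 (x : Lorentz) : DL x eS =
    cS Complex.I * (cS (x.n 0) * pS 0 + cS (x.n 1) * pS 1 + cS (x.n 2) * pS 2) := by
  rw [DL_const, lorentzDer_gen, const_gen_trans]
  simp [ract_p, ract_t, -UniversalEnvelopingAlgebra.ι_apply]
  ring

theorem DL_P_zero (x : Lorentz) : DL x (pS 0) =
    cS Complex.I * (cS (x.m 1) * pS 2 - cS (x.m 2) * pS 1 + cS (x.n 0) * eS) := DL_P x 0

theorem DL_P_one (x : Lorentz) : DL x (pS 1) =
    cS Complex.I * (cS (x.m 2) * pS 0 - cS (x.m 0) * pS 2 + cS (x.n 1) * eS) := DL_P x 1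

theorem DL_P_two (x : Lorentz) : DL x (pS 2) =
    cS Complex.I * (cS (x.m 0) * pS 1 - cS (x.m 1) * pS 0 + cS (x.n 2) * eS) := DL_P x 2

theorem DL_one (x : Lorentz) : DL x 1 = 0 := by
  have := DL_mul x 1 1
  simpa using this

theorem DL_hSer (x : Lorentz) : DL x (hSer _) = 0 := by
  rw [hSer, map_smul, DL_one, smul_zero]

theorem DL_sq (x : Lorentz) (u : Ser UTranslations) : DL x (u ^ 2) = 2 * u * DL x u := by
  rw [pow_two, DL_mul]
  ring

/-- P² is invariant, so the derivation kills the square of the root s, giving 2 s D(s) = 0; the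
factor 2 s has invertible constant term and cancels. -/
theorem DL_sqrtSer (x : Lorentz) : DL x (sqrtSer pT eT) = 0 := by
  refine eq_zero_of_mul_eq_zero (v := 2 * sqrtSer pT eT) ?_ ?_
  · rw [two_mul, coeff_add, coeff_zero_sqrtSer, one_add_one_eq_two]
    exact isUnit_two
  · rw [← DL_sq, sqrtSer_sq, map_sub, DL_one, DL_mul, DL_sq, DL_hSer, map_sub, map_add, map_add,
      DL_sq, DL_sq, DL_sq, DL_sq, DL_P_zero, DL_P_one, DL_P_two, DL_P4]
    ring

theorem DL_Xi (x : Lorentz) : DL x xS = hSer _ * DL x eS := by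
  rw [xS, ofPS_Xi, map_add, DL_sqrtSer, DL_mul, DL_hSer]
  ring

/-- Obtained by differentiating ΞΞ⁻¹ = 1. -/
theorem DL_XiInv (x : Lorentz) : DL x yS = -(hSer _ * DL x eS * yS ^ 2) := by
  have h := congrArg (DL x) (Xi_mul_XiInv_ser pT eT)
  rw [DL_mul, DL_one, DL_Xi] at h
  linear_combination yS * h - DL x yS * Xi_mul_XiInv_ser pT eT

end Derivatives

/-! ### Construction of the coaction from a Maurer–Cartan equation -/

section Coaction

theorem sum_eps_smul {V : Type} [AddCommGroup V] [Module ℂ V] (k : Fin 3) (f : Fin 3 → Fin 3 → V) :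
    ∑ i, ∑ j, eps i j k • f i j = f (k + 1) (k + 2) - f (k + 2) (k + 1) := by
  fin_cases k <;> simp [Fin.sum_univ_three, eps] <;> norm_num <;> module

theorem lie_M_M (i j : Fin 3) :
    ⁅Lorentz.M i, Lorentz.M j⁆ = Complex.I • ∑ k, eps i j k • Lorentz.M k := by
  fin_cases i <;> fin_cases j <;> refine Lorentz.ext_comp (fun k => ?_) (fun k => ?_) <;>
    fin_cases k <;> simp [Lorentz.bracket_m, Lorentz.bracket_n, Fin.sum_univ_three, eps]

theorem lie_M_N (i j : Fin 3) :
    ⁅Lorentz.M i, Lorentz.N j⁆ = Complex.I • ∑ k, eps i j k • Lorentz.N k := by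
  fin_cases i <;> fin_cases j <;> refine Lorentz.ext_comp (fun k => ?_) (fun k => ?_) <;>
    fin_cases k <;> simp [Lorentz.bracket_m, Lorentz.bracket_n, Fin.sum_univ_three, eps]

theorem lie_N_M (i j : Fin 3) :
    ⁅Lorentz.N i, Lorentz.M j⁆ = Complex.I • ∑ k, eps i j k • Lorentz.N k := by
  fin_cases i <;> fin_cases j <;> refine Lorentz.ext_comp (fun k => ?_) (fun k => ?_) <;>
    fin_cases k <;> simp [Lorentz.bracket_m, Lorentz.bracket_n, Fin.sum_univ_three, eps]

theorem lie_N_N (i j : Fin 3) :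
    ⁅Lorentz.N i, Lorentz.N j⁆ = -(Complex.I • ∑ k, eps i j k • Lorentz.M k) := by
  rw [← neg_one_smul ℂ]
  fin_cases i <;> fin_cases j <;> refine Lorentz.ext_comp (fun k => ?_) (fun k => ?_) <;>
    fin_cases k <;> simp [-neg_smul, Lorentz.bracket_m, Lorentz.bracket_n, Fin.sum_univ_three, eps]
  ring

/-- The element `∑ k, a k ⊗ e k`, where the `e k` are the basis of the Lorentz algebra. -/
def gauge (a : Fin 3 ⊕ Fin 3 → Ser UTranslations) : Ser (UTranslations ⊗[ℂ] ULorentz) :=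
  ∑ k, tmul (a k) (const (eL k))

theorem gauge_add (a b : Fin 3 ⊕ Fin 3 → Ser UTranslations) :
    gauge (a + b) = gauge a + gauge b := by
  simp [gauge, add_tmul, Finset.sum_add_distrib, -UniversalEnvelopingAlgebra.ι_apply]

theorem gauge_sub (a b : Fin 3 ⊕ Fin 3 → Ser UTranslations) :
    gauge (a - b) = gauge a - gauge b := by
  simp [gauge, sub_tmul, Finset.sum_sub_distrib, -UniversalEnvelopingAlgebra.ι_apply]

/-- The bracket of `A ⊗ o(1,3)`. -/
def gaugeLie (a b : Fin 3 ⊕ Fin 3 → Ser UTranslations) : Fin 3 ⊕ Fin 3 → Ser UTranslations :=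
  Sum.elim
    (fun k => Complex.I • ((a (.inl (k + 1)) * b (.inl (k + 2)) - a (.inl (k + 2)) * b (.inl (k + 1))) -
      (a (.inr (k + 1)) * b (.inr (k + 2)) - a (.inr (k + 2)) * b (.inr (k + 1)))))
    (fun k => Complex.I • ((a (.inl (k + 1)) * b (.inr (k + 2)) - a (.inl (k + 2)) * b (.inr (k + 1))) +
      (a (.inr (k + 1)) * b (.inl (k + 2)) - a (.inr (k + 2)) * b (.inl (k + 1)))))

theorem sum_tmul_eps {V : Type} [AddCommGroup V] [Module ℂ V]
    (f : Fin 3 → Fin 3 → Ser UTranslations) (v : Fin 3 → V) :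
    ∑ i, ∑ j, tmul (f i j) (const (Complex.I • ∑ k, eps i j k • v k)) =
      ∑ k, tmul (Complex.I • (f (k + 1) (k + 2) - f (k + 2) (k + 1))) (const (v k)) := by
  simp only [← sum_eps_smul, LinearMap.map_smul const, map_sum, tmul_csmul, csmul_tmul, tmul_sum,
    sum_tmul, Finset.smul_sum]
  rw [Finset.sum_comm_cycle]

/-- As 𝒜 is commutative, the commutator of a ⊗ x and b ⊗ y is ab ⊗ [x, y]; summing over the basis
leaves only the structure constants of o(1,3). -/
theorem gauge_commutator (a b : Fin 3 ⊕ Fin 3 → Ser UTranslations) :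
    gauge a * gauge b - gauge b * gauge a = gauge (gaugeLie a b) := by
  have h : gauge a * gauge b - gauge b * gauge a =
      ∑ k, ∑ l, tmul (a k * b l) (const (gen ⁅lorentzGen k, lorentzGen l⁆)) := by
    rw [gauge, gauge, Finset.sum_mul_sum, Finset.sum_mul_sum,
      Finset.sum_comm (f := fun k l => tmul (b k) (const (eL k)) * tmul (a l) (const (eL l))),
      ← Finset.sum_sub_distrib]
    refine Finset.sum_congr rfl fun k _ => ?_
    rw [← Finset.sum_sub_distrib]
    refine Finset.sum_congr rfl fun l _ => ?_
    rw [gen_lie, map_sub, const_mul, const_mul, tmul_sub, tmul_mul_tmul, tmul_mul_tmul,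
      mul_comm (b l)]
  rw [h]
  simp only [Fintype.sum_sum_type, lorentzGen, Sum.elim_inl, Sum.elim_inr, lie_M_M, lie_M_N,
    lie_N_M, lie_N_N, gen_neg, gen_smul, gen_sum, LinearMap.map_neg const, tmul_neg, Finset.sum_neg_distrib,
    Finset.sum_add_distrib]
  rw [sum_tmul_eps, sum_tmul_eps, sum_tmul_eps, sum_tmul_eps]
  have aux : ∀ a b c d : Ser (UTranslations ⊗[ℂ] ULorentz),
    a + b + (c + -d) = (a - d) + (c + b) := fun a b c d => by abel
  rw [aux, ← Finset.sum_sub_distrib, ← Finset.sum_add_distrib, gauge, Fintype.sum_sum_type]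
  simp only [← sub_tmul, ← add_tmul, ← smul_sub, ← smul_add, gaugeLie, Sum.elim_inl, Sum.elim_inr,
    eL_inl, eL_inr]

/-- The components of the coaction of an element of the Lorentz algebra. -/
def coactComp : Lorentz →ₗ[ℂ] (Fin 3 ⊕ Fin 3 → Ser UTranslations) where
  toFun x := Sum.elim
    (fun k => cS (x.m k) - hSer _ * (cS (x.n (k + 1)) * pS (k + 2) - cS (x.n (k + 2)) * pS (k + 1)) * yS)
    (fun k => cS (x.n k) * yS)
  map_add' x y := by
    funext k
    rcases k with k | k <;> simp only [Sum.elim_inl, Sum.elim_inr, Pi.add_apply, Lorentz.add_m,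
      Lorentz.add_n, map_add] <;> ring
  map_smul' c x := by
    funext k
    rcases k with k | k <;> simp only [Sum.elim_inl, Sum.elim_inr, Pi.smul_apply, Lorentz.smul_m,
      Lorentz.smul_n, map_mul, Algebra.smul_def, RingHom.id_apply] <;> ring

theorem coactComp_inl (x : Lorentz) (k : Fin 3) : coactComp x (.inl k) =
    cS (x.m k) - hSer _ * (cS (x.n (k + 1)) * pS (k + 2) - cS (x.n (k + 2)) * pS (k + 1)) * yS := rfl

theorem coactComp_inr (x : Lorentz) (k : Fin 3) : coactComp x (.inr k) = cS (x.n k) * yS := rfl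

theorem DL_cS (x : Lorentz) (c : ℂ) : DL x (cS c) = 0 := by
  rw [cS, Algebra.algebraMap_eq_smul_one, (DL x).map_smul_of_tower, DL_one, smul_zero]

theorem csmul_eq (c : ℂ) (v : Ser UTranslations) : c • v = cS c * v := Algebra.smul_def c v

/-- The Maurer–Cartan equation for the coaction, read off in components. The boost components are
polynomial identities once the derivative of Ξ⁻¹ is known; the rotation components need the
quadratic relation `XiInv_sq`. -/
theorem coactComp_lie (x y : Lorentz) : coactComp ⁅x, y⁆ =
    (fun k => DL y (coactComp x k)) - (fun k => DL x (coactComp y k)) +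
      gaugeLie (coactComp x) (coactComp y) := by
  have key := XiInv_sq pT eT
  funext k
  rcases k with k | k
  · simp only [coactComp_inl, coactComp_inr, Pi.add_apply, Pi.sub_apply, gaugeLie, Sum.elim_inl,
      map_sub, DL_mul, DL_cS, DL_hSer, DL_XiInv, DL_P4, csmul_eq, Lorentz.bracket_m,
      Lorentz.bracket_n, Lorentz.sum_eps, map_mul, map_add]
    fin_cases k
    · simp [DL_P_one, DL_P_two, -UniversalEnvelopingAlgebra.ι_apply]
      -- The bracket of two boosts is a rotation with constant coefficient, whereas the other terms
      -- carry powers of Ξ⁻¹; the quadratic relation expresses that constant through them.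
      linear_combination -cS Complex.I * (cS (x.n 1) * cS (y.n 2) - cS (x.n 2) * cS (y.n 1)) * key
    · simp [DL_P_zero, DL_P_two, -UniversalEnvelopingAlgebra.ι_apply]
      linear_combination -cS Complex.I * (cS (x.n 2) * cS (y.n 0) - cS (x.n 0) * cS (y.n 2)) * key
    · simp [DL_P_zero, DL_P_one, -UniversalEnvelopingAlgebra.ι_apply]
      linear_combination -cS Complex.I * (cS (x.n 0) * cS (y.n 1) - cS (x.n 1) * cS (y.n 0)) * key
  · simp only [coactComp_inl, coactComp_inr, Pi.add_apply, Pi.sub_apply, gaugeLie, Sum.elim_inr,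
      DL_mul, DL_cS, DL_XiInv, DL_P4, csmul_eq, Lorentz.bracket_n, Lorentz.sum_eps, map_mul,
      map_sub, map_add]
    fin_cases k <;> simp [-UniversalEnvelopingAlgebra.ι_apply] <;> ring

/-- The coaction of the elements of the Lorentz algebra. -/
def coactGen : Lorentz →ₗ[ℂ] Ser (UTranslations ⊗[ℂ] ULorentz) where
  toFun x := gauge (coactComp x)
  map_add' x y := by rw [map_add, gauge_add]
  map_smul' c x := by
    rw [map_smul]
    simp only [gauge, Pi.smul_apply, csmul_tmul, Finset.smul_sum, RingHom.id_apply]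

theorem tmap_DL_mul {B : Type} [Ring B] [Algebra ℂ B] (x : Lorentz) (b c : Ser (UTranslations ⊗[ℂ] B)) :
    tmap (DL x) LinearMap.id (b * c) =
      tmap (DL x) LinearMap.id b * c + b * tmap (DL x) LinearMap.id c := by
  refine isLinear_tmul_ext (f := fun b => tmap (DL x) LinearMap.id (b * c))
    (g := fun b => tmap (DL x) LinearMap.id b * c + b * tmap (DL x) LinearMap.id c) ?_ ?_
    (fun f u => ?_) b
  · exact ⟨fun _ _ => by simp only [add_mul, map_add],
      fun _ _ => by simp only [smul_mul_assoc, map_smul]⟩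
  · exact ⟨fun _ _ => by simp only [add_mul, map_add]; abel,
      fun _ _ => by simp only [smul_mul_assoc, map_smul, smul_add]⟩
  refine isLinear_tmul_ext (f := fun c => tmap (DL x) LinearMap.id (tmul f u * c))
    (g := fun c => tmap (DL x) LinearMap.id (tmul f u) * c +
      tmul f u * tmap (DL x) LinearMap.id c) ?_ ?_ (fun g v => ?_) c
  · exact ⟨fun _ _ => by simp only [mul_add, map_add],
      fun _ _ => by simp only [mul_smul_comm, map_smul]⟩
  · exact ⟨fun _ _ => by simp only [mul_add, map_add]; abel,
      fun _ _ => by simp only [mul_smul_comm, map_smul, smul_add]⟩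
  simp only [tmul_mul_tmul, tmap_tmul, DL_mul, add_tmul, LinearMap.id_apply]

/-- The right action of the Lorentz algebra whose orbit map is the coaction. -/
def coactOp : Lorentz →ₗ[ℂ] Module.End K (Ser (UTranslations ⊗[ℂ] ULorentz)) where
  toFun x := tmap (DL x) LinearMap.id + LinearMap.mulRight K (coactGen x)
  map_add' x y := LinearMap.ext fun b => by
    simp only [LinearMap.add_apply, LinearMap.mulRight_apply, map_add, mul_add]
    have : tmap (DL (x + y)) LinearMap.id b =
        tmap (DL x) LinearMap.id b + tmap (DL y) LinearMap.id b :=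
      LinearMap.congr_fun (f := tmap (DL (x + y)) LinearMap.id)
        (g := tmap (DL x) LinearMap.id + tmap (DL y) LinearMap.id)
        (tmul_ext fun f u => by
          simp only [LinearMap.add_apply, tmap_tmul, DL_add, add_tmul]) b
    rw [this]
    abel
  map_smul' c x := LinearMap.ext fun b => by
    simp only [LinearMap.add_apply, LinearMap.smul_apply, LinearMap.mulRight_apply, map_smul,
      mul_smul_comm, RingHom.id_apply, smul_add]
    have : tmap (DL (c • x)) LinearMap.id b = c • tmap (DL x) LinearMap.id b :=
      LinearMap.congr_fun (f := tmap (DL (c • x)) LinearMap.id)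
        (g := c • tmap (DL x) LinearMap.id)
        (tmul_ext fun f u => by
          simp only [LinearMap.smul_apply, tmap_tmul, DL_smul, csmul_tmul]) b
    rw [this]

theorem coactOp_apply (x : Lorentz) (b : Ser (UTranslations ⊗[ℂ] ULorentz)) :
    coactOp x b = tmap (DL x) LinearMap.id b + b * coactGen x := rfl

theorem tmap_DL_lie {B : Type} [Ring B] [Algebra ℂ B] (x y : Lorentz)
    (b : Ser (UTranslations ⊗[ℂ] B)) : tmap (DL ⁅x, y⁆) LinearMap.id b =
      tmap (DL y) LinearMap.id (tmap (DL x) LinearMap.id b) -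
        tmap (DL x) LinearMap.id (tmap (DL y) LinearMap.id b) :=
  LinearMap.congr_fun (f := tmap (DL ⁅x, y⁆) LinearMap.id)
    (g := tmap (DL y) LinearMap.id ∘ₗ tmap (DL x) LinearMap.id -
      tmap (DL x) LinearMap.id ∘ₗ tmap (DL y) LinearMap.id)
    (tmul_ext fun f u => by
      simp only [LinearMap.sub_apply, LinearMap.comp_apply, tmap_tmul, DL_lie, sub_tmul,
        LinearMap.id_apply]) b

/-- The same equation inside the algebra 𝒜 ⊗̂ ℋ. It serves twice: to define the coaction, and to
make the deformed coproduct on io(1,3) respect brackets. -/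
theorem coactGen_lie (x y : Lorentz) : coactGen ⁅x, y⁆ =
    tmap (DL y) LinearMap.id (coactGen x) - tmap (DL x) LinearMap.id (coactGen y) +
      (coactGen x * coactGen y - coactGen y * coactGen x) := by
  have h : ∀ (x : Lorentz) (a : Fin 3 ⊕ Fin 3 → Ser UTranslations),
      tmap (DL x) LinearMap.id (gauge a) = gauge fun k => DL x (a k) := fun x a => by
    simp only [gauge, map_sum, tmap_tmul, LinearMap.id_apply]
  change gauge _ = tmap (DL y) _ (gauge _) - tmap (DL x) _ (gauge _) +
    (gauge _ * gauge _ - gauge _ * gauge _)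
  rw [gauge_commutator, h, h, coactComp_lie, gauge_add, gauge_sub]

/-- In the commutator of D_y + R_{c(y)} and D_x + R_{c(x)}, where R denotes right multiplication,
the mixed terms b ↦ D_x(b) c(y) cancel by the Leibniz rule, and the rest is the Maurer–Cartan
equation. -/
theorem coactOp_lie (x y : Lorentz) :
    coactOp ⁅x, y⁆ = coactOp y * coactOp x - coactOp x * coactOp y := LinearMap.ext fun b => by
  rw [LinearMap.sub_apply, Module.End.mul_apply, Module.End.mul_apply]
  simp only [coactOp_apply, map_add, tmap_DL_mul, tmap_DL_lie, coactGen_lie, mul_add,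
    mul_sub, mul_assoc]
  abel

/-- The coaction `β_κ`. -/
def kappaCoact : Ser ULorentz →ₗ[K] Ser (UTranslations ⊗[ℂ] ULorentz) :=
  orbit coactOp coactOp_lie (tmul 1 1)

theorem kappaCoact_one : kappaCoact 1 = tmul 1 1 := orbit_one _ _ _

theorem kappaCoact_mul_gen (u : Ser ULorentz) (x : Lorentz) : kappaCoact (u * const (gen x)) =
    tmap (DL x) LinearMap.id (kappaCoact u) + kappaCoact u * coactGen x := orbit_mul_gen _ _ _ _ _

theorem kappaCoact_gen (x : Lorentz) : kappaCoact (const (gen x)) = coactGen x := by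
  have := kappaCoact_mul_gen 1 x
  rw [one_mul, kappaCoact_one, tmap_tmul, DL_one, zero_tmul, zero_add, one_tmul_one,
    one_mul] at this
  exact this

end Coaction

/-! ### Compatibility of the action and coaction with the deformed coproduct -/

section ComulDer

theorem transComul_cS (c : ℂ) : transComul (cS c) = algebraMap ℂ _ c := by
  rw [cS, Algebra.algebraMap_eq_smul_one, transComul.map_smul_of_tower, isAlg_transComul.one,
    Algebra.algebraMap_eq_smul_one]

theorem inlHom_cS (c : ℂ) : inlHom UTranslations UTranslations (cS c) = algebraMap ℂ _ c := by
  change tmul _ _ = _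
  rw [cS, Algebra.algebraMap_eq_smul_one, csmul_tmul, one_tmul_one, Algebra.algebraMap_eq_smul_one]

theorem inrHom_cS (c : ℂ) : inrHom UTranslations UTranslations (cS c) = algebraMap ℂ _ c := by
  change tmul _ _ = _
  rw [cS, Algebra.algebraMap_eq_smul_one, tmul_csmul, one_tmul_one, Algebra.algebraMap_eq_smul_one]

/-- The matrix of the coaction in the basis of the Lorentz algebra. -/
def coactMat (k l : Fin 3 ⊕ Fin 3) : Ser UTranslations := coactComp (lorentzGen k) l

/-- The coefficients `c l` commute with everything in 𝒜, so a sum of derivations weighted by them is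
still a derivation. Hence Δ(D_x f) need only be computed on generators. -/
theorem spread_mul {ι : Type} [Fintype ι] {D : Ser UTranslations →ₗ[K] Ser UTranslations}
    {c : ι → Ser UTranslations} {T : ι → Ser UTranslations →ₗ[K] Ser UTranslations}
    (hD : ∀ f g, D (f * g) = D f * g + f * D g) (hT : ∀ l f g, T l (f * g) = T l f * g + f * T l g)
    (b b' : Ser (UTranslations ⊗[ℂ] UTranslations)) :
    spread D c T (b * b') = spread D c T b * b' + b * spread D c T b' := by
  refine isLinear_tmul_ext (f := fun b => spread D c T (b * b'))
    (g := fun b => spread D c T b * b' + b * spread D c T b') ?_ ?_ (fun f u => ?_) b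
  · exact ⟨fun _ _ => by simp only [add_mul, map_add],
      fun _ _ => by simp only [smul_mul_assoc, map_smul]⟩
  · exact ⟨fun _ _ => by simp only [add_mul, map_add]; ring,
      fun _ _ => by simp only [smul_mul_assoc, map_smul, smul_add]⟩
  refine isLinear_tmul_ext (f := fun b' => spread D c T (tmul f u * b'))
    (g := fun b' => spread D c T (tmul f u) * b' + tmul f u * spread D c T b') ?_ ?_
    (fun g v => ?_) b'
  · exact ⟨fun _ _ => by simp only [mul_add, map_add],
      fun _ _ => by simp only [mul_smul_comm, map_smul]⟩
  · exact ⟨fun _ _ => by simp only [mul_add, map_add]; ring,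
      fun _ _ => by simp only [mul_smul_comm, map_smul, smul_add]⟩
  simp only [tmul_mul_tmul, spread_tmul, hD, hT, add_tmul, tmul_add, add_mul, mul_add,
    Finset.sum_add_distrib, Finset.sum_mul, Finset.mul_sum, mul_assoc, mul_left_comm f]
  abel

theorem DL_M_P4 (j : Fin 3) : DL (Lorentz.M j) eS = 0 := by
  rw [DL_P4]
  simp [-UniversalEnvelopingAlgebra.ι_apply]

theorem DL_N_P4 (j : Fin 3) : DL (Lorentz.N j) eS = cS Complex.I * pS j := by
  rw [DL_P4]
  fin_cases j <;> simp [-UniversalEnvelopingAlgebra.ι_apply]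

/-- The action of the basis of the Lorentz algebra. -/
abbrev DGen (l : Fin 3 ⊕ Fin 3) : Ser UTranslations →ₗ[K] Ser UTranslations := DL (lorentzGen l)

theorem spread_DGen_tmul (x : Lorentz) (f g : Ser UTranslations) :
    spread (DL x) (coactComp x) DGen (tmul f g) = tmul (DL x f) g +
      ((tmul (coactComp x (.inl 0) * f) (DL (Lorentz.M 0) g) +
        tmul (coactComp x (.inl 1) * f) (DL (Lorentz.M 1) g) +
        tmul (coactComp x (.inl 2) * f) (DL (Lorentz.M 2) g)) +
      (tmul (coactComp x (.inr 0) * f) (DL (Lorentz.N 0) g) +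
        tmul (coactComp x (.inr 1) * f) (DL (Lorentz.N 1) g) +
        tmul (coactComp x (.inr 2) * f) (DL (Lorentz.N 2) g))) := by
  rw [spread_tmul, Fintype.sum_sum_type, Fin.sum_univ_three, Fin.sum_univ_three]
  rfl

theorem coactComp_values (x : Lorentz) :
    coactComp x (.inl 0) = cS (x.m 0) - hSer _ * (cS (x.n 1) * pS 2 - cS (x.n 2) * pS 1) * yS ∧
    coactComp x (.inl 1) = cS (x.m 1) - hSer _ * (cS (x.n 2) * pS 0 - cS (x.n 0) * pS 2) * yS ∧
    coactComp x (.inl 2) = cS (x.m 2) - hSer _ * (cS (x.n 0) * pS 1 - cS (x.n 1) * pS 0) * yS :=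
  ⟨coactComp_inl x 0, coactComp_inl x 1, coactComp_inl x 2⟩

theorem transComul_DL_P (x : Lorentz) (i : Fin 3) : transComul (DL x (pS i)) =
    spread (DL x) (coactComp x) DGen (transComul (pS i)) := by
  obtain ⟨h0, h1, h2⟩ := coactComp_values x
  rw [DL_P, isAlg_transComul.mul, map_add, map_sub, isAlg_transComul.mul, isAlg_transComul.mul,
    isAlg_transComul.mul, transComul_P, transComul_P, transComul_P, transComul_P4, map_add]
  simp only [spread_DGen_tmul, DL_Xi, DL_M_P4, DL_N_P4, h0, h1, h2, coactComp_inr,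
    DL_one, transComul_cS, Fin.sum_univ_three, DL_P]
  fin_cases i <;> simp [-UniversalEnvelopingAlgebra.ι_apply, tmul_eq_mul, inlHom_cS, inrHom_cS,
      inlHom_hSer, inrHom_hSer] <;> ring

theorem transComul_DL_P4 (x : Lorentz) : transComul (DL x eS) =
    spread (DL x) (coactComp x) DGen (transComul eS) := by
  obtain ⟨h0, h1, h2⟩ := coactComp_values x
  -- Applying D_x to Ξ⁻¹ ⊗ P₄ and h P_m Ξ⁻¹ ⊗ P_m yields terms in Ξ⁻² in the first leg; the
  -- quadratic relation there restores the term 1 ⊗ P_i required by the left side.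
  have key := congrArg (inlHom UTranslations UTranslations) (XiInv_sq pT eT)
  simp only [DL_P4, isAlg_transComul.mul, map_add, transComul_P, transComul_P4,
    spread_DGen_tmul, DL_Xi, DL_XiInv, DL_mul, DL_hSer, h0, h1, h2,
    coactComp_inr, DL_P_zero, DL_P_one, DL_P_two, transComul_cS,
    Fin.sum_univ_three]
  simp [-UniversalEnvelopingAlgebra.ι_apply, tmul_eq_mul, inlHom_cS, inrHom_cS,
      inlHom_hSer, inrHom_hSer, map_ofNat] at key ⊢
  linear_combination algebraMap ℂ _ Complex.I * (algebraMap ℂ _ (x.n 0) * inrHom _ _ (pS 0) +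
    algebraMap ℂ _ (x.n 1) * inrHom _ _ (pS 1) + algebraMap ℂ _ (x.n 2) * inrHom _ _ (pS 2)) * key

/-- Both sides satisfy the Leibniz rule relative to the homomorphism Δ, so the cases of P_i and P₄
settle it. This is the infinitesimal form of Majid's condition (A). -/
theorem transComul_DL (x : Lorentz) (f : Ser UTranslations) : transComul (DL x f) =
    spread (DL x) (coactComp x) DGen (transComul f) := by
  refine LinearMap.congr_fun (f := transComul ∘ₗ DL x)
    (g := spread (DL x) (coactComp x) DGen ∘ₗ transComul) (adjoin_ext adjoin_transGen ?_
      fun k u hu => ?_) f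
  · simp only [LinearMap.comp_apply, DL_one, map_zero, isAlg_transComul.one, ← one_tmul_one,
      spread_tmul, zero_tmul, tmul_zero, Finset.sum_const_zero, add_zero]
  · have hk : transComul (DL x (const (gen (transGen k)))) =
        spread (DL x) (coactComp x) DGen (transComul (const (gen (transGen k)))) := by
      rcases k with i | _
      · exact transComul_DL_P x i
      · exact transComul_DL_P4 x
    simp only [LinearMap.comp_apply] at hu ⊢
    rw [DL_mul, map_add, isAlg_transComul.mul, isAlg_transComul.mul, isAlg_transComul.mul, hk, hu,
      spread_mul (DL_mul x) fun l => DL_mul (lorentzGen l)]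

theorem transCounit_DL (x : Lorentz) (f : Ser UTranslations) : transCounit (DL x f) = 0 := by
  refine LinearMap.congr_fun (f := transCounit ∘ₗ DL x) (g := 0) (adjoin_ext adjoin_transGen ?_
      fun k u hu => ?_) f
  · simp only [LinearMap.comp_apply, DL_one, map_zero, LinearMap.zero_apply]
  · have hk : transCounit (DL x (const (gen (transGen k)))) = 0 := by
      rcases k with i | _
      · change transCounit (DL x (pS i)) = 0
        rw [DL_P]
        simp only [isAlg_transCounit.mul, map_add, map_sub, transCounit_P, transCounit_P4, mul_zero,
          sub_zero, add_zero]
      · change transCounit (DL x eS) = 0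
        rw [DL_P4]
        simp only [isAlg_transCounit.mul, map_add, transCounit_P, mul_zero, add_zero]
    have hg : transCounit (const (gen (transGen k))) = 0 := by
      rcases k with i | _
      · exact transCounit_P i
      · exact transCounit_P4
    simp only [LinearMap.comp_apply, LinearMap.zero_apply] at hu ⊢
    rw [DL_mul, map_add, isAlg_transCounit.mul, isAlg_transCounit.mul, hk, hg, mul_zero, mul_zero,
      add_zero]

/-- In the splitting into rotations and boosts the matrix is block triangular, with diagonal blocks
the identity and Ξ⁻¹, and a boost–rotation block of entries ±h P_j Ξ⁻¹. Thus the rule combines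
group-likeness of Ξ⁻¹ with skew-primitivity of h P_j Ξ⁻¹. -/
theorem transComul_coactMat (k l : Fin 3 ⊕ Fin 3) :
    transComul (coactMat k l) = ∑ m, tmul (coactMat k m) (coactMat m l) := by
  rw [Fintype.sum_sum_type, Fin.sum_univ_three, Fin.sum_univ_three]
  rcases k with k | k <;> rcases l with l | l <;>
    simp only [coactMat, lorentzGen, Sum.elim_inl, Sum.elim_inr, coactComp_inl, coactComp_inr,
      map_sub, isAlg_transComul.mul, transComul_cS, isAlg_transComul.map_hSer, transComul_P,
      transComul_XiInv, tmul_eq_mul, map_mul, inlHom_cS, inrHom_cS, inlHom_hSer, inrHom_hSer,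
      Lorentz.M_m, Lorentz.M_n, Lorentz.N_m, Lorentz.N_n]
  · fin_cases k <;> fin_cases l <;> simp [-UniversalEnvelopingAlgebra.ι_apply]
  · simp [-UniversalEnvelopingAlgebra.ι_apply]
  · have h := congrArg (inrHom UTranslations UTranslations) (Xi_mul_XiInv_ser pT eT)
    rw [map_mul, map_one] at h
    fin_cases k <;> fin_cases l <;> simp [-UniversalEnvelopingAlgebra.ι_apply]
    · linear_combination hSer _ * inlHom _ _ (pS 2) * inlHom _ _ yS * h
    · linear_combination -hSer _ * inlHom _ _ (pS 1) * inlHom _ _ yS * h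
    · linear_combination -hSer _ * inlHom _ _ (pS 2) * inlHom _ _ yS * h
    · linear_combination hSer _ * inlHom _ _ (pS 0) * inlHom _ _ yS * h
    · linear_combination hSer _ * inlHom _ _ (pS 1) * inlHom _ _ yS * h
    · linear_combination -hSer _ * inlHom _ _ (pS 0) * inlHom _ _ yS * h
  · fin_cases k <;> fin_cases l <;> simp [-UniversalEnvelopingAlgebra.ι_apply]

theorem transCounit_coactMat (k l : Fin 3 ⊕ Fin 3) :
    toK (transCounit (coactMat k l)) = if k = l then 1 else 0 := by
  have hc : ∀ c, transCounit (cS c) = algebraMap ℂ _ c := fun c => by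
    rw [cS, Algebra.algebraMap_eq_smul_one, transCounit.map_smul_of_tower, isAlg_transCounit.one,
      Algebra.algebraMap_eq_smul_one]
  rcases k with k | k <;> rcases l with l | l <;>
    simp only [coactMat, lorentzGen, Sum.elim_inl, Sum.elim_inr, coactComp_inl, coactComp_inr,
      map_sub, isAlg_transCounit.mul, hc, isAlg_transCounit.map_hSer, transCounit_P,
      transCounit_XiInv, Lorentz.M_m, Lorentz.M_n, Lorentz.N_m, Lorentz.N_n]
  · fin_cases k <;> fin_cases l <;> simp
  · simp
  · simp
  · fin_cases k <;> fin_cases l <;> simp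

/-- The concrete data meet the abstract hypotheses; from here on every axiom of the first three
parts is formal. -/
theorem bicrossData : BicrossData lorentzHopf transHopf classicalAct kappaCoact eL DGen coactMat where
  adjoin_e := adjoin_eL
  classical_H := primHopf_classical _
  classical_A := isKappaTranslations.classical
  comul_e k := primComul_gen _
  counit_e k := primCounit_gen _
  D_mul k := DL_mul _
  act_one := classicalAct_one
  act_mul_e f L k := classicalAct_mul_gen _ _ _
  coact_one := kappaCoact_one
  coact_mul_e L k := by
    rw [kappaCoact_mul_gen]
    generalize kappaCoact L = b
    refine isLinear_tmul_ext (f := fun b => tmap (DL (lorentzGen k)) LinearMap.id b +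
        b * coactGen (lorentzGen k))
      (g := fun b => spread (DGen k) (coactMat k) (fun l => LinearMap.mulRight K (const (eL l))) b)
      ?_ ?_ (fun f u => ?_) b
    · exact ⟨fun _ _ => by simp only [add_mul, map_add]; abel,
        fun _ _ => by simp only [smul_mul_assoc, map_smul, smul_add]⟩
    · exact ⟨map_add _, map_smul _⟩
    rw [spread_tmul, tmap_tmul]
    change _ + tmul f u * gauge _ = _
    rw [gauge, Finset.mul_sum]
    simp only [tmul_mul_tmul, mul_comm f]
    rfl
  comul_D k := transComul_DL _
  counit_D k := transCounit_DL _
  comul_a := transComul_coactMat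
  counit_a := transCounit_coactMat

end ComulDer

/-! ### Values on generators, and uniqueness of action and coaction -/

section Uniqueness

theorem coactGen_M (i : Fin 3) :
    coactGen (Lorentz.M i) = tmul 1 (const (gen (Lorentz.M i))) := by
  change gauge _ = _
  rw [gauge, Fintype.sum_sum_type]
  simp only [eL_inl, eL_inr, coactComp_inl, coactComp_inr, Lorentz.M_m, Lorentz.M_n]
  rw [Finset.sum_eq_single i]
  · simp [-UniversalEnvelopingAlgebra.ι_apply]
  · intro j _ hj
    simp [-UniversalEnvelopingAlgebra.ι_apply, hj]
  · simp

theorem coactGen_N (i : Fin 3) :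
    coactGen (Lorentz.N i) = tmul yS (const (gen (Lorentz.N i))) -
      ∑ j : Fin 3, ∑ m : Fin 3,
        eps i j m • tmul (ofPS (hPXiInv pT eT j)) (const (gen (Lorentz.M m))) := by
  change gauge _ = _
  rw [gauge, Fintype.sum_sum_type]
  simp only [eL_inl, eL_inr, coactComp_inl, coactComp_inr, Lorentz.N_m, Lorentz.N_n,
    ofPS_hPXiInv, Fin.sum_univ_three]
  fin_cases i <;>
    simp [-UniversalEnvelopingAlgebra.ι_apply, eps, neg_tmul] <;>
    norm_num [-UniversalEnvelopingAlgebra.ι_apply] <;> abel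

theorem hasKappaValues : HasKappaValues kappaCoact where
  coact_M i := by rw [kappaCoact_gen, coactGen_M, const_one]
  coact_N i := by rw [kappaCoact_gen, coactGen_N]

theorem HasKappaValues.coact_gen {β : Ser ULorentz →ₗ[K] Ser (UTranslations ⊗[ℂ] ULorentz)}
    (h : HasKappaValues β) (k : Fin 3 ⊕ Fin 3) : β (const (eL k)) = coactGen (lorentzGen k) := by
  rcases k with i | i
  · exact (h.coact_M i).trans (coactGen_M i).symm
  · exact (h.coact_N i).trans (coactGen_N i).symm

/-- Condition (B) with M = e_k primitive expresses β(L e_k) through β(L) and the known β(e_k), and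
this is the recursion of the orbit map. -/
theorem HasKappaValues.eq_kappaCoact
    {β : Ser ULorentz →ₗ[K] Ser (UTranslations ⊗[ℂ] ULorentz)} (h : HasKappaValues β)
    (hm : IsMultiplicativeCoaction lorentzHopf transHopf classicalAct β) : β = kappaCoact := by
  have h1 : β 1 = tmul 1 1 := hm.coact_one
  refine recursion_ext adjoin_eL (h1.trans kappaCoact_one.symm)
    (fun k b => tmap (DL (lorentzGen k)) LinearMap.id b + b * coactGen (lorentzGen k))
    (fun k L => ?_) (fun k L => kappaCoact_mul_gen _ _)
  have hmul := hm.coact_mul L (const (eL k))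
  rw [(primHopf_classical _).mul_tmul, bicrossData.comul_e, map_add, tmap_tmul, tmap_tmul,
    h1, h.coact_gen] at hmul
  rw [hmul, tmul_add, map_add, map_add]
  generalize β L = b
  generalize coactGen (lorentzGen k) = c
  -- The summand e_k ⊗ 1 of the coproduct makes the generator act on the 𝒜-leg; the summand 1 ⊗ e_k,
  -- treated in `e2`, multiplies by its coaction.
  have e1 : ∀ b, crossMap classicalAct (mulMap ULorentz)
      (tmul b (tmul (const (eL k)) (tmul (1 : Ser UTranslations) (1 : Ser ULorentz)))) =
      tmap (DL (lorentzGen k)) LinearMap.id b := fun b => by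
    refine isLinear_tmul_ext (f := fun b => crossMap classicalAct (mulMap ULorentz)
        (tmul b (tmul (const (eL k)) (tmul (1 : Ser UTranslations) (1 : Ser ULorentz)))))
      (g := fun b => tmap (DL (lorentzGen k)) LinearMap.id b) ?_ ⟨map_add _, map_smul _⟩
      (fun f u => ?_) b
    · exact ⟨fun _ _ => by simp only [add_tmul, map_add],
        fun _ _ => by simp only [smul_tmul, map_smul]⟩
    · simp only [crossMap_tmul, classicalAct_gen, mulMap_tmul, mul_one, tmap_tmul,
        LinearMap.id_apply]
  have e2 : ∀ b c, crossMap classicalAct (mulMap ULorentz) (tmul b (tmul 1 c)) = b * c :=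
    fun b c => by
    refine isLinear_tmul_ext
      (f := fun b => crossMap classicalAct (mulMap ULorentz) (tmul b (tmul 1 c)))
      (g := fun b => b * c) ?_ ?_ (fun f u => ?_) b
    · exact ⟨fun _ _ => by simp only [add_tmul, map_add],
        fun _ _ => by simp only [smul_tmul, map_smul]⟩
    · exact ⟨fun _ _ => by simp only [add_mul], fun _ _ => by simp only [smul_mul_assoc]⟩
    refine isLinear_tmul_ext
      (f := fun c => crossMap classicalAct (mulMap ULorentz) (tmul (tmul f u) (tmul 1 c)))
      (g := fun c => tmul f u * c) ?_ ?_ (fun g v => ?_) c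
    · exact ⟨fun _ _ => by simp only [tmul_add, map_add],
        fun _ _ => by simp only [tmul_smul, map_smul]⟩
    · exact ⟨fun _ _ => by simp only [mul_add], fun _ _ => by simp only [mul_smul_comm]⟩
    rw [crossMap_tmul, classicalAct_one, mulMap_tmul, tmul_mul_tmul]
  exact congrArg₂ (· + ·) (e1 b) (e2 b c)

theorem isClassicalAction : IsClassicalAction lorentzHopf transHopf classicalAct where
  moduleAlgebra := bicrossData.isRightModuleAlgebra
  P_act_M k j := by
    rw [classicalAct_gen, DL_P, Fin.sum_univ_three]
    simp only [csmul_eq]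
    fin_cases k <;> fin_cases j <;>
      simp [-UniversalEnvelopingAlgebra.ι_apply, eps, map_ofNat] <;>
      norm_num [-UniversalEnvelopingAlgebra.ι_apply]
  P4_act_M j := by
    rw [classicalAct_gen, DL_P4]
    simp [-UniversalEnvelopingAlgebra.ι_apply]
  P_act_N k j := by
    rw [classicalAct_gen, DL_P]
    simp only [csmul_eq]
    fin_cases k <;> fin_cases j <;> simp [-UniversalEnvelopingAlgebra.ι_apply]
  P4_act_N j := by
    rw [classicalAct_gen, DL_P4]
    simp only [csmul_eq]
    fin_cases j <;> simp [-UniversalEnvelopingAlgebra.ι_apply]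

/-- In a module algebra a primitive element acts by a derivation killing 1, so its values on the
momenta decide everything. -/
theorem IsClassicalAction.act_gen {act : Ser (UTranslations ⊗[ℂ] ULorentz) →ₗ[K] Ser UTranslations}
    (h : IsClassicalAction lorentzHopf transHopf act) (f : Ser UTranslations) (k : Fin 3 ⊕ Fin 3) :
    act (tmul f (const (eL k))) = DL (lorentzGen k) f := by
  have h1 : ∀ f, act (tmul f 1) = f := h.moduleAlgebra.act_one
  refine LinearMap.congr_fun (f := act ∘ₗ tmulRight (const (eL k))) (g := DL (lorentzGen k))
    (adjoin_ext adjoin_transGen ?_ fun l u hu => ?_) f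
  · have := h.moduleAlgebra.one_act (const (eL k))
    rw [show lorentzHopf.counit (const (eL k)) = 0 from bicrossData.counit_e k, zero_tmul,
      map_zero] at this
    rw [DL_one]
    exact this
  · have hl : act (tmul (const (gen (transGen l))) (const (eL k))) =
        DL (lorentzGen k) (const (gen (transGen l))) := by
      rw [← classicalAct_gen]
      rcases l with i | _ <;> rcases k with j | j
      · exact (h.P_act_M i j).trans (isClassicalAction.P_act_M i j).symm
      · exact (h.P_act_N i j).trans (isClassicalAction.P_act_N i j).symm
      · exact (h.P4_act_M j).trans (isClassicalAction.P4_act_M j).symm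
      · exact (h.P4_act_N j).trans (isClassicalAction.P4_act_N j).symm
    have := h.moduleAlgebra.mul_act (const u) (const (gen (transGen l))) (const (eL k))
    rw [isKappaTranslations.classical.mul_tmul, isKappaTranslations.classical.1,
      bicrossData.comul_e, tmul_add, map_add, coeffwise_tttComm, coeffwise_tttComm, map_add,
      tmap_tmul, tmap_tmul, h1, h1, map_add, mulMap_tmul, mulMap_tmul, hl] at this
    rw [LinearMap.comp_apply, tmulRight_apply] at hu ⊢
    rw [this, hu, DL_mul]

theorem IsClassicalAction.eq_classicalAct
    {act : Ser (UTranslations ⊗[ℂ] ULorentz) →ₗ[K] Ser UTranslations}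
    (h : IsClassicalAction lorentzHopf transHopf act) : act = classicalAct := by
  have h1 : ∀ f, act (tmul f 1) = f := h.moduleAlgebra.act_one
  refine tmul_ext fun f L => ?_
  refine LinearMap.congr_fun (f := act ∘ₗ tmulLeft f) (g := classicalAct ∘ₗ tmulLeft f)
    (recursion_ext adjoin_eL ?_ (fun k => DL (lorentzGen k)) (fun k u => ?_) (fun k u => ?_)) L
  · rw [LinearMap.comp_apply, LinearMap.comp_apply, tmulLeft_apply, h1, classicalAct_one]
  · have := h.moduleAlgebra.act_act f u (const (eL k))
    rw [(primHopf_classical _).mul_tmul, h.act_gen] at this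
    exact this.symm
  · exact classicalAct_mul_gen f u (lorentzGen k)

end Uniqueness

/-! ### Hopf structure on an algebra factorised as ℋ times 𝒜 -/

namespace HasClassicalProduct

variable {U : Type} [Ring U] [Algebra ℂ U] {𝒰 : HopfStr U}

theorem antipode_left (h : HasClassicalProduct 𝒰) (v : Ser U) :
    mulMap U (tmap 𝒰.antipode LinearMap.id (𝒰.comul v)) = toK (𝒰.counit v) • 1 := by
  rw [mulMap, ← h.1, 𝒰.antipode_left, coeffwise_lid_tmul, h.2, const_one]

theorem antipode_right (h : HasClassicalProduct 𝒰) (v : Ser U) :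
    mulMap U (tmap LinearMap.id 𝒰.antipode (𝒰.comul v)) = toK (𝒰.counit v) • 1 := by
  rw [mulMap, ← h.1, 𝒰.antipode_right, coeffwise_lid_tmul, h.2, const_one]

end HasClassicalProduct

theorem Ser.coeffwise_assoc_tmap {X Y Z X' Y' Z' : Type} [AddCommGroup X] [Module ℂ X]
    [AddCommGroup Y] [Module ℂ Y] [AddCommGroup Z] [Module ℂ Z] [AddCommGroup X'] [Module ℂ X']
    [AddCommGroup Y'] [Module ℂ Y'] [AddCommGroup Z'] [Module ℂ Z'] (f : Ser X →ₗ[K] Ser X')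
    (g : Ser Y →ₗ[K] Ser Y') (k : Ser Z →ₗ[K] Ser Z') (z : Ser ((X ⊗[ℂ] Y) ⊗[ℂ] Z)) :
    coeffwise (TensorProduct.assoc ℂ X' Y' Z').toLinearMap (tmap (tmap f g) k z) =
      tmap f (tmap g k) (coeffwise (TensorProduct.assoc ℂ X Y Z).toLinearMap z) := by
  refine LinearMap.congr_fun
    (f := coeffwise (TensorProduct.assoc ℂ X' Y' Z').toLinearMap ∘ₗ tmap (tmap f g) k)
    (g := tmap f (tmap g k) ∘ₗ coeffwise (TensorProduct.assoc ℂ X Y Z).toLinearMap)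
    (tmul_ext fun w z => ?_) z
  refine isLinear_tmul_ext
    (f := fun w => (coeffwise (TensorProduct.assoc ℂ X' Y' Z').toLinearMap ∘ₗ
      tmap (tmap f g) k) (tmul w z))
    (g := fun w => (tmap f (tmap g k) ∘ₗ
      coeffwise (TensorProduct.assoc ℂ X Y Z).toLinearMap) (tmul w z))
    ⟨fun _ _ => by simp [add_tmul], fun _ _ => by simp [smul_tmul]⟩
    ⟨fun _ _ => by simp [add_tmul], fun _ _ => by simp [smul_tmul]⟩ (fun x y => ?_) w
  simp

section Smash

variable {H A U ι : Type} [Ring H] [Algebra ℂ H] [CommRing A] [Algebra ℂ A] [Ring U] [Algebra ℂ U]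
  [Fintype ι]

/-- An algebra `U` generated by copies of `H` and `A`, with the cross relations given by the
derivations `D k`, and with a coproduct which extends that of `A` and twists that of `H` by the
coaction `e k ↦ ∑ l, a k l ⊗ e l`. -/
structure SmashData (𝒜 : HopfStr A) (e : ι → H) (D : ι → Ser A →ₗ[K] Ser A) (a : ι → ι → Ser A)
    (J : Ser H →ₗ[K] Ser U) (I : Ser A →ₗ[K] Ser U) (Δ : Ser U →ₗ[K] Ser (U ⊗[ℂ] U))
    (ε : Ser U →ₗ[K] Ser ℂ) (Ψ : Ser (H ⊗[ℂ] A) ≃ₗ[K] Ser U) : Prop where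
  alg_J : IsAlg J
  alg_I : IsAlg I
  alg_comul : IsAlg Δ
  alg_counit : IsAlg ε
  alg_antipode : IsAlg 𝒜.antipode
  equiv_tmul : ∀ L f, Ψ (tmul L f) = J L * I f
  cross : ∀ f k, I f * J (const (e k)) = J (const (e k)) * I f + I (D k f)
  comul_I : ∀ f, Δ (I f) = tmap I I (𝒜.comul f)
  comul_J_e : ∀ k, Δ (J (const (e k))) =
    tmul (J (const (e k))) 1 + ∑ l, tmul (I (a k l)) (J (const (e l)))
  counit_I : ∀ f, ε (I f) = 𝒜.counit f
  counit_J_e : ∀ k, ε (J (const (e k))) = 0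

end Smash

namespace SmashData

variable {H A U ι : Type} [Ring H] [Algebra ℂ H] [CommRing A] [Algebra ℂ A] [Ring U] [Algebra ℂ U]
  [Fintype ι] [DecidableEq ι]
  {ℋ : HopfStr H} {𝒜 : HopfStr A} {act : Ser (A ⊗[ℂ] H) →ₗ[K] Ser A}
  {β : Ser H →ₗ[K] Ser (A ⊗[ℂ] H)} {e : ι → H} {D : ι → Ser A →ₗ[K] Ser A}
  {a : ι → ι → Ser A} {J : Ser H →ₗ[K] Ser U} {I : Ser A →ₗ[K] Ser U}
  {Δ : Ser U →ₗ[K] Ser (U ⊗[ℂ] U)} {ε : Ser U →ₗ[K] Ser ℂ} {Ψ : Ser (H ⊗[ℂ] A) ≃ₗ[K] Ser U}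

/-- The map `L ⊗ M ↦ L M⁽⁻¹⁾ ⊗ M⁽⁰⁾`. -/
def twist (β : Ser H →ₗ[K] Ser (A ⊗[ℂ] H)) (J : Ser H →ₗ[K] Ser U) (I : Ser A →ₗ[K] Ser U) :
    Ser (H ⊗[ℂ] H) →ₗ[K] Ser (U ⊗[ℂ] U) :=
  mulMap (U ⊗[ℂ] U) ∘ₗ tmap (tmulRight 1 ∘ₗ J) (tmap I J ∘ₗ β)

theorem twist_tmul (L M : Ser H) :
    twist β J I (tmul L M) = tmul (J L) 1 * tmap I J (β M) := by
  simp only [twist, LinearMap.comp_apply, tmap_tmul, mulMap_tmul, tmulRight_apply]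

variable (s : SmashData 𝒜 e D a J I Δ ε Ψ) (d : BicrossData ℋ 𝒜 act β e D a)

include s

theorem hom_ext {X : Type} [AddCommGroup X] [Module ℂ X] {F G : Ser U →ₗ[K] Ser X}
    (h : ∀ L f, F (J L * I f) = G (J L * I f)) : F = G := by
  have : F ∘ₗ Ψ.toLinearMap = G ∘ₗ Ψ.toLinearMap := tmul_ext fun L f => by
    simpa only [LinearMap.comp_apply, LinearEquiv.coe_coe, s.equiv_tmul] using h L f
  refine LinearMap.ext fun u => ?_
  have h := LinearMap.congr_fun this (Ψ.symm u)
  simpa only [LinearMap.comp_apply, LinearEquiv.coe_coe, LinearEquiv.apply_symm_apply] using h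

theorem mul_I_I (f g : Ser A) : I f * I g = I g * I f := by
  rw [← s.alg_I.mul, ← s.alg_I.mul, mul_comm]

include d

theorem alg_ext {B : Type} [Ring B] [Algebra ℂ B] {F G : Ser U →ₗ[K] Ser B} (hF : IsAlg F)
    (hG : IsAlg G) (hI : ∀ f, F (I f) = G (I f))
    (hJ : ∀ k, F (J (const (e k))) = G (J (const (e k)))) : F = G := by
  have : F ∘ₗ J = G ∘ₗ J := IsAlg.ext d.adjoin_e (hF.comp s.alg_J) (hG.comp s.alg_J) hJ
  refine s.hom_ext fun L f => ?_
  rw [hF.mul, hG.mul, hI]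
  exact congrArg (· * G (I f)) (LinearMap.congr_fun this L)

/-- All maps are homomorphisms, so it is enough to look at 𝒜, where coassociativity is inherited,
and at the generators `e k`, where it is the matrix rule `comul_a`. -/
theorem coassoc : coeffwise (TensorProduct.assoc ℂ U U U).toLinearMap ∘ₗ
    tmap Δ LinearMap.id ∘ₗ Δ = tmap LinearMap.id Δ ∘ₗ Δ := by
  refine s.alg_ext d (IsAlg.assoc.comp ((s.alg_comul.tmap .id).comp s.alg_comul))
    ((IsAlg.id.tmap s.alg_comul).comp s.alg_comul) (fun f => ?_) (fun k => ?_)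
  · have h₁ : Δ ∘ₗ I = tmap I I ∘ₗ 𝒜.comul := LinearMap.ext s.comul_I
    simp only [LinearMap.comp_apply, s.comul_I, tmap_comp_apply, h₁, LinearMap.id_comp]
    have h₂ : ∀ z, tmap (tmap I I ∘ₗ 𝒜.comul) I z =
        tmap (tmap I I) I (tmap 𝒜.comul LinearMap.id z) := fun z => by
      rw [tmap_comp_apply, LinearMap.comp_id]
    have h₃ : ∀ z, tmap I (tmap I I ∘ₗ 𝒜.comul) z =
        tmap I (tmap I I) (tmap LinearMap.id 𝒜.comul z) := fun z => by
      rw [tmap_comp_apply, LinearMap.comp_id]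
    rw [h₂, h₃, coeffwise_assoc_tmap]
    exact congrArg _ (LinearMap.congr_fun 𝒜.coassoc f)
  · simp only [LinearMap.comp_apply, s.comul_J_e, map_add, map_sum, tmap_tmul, LinearMap.id_apply,
      s.comul_I, d.comul_a, add_tmul, sum_tmul, tmul_add, tmul_sum, coeffwise_assoc,
      s.alg_comul.one, ← one_tmul_one, Finset.sum_add_distrib, add_assoc]
    rw [Finset.sum_comm]

theorem counit_comul : coeffwise (TensorProduct.lid ℂ U).toLinearMap ∘ₗ
    tmap ε LinearMap.id ∘ₗ Δ = LinearMap.id := by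
  refine s.alg_ext d (IsAlg.lid.comp ((s.alg_counit.tmap .id).comp s.alg_comul)) .id
    (fun f => ?_) (fun k => ?_)
  · have h₁ : ∀ z, coeffwise (TensorProduct.lid ℂ U).toLinearMap (tmap ε LinearMap.id (tmap I I z))
        = I (coeffwise (TensorProduct.lid ℂ A).toLinearMap (tmap 𝒜.counit LinearMap.id z)) :=
      LinearMap.congr_fun (f := coeffwise (TensorProduct.lid ℂ U).toLinearMap ∘ₗ
        tmap ε LinearMap.id ∘ₗ tmap I I) (g := I ∘ₗ
          coeffwise (TensorProduct.lid ℂ A).toLinearMap ∘ₗ tmap 𝒜.counit LinearMap.id)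
        (tmul_ext fun f g => by simp [coeffwise_lid_tmul, s.counit_I])
    simp only [LinearMap.comp_apply, s.comul_I, h₁]
    exact congrArg I (LinearMap.congr_fun 𝒜.counit_comul f)
  · simp [s.comul_J_e, s.counit_J_e, coeffwise_lid_tmul, s.counit_I, d.counit_a]

theorem comul_counit : coeffwise (TensorProduct.rid ℂ U).toLinearMap ∘ₗ
    tmap LinearMap.id ε ∘ₗ Δ = LinearMap.id := by
  refine s.alg_ext d (IsAlg.rid.comp ((IsAlg.id.tmap s.alg_counit).comp s.alg_comul)) .id
    (fun f => ?_) (fun k => ?_)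
  · have h₁ : ∀ z, coeffwise (TensorProduct.rid ℂ U).toLinearMap (tmap LinearMap.id ε (tmap I I z))
        = I (coeffwise (TensorProduct.rid ℂ A).toLinearMap (tmap LinearMap.id 𝒜.counit z)) :=
      LinearMap.congr_fun (f := coeffwise (TensorProduct.rid ℂ U).toLinearMap ∘ₗ
        tmap LinearMap.id ε ∘ₗ tmap I I) (g := I ∘ₗ
          coeffwise (TensorProduct.rid ℂ A).toLinearMap ∘ₗ tmap LinearMap.id 𝒜.counit)
        (tmul_ext fun f g => by simp [coeffwise_rid_tmul, s.counit_I])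
    simp only [LinearMap.comp_apply, s.comul_I, h₁]
    exact congrArg I (LinearMap.congr_fun 𝒜.comul_counit f)
  · simp [s.comul_J_e, s.counit_J_e, coeffwise_rid_tmul, s.alg_counit.one]

omit d in
-- Inside U the derivation D_k is a commutator with the generator. The step operator thereby becomes
-- right multiplication by Δ(e_k) minus left multiplication by e_k ⊗ 1.
theorem tmap_spread (k : ι) (b : Ser (A ⊗[ℂ] H)) :
    tmap I J (spread (D k) (a k) (fun l => LinearMap.mulRight K (const (e l))) b) =
      tmap I J b * Δ (J (const (e k))) - tmul (J (const (e k))) 1 * tmap I J b := by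
  refine isLinear_tmul_ext
    (f := fun b => tmap I J (spread (D k) (a k) (fun l => LinearMap.mulRight K (const (e l))) b))
    (g := fun b => tmap I J b * Δ (J (const (e k))) - tmul (J (const (e k))) 1 * tmap I J b)
    ?_ ?_ (fun f M => ?_) b
  · exact ⟨fun _ _ => by simp only [map_add], fun _ _ => by simp only [map_smul]⟩
  · exact ⟨fun _ _ => by simp only [map_add, add_mul, mul_add]; abel,
      fun _ _ => by simp only [map_smul, smul_mul_assoc, mul_smul_comm, smul_sub]⟩
  simp only [spread_tmul, map_add, map_sum, tmap_tmul, LinearMap.mulRight_apply, s.comul_J_e,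
    mul_add, Finset.mul_sum, tmul_mul_tmul, mul_one, one_mul, s.cross, add_tmul, s.alg_I.mul,
    s.alg_J.mul, s.mul_I_I f]
  abel

/-- The correction by left multiplication with e_k ⊗ 1 in the second summand is exactly the first
summand, so the two add up to plain right multiplication by Δ(e_k). -/
theorem twist_spread (L M : Ser H) (k : ι) :
    twist β J I (tmul (L * const (e k)) M) + twist β J I (tmul L (M * const (e k))) =
      twist β J I (tmul L M) * Δ (J (const (e k))) := by
  rw [twist_tmul, twist_tmul, twist_tmul, d.coact_mul_e, s.tmap_spread, s.alg_J.mul, mul_sub,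
    ← mul_assoc, ← mul_assoc, tmul_mul_tmul, mul_one]
  abel

/-- This is Δ(L) = L₁ L₂⁽⁻¹⁾ ⊗ L₂⁽⁰⁾: both sides are multiplied on the right by Δ(e_k) when L is
multiplied by e_k. -/
theorem comul_J (L : Ser H) : Δ (J L) = twist β J I (ℋ.comul L) := by
  refine LinearMap.congr_fun (f := Δ ∘ₗ J) (g := twist β J I ∘ₗ ℋ.comul)
    (recursion_ext d.adjoin_e ?_ (fun k z => z * Δ (J (const (e k)))) (fun k L => ?_)
      (fun k L => d.comul_recursion (S := LinearMap.mulRight K (Δ (J (const (e k)))))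
        (fun L M => s.twist_spread d L M k) L)) L
  · rw [LinearMap.comp_apply, LinearMap.comp_apply, d.comul_one_H, twist_tmul, d.coact_one,
      tmap_tmul, s.alg_J.one, s.alg_I.one, s.alg_comul.one, one_tmul_one, one_mul]
  · rw [LinearMap.comp_apply, LinearMap.comp_apply, s.alg_J.mul, s.alg_comul.mul]

theorem comul_J_I (L : Ser H) (f : Ser A) :
    Δ (J L * I f) = twist β J I (ℋ.comul L) * tmap I I (𝒜.comul f) := by
  rw [s.alg_comul.mul, s.comul_J d, s.comul_I]

theorem counit_J (L : Ser H) : ε (J L) = ℋ.counit L := by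
  refine LinearMap.congr_fun (f := ε ∘ₗ J)
    (IsAlg.ext d.adjoin_e (s.alg_counit.comp s.alg_J) d.classical_H.isAlg_counit fun k => ?_) L
  rw [LinearMap.comp_apply, s.counit_J_e, d.counit_e]

theorem counit_J_I (L : Ser H) (f : Ser A) : ε (J L * I f) = ℋ.counit L * 𝒜.counit f := by
  rw [s.alg_counit.mul, s.counit_J d, s.counit_I]

end SmashData

namespace SmashData

section Maps

variable {H A U : Type} [Ring H] [Algebra ℂ H] [CommRing A] [Algebra ℂ A] [Ring U] [Algebra ℂ U]
  (ℋ : HopfStr H) (𝒜 : HopfStr A) (β : Ser H →ₗ[K] Ser (A ⊗[ℂ] H)) (J : Ser H →ₗ[K] Ser U)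
  (I : Ser A →ₗ[K] Ser U)

/-- The map `g ⊗ M ↦ S(g) S(M)`. -/
def antipodeMul : Ser (A ⊗[ℂ] H) →ₗ[K] Ser U :=
  mulMap U ∘ₗ tmap (I ∘ₗ 𝒜.antipode) (J ∘ₗ ℋ.antipode)

/-- The map `L ⊗ f ↦ S(L⁽⁻¹⁾ f) S(L⁽⁰⁾)`. -/
def antipodeSmash : Ser (H ⊗[ℂ] A) →ₗ[K] Ser U :=
  mulMap U ∘ₗ tmap (I ∘ₗ 𝒜.antipode ∘ₗ mulMap A) (J ∘ₗ ℋ.antipode) ∘ₗ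
    coeffwise (TensorProduct.rightComm ℂ A H A).toLinearMap ∘ₗ tmap β LinearMap.id

/-- The map `(f ⊗ L) ⊗ (g ⊗ M) ↦ S(f g) S(L) M`. -/
def antipodePair : Ser ((A ⊗[ℂ] H) ⊗[ℂ] (A ⊗[ℂ] H)) →ₗ[K] Ser U :=
  mulMap U ∘ₗ tmap (I ∘ₗ 𝒜.antipode ∘ₗ mulMap A) (mulMap U ∘ₗ tmap (J ∘ₗ ℋ.antipode) J) ∘ₗ
    coeffwise (TensorProduct.tensorTensorTensorComm ℂ A H A H).toLinearMap

theorem antipodeMul_tmul (g : Ser A) (M : Ser H) :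
    antipodeMul ℋ 𝒜 J I (tmul g M) = I (𝒜.antipode g) * J (ℋ.antipode M) := by
  simp only [antipodeMul, LinearMap.comp_apply, tmap_tmul, mulMap_tmul]

theorem antipodePair_tmul (f g : Ser A) (L M : Ser H) :
    antipodePair ℋ 𝒜 J I (tmul (tmul f L) (tmul g M)) =
      I (𝒜.antipode (f * g)) * (J (ℋ.antipode L) * J M) := by
  simp only [antipodePair, LinearMap.comp_apply, coeffwise_tttComm, tmap_tmul, mulMap_tmul]

end Maps

variable {H A U ι : Type} [Ring H] [Algebra ℂ H] [CommRing A] [Algebra ℂ A] [Ring U] [Algebra ℂ U]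
  [Fintype ι] [DecidableEq ι]
  {ℋ : HopfStr H} {𝒜 : HopfStr A} {act : Ser (A ⊗[ℂ] H) →ₗ[K] Ser A}
  {β : Ser H →ₗ[K] Ser (A ⊗[ℂ] H)} {e : ι → H} {D : ι → Ser A →ₗ[K] Ser A}
  {a : ι → ι → Ser A} {J : Ser H →ₗ[K] Ser U} {I : Ser A →ₗ[K] Ser U}
  {Δ : Ser U →ₗ[K] Ser (U ⊗[ℂ] U)} {ε : Ser U →ₗ[K] Ser ℂ} {Ψ : Ser (H ⊗[ℂ] A) ≃ₗ[K] Ser U}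
  (s : SmashData 𝒜 e D a J I Δ ε Ψ) (d : BicrossData ℋ 𝒜 act β e D a)

include s

theorem antipodeSmash_tmul (L : Ser H) (f : Ser A) : antipodeSmash ℋ 𝒜 β J I (tmul L f) =
    I (𝒜.antipode f) * antipodeMul ℋ 𝒜 J I (β L) := by
  simp only [antipodeSmash, LinearMap.comp_apply, tmap_tmul, LinearMap.id_apply]
  refine isLinear_tmul_ext
    (f := fun b => mulMap U (tmap (I ∘ₗ 𝒜.antipode ∘ₗ mulMap A) (J ∘ₗ ℋ.antipode)
      (coeffwise (TensorProduct.rightComm ℂ A H A).toLinearMap (tmul b f))))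
    (g := fun b => I (𝒜.antipode f) * antipodeMul ℋ 𝒜 J I b) ?_ ?_ (fun g M => ?_) (β L)
  · exact ⟨fun _ _ => by simp only [add_tmul, map_add],
      fun _ _ => by simp only [smul_tmul, map_smul]⟩
  · exact ⟨fun _ _ => by simp only [map_add, mul_add],
      fun _ _ => by simp only [map_smul, mul_smul_comm]⟩
  simp only [coeffwise_rightComm, tmap_tmul, LinearMap.comp_apply, mulMap_tmul, antipodeMul_tmul,
    s.alg_antipode.mul, s.alg_I.mul]
  rw [s.mul_I_I, mul_assoc]

include d

/-- The rule for the coaction of a coproduct gathers L₁⁽⁻¹⁾ L₂⁽⁻¹⁾ into L⁽⁻¹⁾ and leaves L⁽⁰⁾₁ ⊗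
L⁽⁰⁾₂, on which the antipode axiom of ℋ applies; the counit rule for β finishes. -/
theorem antipodePair_comul (L : Ser H) :
    antipodePair ℋ 𝒜 J I (tmap β β (ℋ.comul L)) = toK (ℋ.counit L) • 1 := by
  have h := LinearMap.congr_fun d.coact_comul L
  simp only [LinearMap.comp_apply, d.classical_A.1] at h
  have h₁ : ∀ z, antipodePair ℋ 𝒜 J I z =
      mulMap U (tmap (I ∘ₗ 𝒜.antipode) (mulMap U ∘ₗ tmap (J ∘ₗ ℋ.antipode) J)
        (tmap (mulMap A) LinearMap.id
          (coeffwise (TensorProduct.tensorTensorTensorComm ℂ A H A H).toLinearMap z))) := fun z => by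
    rw [tmap_comp_apply]
    rfl
  have h₂ : (mulMap U ∘ₗ tmap (J ∘ₗ ℋ.antipode) J) ∘ₗ ℋ.comul = unitMap U ∘ₗ ℋ.counit := by
    have h₃ : mulMap U ∘ₗ tmap (J ∘ₗ ℋ.antipode) J =
        J ∘ₗ mulMap H ∘ₗ tmap ℋ.antipode LinearMap.id := tmul_ext fun L M => by
      simp [s.alg_J.mul]
    refine LinearMap.ext fun M => ?_
    have := d.classical_H.antipode_left M
    rw [h₃, LinearMap.comp_apply, LinearMap.comp_apply, LinearMap.comp_apply, this, map_smul,
      s.alg_J.one, LinearMap.comp_apply, unitMap_apply]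
  rw [h₁, ← h, tmap_comp_apply, h₂]
  have h₄ : ∀ b, mulMap U (tmap ((I ∘ₗ 𝒜.antipode) ∘ₗ LinearMap.id) (unitMap U ∘ₗ ℋ.counit) b) =
      I (𝒜.antipode (coeffwise (TensorProduct.rid ℂ A).toLinearMap
        (tmap LinearMap.id ℋ.counit b))) :=
    LinearMap.congr_fun (f := mulMap U ∘ₗ
        tmap ((I ∘ₗ 𝒜.antipode) ∘ₗ LinearMap.id) (unitMap U ∘ₗ ℋ.counit))
      (g := I ∘ₗ 𝒜.antipode ∘ₗ coeffwise (TensorProduct.rid ℂ A).toLinearMap ∘ₗ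
        tmap LinearMap.id ℋ.counit)
      (tmul_ext fun g M => by simp [coeffwise_rid_tmul, unitMap_apply])
  rw [h₄, d.isLeftComoduleCoalgebra.coact_counit, d.classical_A.2, const_one, coeffwise_lid_tmul,
    map_smul, map_smul, s.alg_antipode.one, s.alg_I.one]

/-- For u = L f the expression becomes S(f₁) [S(L₁⁽⁻¹⁾ L₂⁽⁻¹⁾) S(L₁⁽⁰⁾) L₂⁽⁰⁾] f₂. The bracket is
`antipodePair`, hence ε(L), and S(f₁) f₂ = ε(f) remains. -/
theorem antipode_left (u : Ser U) :
    mulMap U (tmap (antipodeSmash ℋ 𝒜 β J I ∘ₗ Ψ.symm.toLinearMap) LinearMap.id (Δ u)) =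
      toK (ε u) • 1 := by
  refine LinearMap.congr_fun (f := mulMap U ∘ₗ
      tmap (antipodeSmash ℋ 𝒜 β J I ∘ₗ Ψ.symm.toLinearMap) LinearMap.id ∘ₗ Δ)
    (g := unitMap U ∘ₗ ε) (s.hom_ext fun L f => ?_) u |>.trans (unitMap_apply _)
  have hS : ∀ L f, (antipodeSmash ℋ 𝒜 β J I ∘ₗ Ψ.symm.toLinearMap) (J L * I f) =
      I (𝒜.antipode f) * antipodeMul ℋ 𝒜 J I (β L) := fun L f => by
    rw [← s.equiv_tmul, LinearMap.comp_apply, LinearEquiv.coe_coe, LinearEquiv.symm_apply_apply,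
      s.antipodeSmash_tmul]
  -- Only the values of the antipode on products J L · I f enter from here on.
  generalize antipodeSmash ℋ 𝒜 β J I ∘ₗ Ψ.symm.toLinearMap = S at hS ⊢
  have key : ∀ z f₁ f₂, mulMap U (tmap S LinearMap.id (twist β J I z * tmap I I (tmul f₁ f₂))) =
      I (𝒜.antipode f₁) * antipodePair ℋ 𝒜 J I (tmap β β z) * I f₂ := fun z f₁ f₂ => by
    refine isLinear_tmul_ext
      (f := fun z => mulMap U (tmap S LinearMap.id (twist β J I z * tmap I I (tmul f₁ f₂))))
      (g := fun z => I (𝒜.antipode f₁) * antipodePair ℋ 𝒜 J I (tmap β β z) * I f₂) ?_ ?_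
      (fun L M => ?_) z
    · exact ⟨fun _ _ => by simp only [map_add, add_mul],
        fun _ _ => by simp only [map_smul, smul_mul_assoc]⟩
    · exact ⟨fun _ _ => by simp only [map_add, mul_add, add_mul],
        fun _ _ => by simp only [map_smul, mul_smul_comm, smul_mul_assoc]⟩
    rw [twist_tmul, tmap_tmul, tmap_tmul]
    refine isLinear_tmul_ext
      (f := fun c => mulMap U (tmap S LinearMap.id
        (tmul (J L) 1 * tmap I J c * tmul (I f₁) (I f₂))))
      (g := fun c => I (𝒜.antipode f₁) * antipodePair ℋ 𝒜 J I (tmul (β L) c) * I f₂) ?_ ?_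
      (fun g N => ?_) (β M)
    · exact ⟨fun _ _ => by simp only [map_add, mul_add, add_mul],
        fun _ _ => by simp only [map_smul, mul_smul_comm, smul_mul_assoc]⟩
    · exact ⟨fun _ _ => by simp only [tmul_add, map_add, mul_add, add_mul],
        fun _ _ => by simp only [tmul_smul, map_smul, mul_smul_comm, smul_mul_assoc]⟩
    rw [tmap_tmul, tmul_mul_tmul, tmul_mul_tmul, tmap_tmul, mulMap_tmul, LinearMap.id_apply,
      mul_assoc (J L), ← s.alg_I.mul, hS, one_mul]
    refine isLinear_tmul_ext
      (f := fun b => I (𝒜.antipode (g * f₁)) * antipodeMul ℋ 𝒜 J I b * (J N * I f₂))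
      (g := fun b => I (𝒜.antipode f₁) * antipodePair ℋ 𝒜 J I (tmul b (tmul g N)) * I f₂) ?_ ?_
      (fun g' N' => ?_) (β L)
    · exact ⟨fun _ _ => by simp only [map_add, mul_add, add_mul],
        fun _ _ => by simp only [map_smul, mul_smul_comm, smul_mul_assoc]⟩
    · exact ⟨fun _ _ => by simp only [add_tmul, map_add, mul_add, add_mul],
        fun _ _ => by simp only [smul_tmul, map_smul, mul_smul_comm, smul_mul_assoc]⟩
    rw [antipodeMul_tmul, antipodePair_tmul]
    simp only [← mul_assoc, ← s.alg_I.mul, ← s.alg_antipode.mul]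
    -- Commutativity of 𝒜 brings the coaction legs of L₁ and L₂ together in the order that
    -- `antipodePair` expects.
    rw [show g * f₁ * g' = f₁ * g' * g by ring]
  rw [LinearMap.comp_apply, LinearMap.comp_apply, LinearMap.comp_apply, s.comul_J_I d, s.counit_J_I d,
    unitMap_apply, toK_mul]
  have key₂ : ∀ w, mulMap U (tmap S LinearMap.id (twist β J I (ℋ.comul L) * tmap I I w)) =
      toK (ℋ.counit L) • I (mulMap A (tmap 𝒜.antipode LinearMap.id w)) := fun w => by
    refine isLinear_tmul_ext
      (f := fun w => mulMap U (tmap S LinearMap.id (twist β J I (ℋ.comul L) * tmap I I w)))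
      (g := fun w => toK (ℋ.counit L) • I (mulMap A (tmap 𝒜.antipode LinearMap.id w))) ?_ ?_
      (fun f₁ f₂ => ?_) w
    · exact ⟨fun _ _ => by simp only [map_add, mul_add],
        fun _ _ => by simp only [map_smul, mul_smul_comm]⟩
    · exact ⟨fun _ _ => by simp only [map_add, smul_add],
        fun _ _ => by simp only [map_smul]; exact smul_comm _ _ _⟩
    rw [key, s.antipodePair_comul d, tmap_tmul, mulMap_tmul, s.alg_I.mul, mul_smul_comm, mul_one,
      smul_mul_assoc, LinearMap.id_apply]
  rw [key₂, d.classical_A.antipode_left, map_smul, s.alg_I.one, smul_smul]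

/-- That is, M⁽⁻¹⁾ S(M⁽⁰⁾⁽⁻¹⁾) S(M⁽⁰⁾⁽⁰⁾) = S(M): coassociativity of β rewrites the first two
factors as f₁ S(f₂) with f = M⁽⁻¹⁾, and the counit rule removes them. -/
theorem antipodeMul_coact (M : Ser H) :
    mulMap U (tmap I (antipodeMul ℋ 𝒜 J I ∘ₗ β) (β M)) = J (ℋ.antipode M) := by
  have h := LinearMap.congr_fun d.coact_coassoc M
  simp only [LinearMap.comp_apply] at h
  have h₁ : ∀ z, tmap I (antipodeMul ℋ 𝒜 J I ∘ₗ β) z =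
      tmap I (antipodeMul ℋ 𝒜 J I) (tmap LinearMap.id β z) := fun z => by
    rw [tmap_comp_apply, LinearMap.comp_id]
  have h₂ : ∀ z, mulMap U (tmap I (antipodeMul ℋ 𝒜 J I)
      (coeffwise (TensorProduct.assoc ℂ A A H).toLinearMap z)) =
      mulMap U (tmap (I ∘ₗ mulMap A ∘ₗ tmap LinearMap.id 𝒜.antipode) (J ∘ₗ ℋ.antipode) z) :=
    fun z => by
    refine isLinear_tmul_ext (f := fun z => mulMap U (tmap I (antipodeMul ℋ 𝒜 J I)
        (coeffwise (TensorProduct.assoc ℂ A A H).toLinearMap z)))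
      (g := fun z => mulMap U
        (tmap (I ∘ₗ mulMap A ∘ₗ tmap LinearMap.id 𝒜.antipode) (J ∘ₗ ℋ.antipode) z)) ?_ ?_
      (fun w N => ?_) z
    · exact ⟨fun _ _ => by simp only [map_add], fun _ _ => by simp only [map_smul]⟩
    · exact ⟨fun _ _ => by simp only [map_add], fun _ _ => by simp only [map_smul]⟩
    refine isLinear_tmul_ext (f := fun w => mulMap U (tmap I (antipodeMul ℋ 𝒜 J I)
        (coeffwise (TensorProduct.assoc ℂ A A H).toLinearMap (tmul w N))))
      (g := fun w => mulMap U (tmap (I ∘ₗ mulMap A ∘ₗ tmap LinearMap.id 𝒜.antipode)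
        (J ∘ₗ ℋ.antipode) (tmul w N))) ?_ ?_ (fun f g => ?_) w
    · exact ⟨fun _ _ => by simp only [add_tmul, map_add],
        fun _ _ => by simp only [smul_tmul, map_smul]⟩
    · exact ⟨fun _ _ => by simp only [add_tmul, map_add],
        fun _ _ => by simp only [smul_tmul, map_smul]⟩
    simp only [coeffwise_assoc, tmap_tmul, mulMap_tmul, antipodeMul_tmul, LinearMap.comp_apply,
      LinearMap.id_apply, s.alg_I.mul, mul_assoc]
  have h₃ : (I ∘ₗ mulMap A ∘ₗ tmap LinearMap.id 𝒜.antipode) ∘ₗ 𝒜.comul = unitMap U ∘ₗ 𝒜.counit :=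
    LinearMap.ext fun f => by
      have := d.classical_A.antipode_right f
      rw [LinearMap.comp_apply, LinearMap.comp_apply, LinearMap.comp_apply, this, map_smul,
        s.alg_I.one, LinearMap.comp_apply, unitMap_apply]
  have h₄ : ∀ b, mulMap U (tmap (unitMap U ∘ₗ 𝒜.counit) ((J ∘ₗ ℋ.antipode) ∘ₗ LinearMap.id) b) =
      J (ℋ.antipode (coeffwise (TensorProduct.lid ℂ H).toLinearMap
        (tmap 𝒜.counit LinearMap.id b))) :=
    LinearMap.congr_fun (f := mulMap U ∘ₗ
        tmap (unitMap U ∘ₗ 𝒜.counit) ((J ∘ₗ ℋ.antipode) ∘ₗ LinearMap.id))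
      (g := J ∘ₗ ℋ.antipode ∘ₗ coeffwise (TensorProduct.lid ℂ H).toLinearMap ∘ₗ
        tmap 𝒜.counit LinearMap.id)
      (tmul_ext fun g M => by simp [coeffwise_lid_tmul, unitMap_apply])
  have h₅ := LinearMap.congr_fun d.isLeftComoduleCoalgebra.counit_coact M
  simp only [LinearMap.comp_apply, LinearMap.id_apply] at h₅
  rw [h₁, h, h₂, tmap_comp_apply, h₃, h₄, h₅]

/-- For u = L f one gets L₁ L₂⁽⁻¹⁾ f₁ S(f₂) times the antipode of L₂⁽⁰⁾. As 𝒜 is commutative, f₁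
S(f₂) = ε(f) can be moved out, and `antipodeMul_coact` reduces the rest to L₁ S(L₂) = ε(L). -/
theorem antipode_right (u : Ser U) :
    mulMap U (tmap LinearMap.id (antipodeSmash ℋ 𝒜 β J I ∘ₗ Ψ.symm.toLinearMap) (Δ u)) =
      toK (ε u) • 1 := by
  refine LinearMap.congr_fun (f := mulMap U ∘ₗ
      tmap LinearMap.id (antipodeSmash ℋ 𝒜 β J I ∘ₗ Ψ.symm.toLinearMap) ∘ₗ Δ)
    (g := unitMap U ∘ₗ ε) (s.hom_ext fun L f => ?_) u |>.trans (unitMap_apply _)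
  have hS : ∀ L f, (antipodeSmash ℋ 𝒜 β J I ∘ₗ Ψ.symm.toLinearMap) (J L * I f) =
      I (𝒜.antipode f) * antipodeMul ℋ 𝒜 J I (β L) := fun L f => by
    rw [← s.equiv_tmul, LinearMap.comp_apply, LinearEquiv.coe_coe, LinearEquiv.symm_apply_apply,
      s.antipodeSmash_tmul]
  generalize antipodeSmash ℋ 𝒜 β J I ∘ₗ Ψ.symm.toLinearMap = S at hS ⊢
  have key : ∀ L M w, mulMap U (tmap LinearMap.id S (twist β J I (tmul L M) * tmap I I w)) =
      J L * I (mulMap A (tmap LinearMap.id 𝒜.antipode w)) * J (ℋ.antipode M) := fun L M w => by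
    rw [twist_tmul, ← s.antipodeMul_coact d M]
    refine isLinear_tmul_ext
      (f := fun b => mulMap U (tmap LinearMap.id S (tmul (J L) 1 * tmap I J b * tmap I I w)))
      (g := fun b => J L * I (mulMap A (tmap LinearMap.id 𝒜.antipode w)) *
        mulMap U (tmap I (antipodeMul ℋ 𝒜 J I ∘ₗ β) b)) ?_ ?_ (fun g N => ?_) (β M)
    · exact ⟨fun _ _ => by simp only [map_add, mul_add, add_mul],
        fun _ _ => by simp only [map_smul, mul_smul_comm, smul_mul_assoc]⟩
    · exact ⟨fun _ _ => by simp only [map_add, mul_add],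
        fun _ _ => by simp only [map_smul, mul_smul_comm]⟩
    refine isLinear_tmul_ext
      (f := fun w => mulMap U (tmap LinearMap.id S
        (tmul (J L) 1 * tmap I J (tmul g N) * tmap I I w)))
      (g := fun w => J L * I (mulMap A (tmap LinearMap.id 𝒜.antipode w)) *
        mulMap U (tmap I (antipodeMul ℋ 𝒜 J I ∘ₗ β) (tmul g N))) ?_ ?_ (fun f₁ f₂ => ?_) w
    · exact ⟨fun _ _ => by simp only [map_add, mul_add],
        fun _ _ => by simp only [map_smul, mul_smul_comm]⟩
    · exact ⟨fun _ _ => by simp only [map_add, mul_add, add_mul],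
        fun _ _ => by simp only [map_smul, mul_smul_comm, smul_mul_assoc]⟩
    simp only [tmap_tmul, tmul_mul_tmul, one_mul, mulMap_tmul, LinearMap.id_apply, hS,
      LinearMap.comp_apply, ← mul_assoc]
    simp only [mul_assoc (J L), ← s.alg_I.mul]
    rw [show g * f₁ * 𝒜.antipode f₂ = f₁ * 𝒜.antipode f₂ * g by ring]
  rw [LinearMap.comp_apply, LinearMap.comp_apply, LinearMap.comp_apply, s.comul_J_I d, s.counit_J_I d,
    unitMap_apply, toK_mul]
  have key₂ : ∀ z, mulMap U (tmap LinearMap.id S (twist β J I z * tmap I I (𝒜.comul f))) =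
      toK (𝒜.counit f) • J (mulMap H (tmap LinearMap.id ℋ.antipode z)) := fun z => by
    refine isLinear_tmul_ext
      (f := fun z => mulMap U (tmap LinearMap.id S (twist β J I z * tmap I I (𝒜.comul f))))
      (g := fun z => toK (𝒜.counit f) • J (mulMap H (tmap LinearMap.id ℋ.antipode z))) ?_ ?_
      (fun L M => ?_) z
    · exact ⟨fun _ _ => by simp only [map_add, add_mul],
        fun _ _ => by simp only [map_smul, smul_mul_assoc]⟩
    · exact ⟨fun _ _ => by simp only [map_add, smul_add],
        fun _ _ => by simp only [map_smul]; exact smul_comm _ _ _⟩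
    rw [key, d.classical_A.antipode_right, map_smul, s.alg_I.one, mul_smul_comm, mul_one,
      smul_mul_assoc, ← s.alg_J.mul, tmap_tmul, mulMap_tmul, LinearMap.id_apply]
  rw [key₂, d.classical_H.antipode_right, map_smul, s.alg_J.one, smul_smul, mul_comm]

end SmashData

/-- The Hopf algebra structure on an algebra with smash data. -/
def SmashData.hopf {H A U ι : Type} [Ring H] [Algebra ℂ H] [CommRing A] [Algebra ℂ A] [Ring U]
    [Algebra ℂ U] [Fintype ι] [DecidableEq ι]
    {ℋ : HopfStr H} {𝒜 : HopfStr A} {act : Ser (A ⊗[ℂ] H) →ₗ[K] Ser A}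
    {β : Ser H →ₗ[K] Ser (A ⊗[ℂ] H)} {e : ι → H} {D : ι → Ser A →ₗ[K] Ser A}
    {a : ι → ι → Ser A} {J : Ser H →ₗ[K] Ser U} {I : Ser A →ₗ[K] Ser U}
    {Δ : Ser U →ₗ[K] Ser (U ⊗[ℂ] U)} {ε : Ser U →ₗ[K] Ser ℂ} {Ψ : Ser (H ⊗[ℂ] A) ≃ₗ[K] Ser U}
    (s : SmashData 𝒜 e D a J I Δ ε Ψ) (d : BicrossData ℋ 𝒜 act β e D a) : HopfStr U :=
  .ofRing Δ ε (SmashData.antipodeSmash ℋ 𝒜 β J I ∘ₗ Ψ.symm.toLinearMap) s.alg_comul s.alg_counit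
    (s.coassoc d) (s.counit_comul d) (s.comul_counit d) (s.antipode_left d) (s.antipode_right d)

/-! ### Transport of a Hopf structure along a linear isomorphism -/

section Transport

variable {V W : Type} [AddCommGroup V] [Module ℂ V] [AddCommGroup W] [Module ℂ W]

theorem tmap_symm_tmap (Ψ : Ser W ≃ₗ[K] Ser V) (z : Ser (W ⊗[ℂ] W)) :
    tmap Ψ.symm.toLinearMap Ψ.symm.toLinearMap (tmap Ψ.toLinearMap Ψ.toLinearMap z) = z := by
  rw [tmap_comp_apply, LinearEquiv.symm_comp, tmap_id, LinearMap.id_apply]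

theorem tmap_tmap_symm (Ψ : Ser W ≃ₗ[K] Ser V) (z : Ser (V ⊗[ℂ] V)) :
    tmap Ψ.toLinearMap Ψ.toLinearMap (tmap Ψ.symm.toLinearMap Ψ.symm.toLinearMap z) = z := by
  rw [tmap_comp_apply, LinearEquiv.comp_symm, tmap_id, LinearMap.id_apply]

theorem coeffwise_lid_tmap (f : Ser V →ₗ[K] Ser W) (g : Ser V →ₗ[K] Ser ℂ) (z : Ser (V ⊗[ℂ] V)) :
    coeffwise (TensorProduct.lid ℂ W).toLinearMap (tmap g f z) =
      f (coeffwise (TensorProduct.lid ℂ V).toLinearMap (tmap g LinearMap.id z)) :=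
  LinearMap.congr_fun (f := coeffwise (TensorProduct.lid ℂ W).toLinearMap ∘ₗ tmap g f)
    (g := f ∘ₗ coeffwise (TensorProduct.lid ℂ V).toLinearMap ∘ₗ tmap g LinearMap.id)
    (tmul_ext fun a b => by simp [coeffwise_lid_tmul]) z

theorem coeffwise_rid_tmap (f : Ser V →ₗ[K] Ser W) (g : Ser V →ₗ[K] Ser ℂ) (z : Ser (V ⊗[ℂ] V)) :
    coeffwise (TensorProduct.rid ℂ W).toLinearMap (tmap f g z) =
      f (coeffwise (TensorProduct.rid ℂ V).toLinearMap (tmap LinearMap.id g z)) :=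
  LinearMap.congr_fun (f := coeffwise (TensorProduct.rid ℂ W).toLinearMap ∘ₗ tmap f g)
    (g := f ∘ₗ coeffwise (TensorProduct.rid ℂ V).toLinearMap ∘ₗ tmap LinearMap.id g)
    (tmul_ext fun a b => by simp [coeffwise_rid_tmul]) z

theorem coeffwise_tttComm_tmap (f : Ser V →ₗ[K] Ser W) (z z' : Ser (V ⊗[ℂ] V)) :
    coeffwise (TensorProduct.tensorTensorTensorComm ℂ W W W W).toLinearMap
      (tmul (tmap f f z) (tmap f f z')) = tmap (tmap f f) (tmap f f)
        (coeffwise (TensorProduct.tensorTensorTensorComm ℂ V V V V).toLinearMap (tmul z z')) := by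
  refine isLinear_tmul_ext
    (f := fun z => coeffwise (TensorProduct.tensorTensorTensorComm ℂ W W W W).toLinearMap
      (tmul (tmap f f z) (tmap f f z')))
    (g := fun z => tmap (tmap f f) (tmap f f)
      (coeffwise (TensorProduct.tensorTensorTensorComm ℂ V V V V).toLinearMap (tmul z z'))) ?_ ?_
    (fun a b => ?_) z
  · exact ⟨fun _ _ => by simp only [map_add, add_tmul],
      fun _ _ => by simp only [map_smul, smul_tmul]⟩
  · exact ⟨fun _ _ => by simp only [map_add, add_tmul],
      fun _ _ => by simp only [map_smul, smul_tmul]⟩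
  refine isLinear_tmul_ext
    (f := fun z' => coeffwise (TensorProduct.tensorTensorTensorComm ℂ W W W W).toLinearMap
      (tmul (tmap f f (tmul a b)) (tmap f f z')))
    (g := fun z' => tmap (tmap f f) (tmap f f) (coeffwise
      (TensorProduct.tensorTensorTensorComm ℂ V V V V).toLinearMap (tmul (tmul a b) z'))) ?_ ?_
    (fun a' b' => ?_) z'
  · exact ⟨fun _ _ => by simp only [map_add, tmul_add],
      fun _ _ => by simp only [map_smul, tmul_smul]⟩
  · exact ⟨fun _ _ => by simp only [map_add, tmul_add],
      fun _ _ => by simp only [map_smul, tmul_smul]⟩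
  simp only [tmap_tmul, coeffwise_tttComm]

variable (𝒱 : HopfStr V) (Ψ : Ser W ≃ₗ[K] Ser V)

/-- The Hopf algebra structure transported along a linear isomorphism. -/
def HopfStr.transport : HopfStr W where
  mul := Ψ.symm.toLinearMap ∘ₗ 𝒱.mul ∘ₗ tmap Ψ.toLinearMap Ψ.toLinearMap
  one := Ψ.symm 𝒱.one
  comul := tmap Ψ.symm.toLinearMap Ψ.symm.toLinearMap ∘ₗ 𝒱.comul ∘ₗ Ψ.toLinearMap
  counit := 𝒱.counit ∘ₗ Ψ.toLinearMap
  antipode := Ψ.symm.toLinearMap ∘ₗ 𝒱.antipode ∘ₗ Ψ.toLinearMap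
  mul_assoc := by
    refine tmul_ext fun z c => ?_
    refine isLinear_tmul_ext
      (f := fun z => ((Ψ.symm.toLinearMap ∘ₗ 𝒱.mul ∘ₗ tmap Ψ.toLinearMap Ψ.toLinearMap) ∘ₗ
        tmap (Ψ.symm.toLinearMap ∘ₗ 𝒱.mul ∘ₗ tmap Ψ.toLinearMap Ψ.toLinearMap) LinearMap.id)
          (tmul z c))
      (g := fun z => ((Ψ.symm.toLinearMap ∘ₗ 𝒱.mul ∘ₗ tmap Ψ.toLinearMap Ψ.toLinearMap) ∘ₗ
        tmap LinearMap.id (Ψ.symm.toLinearMap ∘ₗ 𝒱.mul ∘ₗ tmap Ψ.toLinearMap Ψ.toLinearMap) ∘ₗ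
          coeffwise (TensorProduct.assoc ℂ W W W).toLinearMap) (tmul z c))
      ⟨fun _ _ => by simp only [add_tmul, map_add], fun _ _ => by simp only [smul_tmul, map_smul]⟩
      ⟨fun _ _ => by simp only [add_tmul, map_add], fun _ _ => by simp only [smul_tmul, map_smul]⟩
      (fun a b => ?_) z
    have := LinearMap.congr_fun 𝒱.mul_assoc (tmul (tmul (Ψ a) (Ψ b)) (Ψ c))
    simp only [LinearMap.comp_apply, tmap_tmul, coeffwise_assoc, LinearMap.id_apply,
      LinearEquiv.coe_coe, LinearEquiv.apply_symm_apply] at this ⊢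
    rw [this]
  one_mul w := by
    simp only [LinearMap.comp_apply, tmap_tmul, LinearEquiv.coe_coe, LinearEquiv.apply_symm_apply,
      𝒱.one_mul, LinearEquiv.symm_apply_apply]
  mul_one w := by
    simp only [LinearMap.comp_apply, tmap_tmul, LinearEquiv.coe_coe, LinearEquiv.apply_symm_apply,
      𝒱.mul_one, LinearEquiv.symm_apply_apply]
  coassoc := by
    refine LinearMap.ext fun w => ?_
    have h := LinearMap.congr_fun 𝒱.coassoc (Ψ w)
    simp only [LinearMap.comp_apply] at h ⊢
    rw [tmap_comp_apply, tmap_comp_apply]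
    have e₁ : ∀ z, tmap ((tmap Ψ.symm.toLinearMap Ψ.symm.toLinearMap ∘ₗ 𝒱.comul ∘ₗ
        Ψ.toLinearMap) ∘ₗ Ψ.symm.toLinearMap) (LinearMap.id ∘ₗ Ψ.symm.toLinearMap) z =
        tmap (tmap Ψ.symm.toLinearMap Ψ.symm.toLinearMap) Ψ.symm.toLinearMap
          (tmap 𝒱.comul LinearMap.id z) := fun z => by
      rw [tmap_comp_apply, LinearMap.comp_assoc, LinearMap.comp_assoc, LinearEquiv.comp_symm]
      rfl
    have e₂ : ∀ z, tmap (LinearMap.id ∘ₗ Ψ.symm.toLinearMap) ((tmap Ψ.symm.toLinearMap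
        Ψ.symm.toLinearMap ∘ₗ 𝒱.comul ∘ₗ Ψ.toLinearMap) ∘ₗ Ψ.symm.toLinearMap) z =
        tmap Ψ.symm.toLinearMap (tmap Ψ.symm.toLinearMap Ψ.symm.toLinearMap)
          (tmap LinearMap.id 𝒱.comul z) := fun z => by
      rw [tmap_comp_apply, LinearMap.comp_assoc, LinearMap.comp_assoc, LinearEquiv.comp_symm]
      rfl
    rw [e₁, e₂, coeffwise_assoc_tmap]
    exact congrArg _ h
  counit_comul := by
    refine LinearMap.ext fun w => ?_
    have h := LinearMap.congr_fun 𝒱.counit_comul (Ψ w)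
    simp only [LinearMap.comp_apply, LinearMap.id_apply] at h ⊢
    rw [tmap_comp_apply, LinearMap.comp_assoc, LinearEquiv.comp_symm, LinearMap.comp_id,
      LinearMap.id_comp, coeffwise_lid_tmap]
    exact (congrArg Ψ.symm h).trans (Ψ.symm_apply_apply w)
  comul_counit := by
    refine LinearMap.ext fun w => ?_
    have h := LinearMap.congr_fun 𝒱.comul_counit (Ψ w)
    simp only [LinearMap.comp_apply, LinearMap.id_apply] at h ⊢
    rw [tmap_comp_apply, LinearMap.comp_assoc, LinearEquiv.comp_symm, LinearMap.comp_id,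
      LinearMap.id_comp, coeffwise_rid_tmap]
    exact (congrArg Ψ.symm h).trans (Ψ.symm_apply_apply w)
  comul_mul := tmul_ext fun v w => by
    have h := LinearMap.congr_fun 𝒱.comul_mul (tmul (Ψ v) (Ψ w))
    simp only [LinearMap.comp_apply, tmap_tmul, LinearEquiv.coe_coe,
      LinearEquiv.apply_symm_apply] at h ⊢
    rw [h, coeffwise_tttComm_tmap, tmap_comp_apply, tmap_comp_apply]
    have e : (Ψ.symm.toLinearMap ∘ₗ 𝒱.mul ∘ₗ tmap Ψ.toLinearMap Ψ.toLinearMap) ∘ₗ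
        tmap Ψ.symm.toLinearMap Ψ.symm.toLinearMap = Ψ.symm.toLinearMap ∘ₗ 𝒱.mul :=
      LinearMap.ext fun z => by
        simp only [LinearMap.comp_apply, tmap_tmap_symm]
    rw [e]
  comul_one := by
    simp only [LinearMap.comp_apply, LinearEquiv.coe_coe, LinearEquiv.apply_symm_apply,
      𝒱.comul_one, tmap_tmul]
  counit_mul := tmul_ext fun v w => by
    have h := LinearMap.congr_fun 𝒱.counit_mul (tmul (Ψ v) (Ψ w))
    simpa only [LinearMap.comp_apply, tmap_tmul, LinearEquiv.coe_coe,
      LinearEquiv.apply_symm_apply] using h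
  counit_one := by
    rw [LinearMap.comp_apply, LinearEquiv.coe_coe, LinearEquiv.apply_symm_apply, 𝒱.counit_one]
  antipode_left w := by
    simp only [LinearMap.comp_apply]
    have e₁ : (Ψ.toLinearMap ∘ₗ Ψ.symm.toLinearMap ∘ₗ 𝒱.antipode ∘ₗ Ψ.toLinearMap) ∘ₗ
        Ψ.symm.toLinearMap = 𝒱.antipode := LinearMap.ext fun v => by
      simp only [LinearMap.comp_apply, LinearEquiv.coe_coe, LinearEquiv.apply_symm_apply]
    have e₂ : (Ψ.toLinearMap ∘ₗ LinearMap.id) ∘ₗ Ψ.symm.toLinearMap = LinearMap.id :=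
      LinearMap.ext fun v => by
        simp only [LinearMap.comp_apply, LinearEquiv.coe_coe, LinearEquiv.apply_symm_apply,
          LinearMap.id_apply]
    rw [tmap_comp_apply, tmap_comp_apply, e₁, e₂]
    have h := 𝒱.antipode_left (Ψ w)
    rw [coeffwise_lid_tmul] at h ⊢
    exact (congrArg Ψ.symm h).trans (map_smul _ _ _)
  antipode_right w := by
    simp only [LinearMap.comp_apply]
    have e₁ : (Ψ.toLinearMap ∘ₗ Ψ.symm.toLinearMap ∘ₗ 𝒱.antipode ∘ₗ Ψ.toLinearMap) ∘ₗ
        Ψ.symm.toLinearMap = 𝒱.antipode := LinearMap.ext fun v => by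
      simp only [LinearMap.comp_apply, LinearEquiv.coe_coe, LinearEquiv.apply_symm_apply]
    have e₂ : (Ψ.toLinearMap ∘ₗ LinearMap.id) ∘ₗ Ψ.symm.toLinearMap = LinearMap.id :=
      LinearMap.ext fun v => by
        simp only [LinearMap.comp_apply, LinearEquiv.coe_coe, LinearEquiv.apply_symm_apply,
          LinearMap.id_apply]
    rw [tmap_comp_apply, tmap_comp_apply, e₁, e₂]
    have h := 𝒱.antipode_right (Ψ w)
    rw [coeffwise_lid_tmul] at h ⊢
    exact (congrArg Ψ.symm h).trans (map_smul _ _ _)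

theorem HopfStr.isHopfIso_transport : IsHopfIso 𝒱 (𝒱.transport Ψ) Ψ.symm where
  map_mul := LinearMap.ext fun z => by
    simp only [HopfStr.transport, LinearMap.comp_apply, tmap_tmap_symm]
  map_one := rfl
  map_comul := LinearMap.ext fun z => by
    simp only [HopfStr.transport, LinearMap.comp_apply, LinearEquiv.coe_coe,
      LinearEquiv.apply_symm_apply]
  map_counit := LinearMap.ext fun z => by
    simp only [HopfStr.transport, LinearMap.comp_apply, LinearEquiv.coe_coe,
      LinearEquiv.apply_symm_apply]
  map_antipode := LinearMap.ext fun z => by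
    simp only [HopfStr.transport, LinearMap.comp_apply, LinearEquiv.coe_coe,
      LinearEquiv.apply_symm_apply]

end Transport

/-- The formulas fix product, unit and coproduct on pure tensors; counit and antipode then have no
freedom left. -/
theorem IsBicrossproduct.unique {H A : Type} [AddCommGroup H] [Module ℂ H] [AddCommGroup A]
    [Module ℂ A] {ℋ : HopfStr H} {𝒜 : HopfStr A} {act : Ser (A ⊗[ℂ] H) →ₗ[K] Ser A}
    {β : Ser H →ₗ[K] Ser (A ⊗[ℂ] H)} {ℬ ℬ' : HopfStr (H ⊗[ℂ] A)}
    (h : IsBicrossproduct ℋ 𝒜 act β ℬ) (h' : IsBicrossproduct ℋ 𝒜 act β ℬ') : ℬ = ℬ' := by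
  refine HopfStr.ext_of_comul (tmul_ext fun x y => ?_) (h.one_eq.trans h'.one_eq.symm)
    (tmul_ext fun L f => (h.comul_eq L f).trans (h'.comul_eq L f).symm)
  refine isLinear_tmul_ext (f := fun x => ℬ.mul (tmul x y)) (g := fun x => ℬ'.mul (tmul x y))
    ⟨fun _ _ => by simp only [add_tmul, map_add], fun _ _ => by simp only [smul_tmul, map_smul]⟩
    ⟨fun _ _ => by simp only [add_tmul, map_add], fun _ _ => by simp only [smul_tmul, map_smul]⟩
    (fun L f => ?_) x
  refine isLinear_tmul_ext (f := fun y => ℬ.mul (tmul (tmul L f) y))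
    (g := fun y => ℬ'.mul (tmul (tmul L f) y))
    ⟨fun _ _ => by simp only [tmul_add, map_add], fun _ _ => by simp only [tmul_smul, map_smul]⟩
    ⟨fun _ _ => by simp only [tmul_add, map_add], fun _ _ => by simp only [tmul_smul, map_smul]⟩
    (fun M g => (h.mul_eq L f M g).trans (h'.mul_eq L f M g).symm) y

/-! ### Identification with the bicrossproduct formulas -/

namespace SmashData

variable {H A U ι : Type} [Ring H] [Algebra ℂ H] [CommRing A] [Algebra ℂ A] [Ring U] [Algebra ℂ U]
  [Fintype ι] [DecidableEq ι]
  {ℋ : HopfStr H} {𝒜 : HopfStr A} {act : Ser (A ⊗[ℂ] H) →ₗ[K] Ser A}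
  {β : Ser H →ₗ[K] Ser (A ⊗[ℂ] H)} {e : ι → H} {D : ι → Ser A →ₗ[K] Ser A}
  {a : ι → ι → Ser A} {J : Ser H →ₗ[K] Ser U} {I : Ser A →ₗ[K] Ser U}
  {Δ : Ser U →ₗ[K] Ser (U ⊗[ℂ] U)} {ε : Ser U →ₗ[K] Ser ℂ} {Ψ : Ser (H ⊗[ℂ] A) ≃ₗ[K] Ser U}
  (s : SmashData 𝒜 e D a J I Δ ε Ψ) (d : BicrossData ℋ 𝒜 act β e D a)

include s d

/-- The exchange rule f M = M₁ (f ◁ M₂) integrates the commutation rule with generators. It is what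
turns the product of U into the smash product. -/
theorem mul_I_J (f : Ser A) (M : Ser H) : I f * J M =
    mulMap U (tmap J (I ∘ₗ act ∘ₗ tmulLeft f) (ℋ.comul M)) := by
  refine LinearMap.congr_fun (f := LinearMap.mulLeft K (I f) ∘ₗ J)
    (g := (mulMap U ∘ₗ tmap J (I ∘ₗ act ∘ₗ tmulLeft f)) ∘ₗ ℋ.comul)
    (recursion_ext d.adjoin_e ?_ (fun k z => z * J (const (e k))) (fun k L => ?_)
      (fun k L => d.comul_recursion (S := LinearMap.mulRight K (J (const (e k))))
        (fun L M => ?_) L)) M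
  · simp only [LinearMap.comp_apply, d.comul_one_H, tmap_tmul, mulMap_tmul, s.alg_J.one,
      LinearMap.mulLeft_apply, mul_one, one_mul, tmulLeft_apply, d.act_one]
  · simp only [LinearMap.comp_apply, LinearMap.mulLeft_apply, s.alg_J.mul, mul_assoc]
  · simp only [LinearMap.comp_apply, tmap_tmul, mulMap_tmul, tmulLeft_apply, d.act_mul_e,
      s.alg_J.mul, LinearMap.mulRight_apply, mul_assoc, s.cross, mul_add]

omit d in
-- Rewrites Δ(L) Δ(f) as the bicrossproduct coproduct (L₁ ⊗ L₂⁽⁻¹⁾ f₁) ⊗ (L₂⁽⁰⁾ ⊗ f₂) seen through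
-- Ψ.
theorem twist_mul_tmap (z : Ser (H ⊗[ℂ] H)) (w : Ser (A ⊗[ℂ] A)) :
    twist β J I z * tmap I I w = tmap Ψ.toLinearMap Ψ.toLinearMap
      (tmap (tmap LinearMap.id (mulMap A) ∘ₗ coeffwise (TensorProduct.assoc ℂ H A A).toLinearMap)
        LinearMap.id
        (coeffwise (TensorProduct.tensorTensorTensorComm ℂ (H ⊗[ℂ] A) H A A).toLinearMap
          (tmul (coeffwise (TensorProduct.assoc ℂ H A H).symm.toLinearMap
            (tmap LinearMap.id β z)) w))) := by
  set T : Ser (((H ⊗[ℂ] A) ⊗[ℂ] H) ⊗[ℂ] (A ⊗[ℂ] A)) →ₗ[K] Ser (U ⊗[ℂ] U) :=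
    tmap Ψ.toLinearMap Ψ.toLinearMap ∘ₗ
    tmap (tmap LinearMap.id (mulMap A) ∘ₗ coeffwise (TensorProduct.assoc ℂ H A A).toLinearMap)
      LinearMap.id ∘ₗ
    coeffwise (TensorProduct.tensorTensorTensorComm ℂ (H ⊗[ℂ] A) H A A).toLinearMap with hT
  have h : ∀ L g N f₁ f₂, T (tmul (tmul (tmul L g) N) (tmul f₁ f₂)) =
      tmul (J L) 1 * tmul (I g) (J N) * tmul (I f₁) (I f₂) := fun L g N f₁ f₂ => by
    simp only [hT, tmap_tmul, coeffwise_tttComm, LinearMap.comp_apply, coeffwise_assoc,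
      mulMap_tmul, LinearMap.id_apply, LinearEquiv.coe_coe, s.equiv_tmul, tmul_mul_tmul, one_mul,
      s.alg_I.mul, mul_assoc]
  change _ = T _
  -- The values of `T` on pure tensors, recorded in `h`, are all that the reduction in each variable
  -- uses.
  clear_value T
  refine isLinear_tmul_ext (f := fun z => twist β J I z * tmap I I w)
    (g := fun z => T (tmul (coeffwise (TensorProduct.assoc ℂ H A H).symm.toLinearMap
      (tmap LinearMap.id β z)) w)) ?_ ?_ (fun L M => ?_) z
  · exact ⟨fun _ _ => by simp only [map_add, add_mul],
      fun _ _ => by simp only [map_smul, smul_mul_assoc]⟩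
  · exact ⟨fun _ _ => by simp only [map_add, add_tmul],
      fun _ _ => by simp only [map_smul, smul_tmul]⟩
  rw [twist_tmul, tmap_tmul]
  refine isLinear_tmul_ext (f := fun b => tmul (J L) 1 * tmap I J b * tmap I I w)
    (g := fun b => T (tmul (coeffwise (TensorProduct.assoc ℂ H A H).symm.toLinearMap
      (tmul (LinearMap.id L) b)) w)) ?_ ?_ (fun g N => ?_) (β M)
  · exact ⟨fun _ _ => by simp only [map_add, mul_add, add_mul],
      fun _ _ => by simp only [map_smul, mul_smul_comm, smul_mul_assoc]⟩
  · exact ⟨fun _ _ => by simp only [map_add, tmul_add, add_tmul],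
      fun _ _ => by simp only [map_smul, tmul_smul, smul_tmul]⟩
  rw [coeffwise_assoc_symm, tmap_tmul, LinearMap.id_apply]
  refine isLinear_tmul_ext (f := fun w => tmul (J L) 1 * tmul (I g) (J N) * tmap I I w)
    (g := fun w => T (tmul (tmul (tmul L g) N) w)) ?_ ?_ (fun f₁ f₂ => ?_) w
  · exact ⟨fun _ _ => by simp only [map_add, mul_add],
      fun _ _ => by simp only [map_smul, mul_smul_comm]⟩
  · exact ⟨fun _ _ => by simp only [map_add, tmul_add],
      fun _ _ => by simp only [map_smul, tmul_smul]⟩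
  rw [h, tmap_tmul]

theorem isBicrossproduct : IsBicrossproduct ℋ 𝒜 act β ((s.hopf d).transport Ψ) where
  mul_eq L f M g := by
    change Ψ.symm (mulMap U (tmap Ψ.toLinearMap Ψ.toLinearMap (tmul (tmul L f) (tmul M g)))) = _
    rw [LinearEquiv.symm_apply_eq, tmap_tmul, mulMap_tmul, LinearEquiv.coe_coe, s.equiv_tmul,
      s.equiv_tmul, mul_assoc, ← mul_assoc (I f), s.mul_I_J d, d.classical_H.1, d.classical_A.1]
    generalize ℋ.comul M = z
    refine isLinear_tmul_ext
      (f := fun z => J L * (mulMap U (tmap J (I ∘ₗ act ∘ₗ tmulLeft f) z) * I g))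
      (g := fun z => Ψ (tmap LinearMap.id (mulMap A)
        (coeffwise (TensorProduct.assoc ℂ H A A).toLinearMap
          (tmul (tmap (mulMap H) act
            (coeffwise (TensorProduct.tensorTensorTensorComm ℂ H A H H).toLinearMap
              (tmul (tmul L f) z))) g)))) ?_ ?_ (fun M N => ?_) z
    · exact ⟨fun _ _ => by simp only [map_add, add_mul, mul_add],
        fun _ _ => by simp only [map_smul, smul_mul_assoc, mul_smul_comm]⟩
    · exact ⟨fun _ _ => by simp only [map_add, add_tmul, tmul_add],
        fun _ _ => by simp only [map_smul, smul_tmul, tmul_smul]⟩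
    simp only [coeffwise_tttComm, tmap_tmul, coeffwise_assoc, mulMap_tmul, s.equiv_tmul,
      LinearMap.id_apply, LinearMap.comp_apply, tmulLeft_apply, s.alg_J.mul, s.alg_I.mul, mul_assoc]
  one_eq := by
    change Ψ.symm (const 1) = _
    rw [LinearEquiv.symm_apply_eq, s.equiv_tmul, d.classical_H.2, d.classical_A.2, const_one,
      const_one, const_one, s.alg_J.one, s.alg_I.one, mul_one]
  comul_eq L f := by
    change tmap Ψ.symm.toLinearMap Ψ.symm.toLinearMap (Δ (Ψ (tmul L f))) = _
    rw [s.equiv_tmul, s.comul_J_I d, s.twist_mul_tmap, tmap_symm_tmap, d.classical_A.1]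
  counit_eq L f := by
    change ε (Ψ (tmul L f)) = _
    rw [s.equiv_tmul, s.counit_J_I d]
    exact (mulMap_tmul _ _).symm
  antipode_eq L f := by
    have hJ : Ψ.toLinearMap ∘ₗ tmulRight 𝒜.one ∘ₗ ℋ.antipode = J ∘ₗ ℋ.antipode :=
      LinearMap.ext fun M => by
        simp only [LinearMap.comp_apply, LinearEquiv.coe_coe, tmulRight_apply, s.equiv_tmul,
          d.classical_A.2, const_one, s.alg_I.one, mul_one]
    have hI : Ψ.toLinearMap ∘ₗ tmulLeft ℋ.one ∘ₗ 𝒜.antipode ∘ₗ 𝒜.mul =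
        I ∘ₗ 𝒜.antipode ∘ₗ mulMap A :=
      LinearMap.ext fun M => by
        simp only [LinearMap.comp_apply, LinearEquiv.coe_coe, tmulLeft_apply, s.equiv_tmul,
          d.classical_H.2, const_one, s.alg_J.one, one_mul, d.classical_A.1]
    -- The bicrossproduct formula is S(L⁽⁻¹⁾ f) S(L⁽⁰⁾) evaluated in U, so after moving Ψ through
    -- the two embeddings it is the definition of `antipodeSmash`.
    change Ψ.symm (antipodeSmash ℋ 𝒜 β J I (Ψ.symm (Ψ (tmul L f)))) =
      Ψ.symm (mulMap U (tmap Ψ.toLinearMap Ψ.toLinearMap (tmap _ _ _)))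
    rw [LinearEquiv.symm_apply_apply, tmap_comp_apply, hJ, hI]
    simp only [antipodeSmash, LinearMap.comp_apply, tmap_tmul, LinearMap.id_apply]

end SmashData

/-! ### The Poincaré algebra as a semidirect sum -/

section Coordinates

namespace Poincare

/-- The component in the Lorentz algebra. -/
def lorentzPart : Poincare →ₗ[ℂ] Lorentz where
  toFun a := a.x
  map_add' _ _ := rfl
  map_smul' _ _ := rfl

/-- The component in the translations. -/
def transPart : Poincare →ₗ[ℂ] Translations where
  toFun a := ⟨a.p, a.t⟩
  map_add' _ _ := rfl
  map_smul' _ _ := rfl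

/-- The inclusion of the Lorentz algebra. -/
def ofLorentz : Lorentz →ₗ[ℂ] Poincare where
  toFun x := ⟨x, 0, 0⟩
  map_add' _ _ := ext' rfl (fun _ => (add_zero _).symm) (add_zero _).symm
  map_smul' _ _ := ext' rfl (fun _ => (mul_zero _).symm) (mul_zero _).symm

/-- The inclusion of the translations. -/
def ofTrans : Translations →ₗ[ℂ] Poincare where
  toFun q := ⟨0, q.p, q.t⟩
  map_add' _ _ := ext' (add_zero _).symm (fun _ => rfl) rfl
  map_smul' _ _ := ext' (smul_zero _).symm (fun _ => rfl) rfl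

theorem eq_add (a : Poincare) : a = ofLorentz (lorentzPart a) + ofTrans (transPart a) :=
  ext' (add_zero _).symm (fun _ => (zero_add _).symm) (zero_add _).symm

theorem lorentzPart_lie (a b : Poincare) :
    lorentzPart ⁅a, b⁆ = ⁅lorentzPart a, lorentzPart b⁆ := rfl

/-- The translations form an abelian ideal on which o(1,3) acts from the right, and this is the
whole bracket outside the Lorentz part. -/
theorem transPart_lie (a b : Poincare) : transPart ⁅a, b⁆ =
    ract (lorentzPart b) (transPart a) - ract (lorentzPart a) (transPart b) := by
  refine Translations.ext_comp (fun l => ?_) ?_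
  · change ⁅a, b⁆.p l = _
    simp only [bracket_p, Translations.sub_p, ract_p, Lorentz.sum_eps]
    change _ = Complex.I * (a.p (l + 1) * b.x.m (l + 2) - a.p (l + 2) * b.x.m (l + 1)) +
      Complex.I * (a.t * b.x.n l) -
      (Complex.I * (b.p (l + 1) * a.x.m (l + 2) - b.p (l + 2) * a.x.m (l + 1)) +
        Complex.I * (b.t * a.x.n l))
    ring
  · change ⁅a, b⁆.t = _
    simp only [bracket_t, Translations.sub_t, ract_t, Fin.sum_univ_three]
    change _ = Complex.I * (a.p 0 * b.x.n 0 + a.p 1 * b.x.n 1 + a.p 2 * b.x.n 2) -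
      Complex.I * (b.p 0 * a.x.n 0 + b.p 1 * a.x.n 1 + b.p 2 * a.x.n 2)
    ring

theorem lie_ofLorentz (x y : Lorentz) : ⁅ofLorentz x, ofLorentz y⁆ = ofLorentz ⁅x, y⁆ := by
  refine ext' rfl (fun l => ?_) ?_
  · simp [bracket_p, ofLorentz]
  · simp [bracket_t, ofLorentz]

theorem lie_ofTrans (q r : Translations) : ⁅ofTrans q, ofTrans r⁆ = 0 := by
  refine ext' (lie_self (0 : Lorentz)) (fun l => ?_) ?_
  · simp [bracket_p, ofTrans]
  · simp [bracket_t, ofTrans]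

theorem lie_ofTrans_ofLorentz (q : Translations) (x : Lorentz) :
    ⁅ofTrans q, ofLorentz x⁆ = ofTrans (ract x q) := by
  refine ext' (zero_lie x) (fun l => ?_) ?_
  · simp [bracket_p, ofLorentz, ofTrans, ract_p]
  · simp [bracket_t, ofLorentz, ofTrans, ract_t]

/-- The basis `M i`, `N i`, `P i`, `P₄` of the Poincaré algebra. -/
def basisGen : (Fin 3 ⊕ Fin 3) ⊕ (Fin 3 ⊕ Unit) → Poincare :=
  Sum.elim (fun k => ofLorentz (lorentzGen k)) (fun k => ofTrans (transGen k))

theorem span_basisGen : ⊤ ≤ Submodule.span ℂ (Set.range basisGen) := fun a _ => by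
  rw [a.eq_add]
  refine add_mem ?_ ?_
  · have h := Submodule.mem_map_of_mem (f := ofLorentz) (lorentz_span (x := lorentzPart a) trivial)
    rw [Submodule.map_span] at h
    refine Submodule.span_mono ?_ h
    rintro _ ⟨_, ⟨k, rfl⟩, rfl⟩
    exact ⟨.inl k, rfl⟩
  · have h := Submodule.mem_map_of_mem (f := ofTrans) (trans_span (x := transPart a) trivial)
    rw [Submodule.map_span] at h
    refine Submodule.span_mono ?_ h
    rintro _ ⟨_, ⟨k, rfl⟩, rfl⟩
    exact ⟨.inr k, rfl⟩

end Poincare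

end Coordinates

/-! ### The deformed coproduct on io(1,3) -/

section KappaGen

variable {U : Type} [Ring U] [Algebra ℂ U] {J : Ser ULorentz →ₗ[K] Ser U}
  {I : Ser UTranslations →ₗ[K] Ser U}

variable (J I) in
/-- The `κ`-deformed coproduct of an element of the Lorentz algebra. -/
def kappaGen (x : Lorentz) : Ser (U ⊗[ℂ] U) :=
  tmul (J (const (gen x))) 1 + tmap I J (coactGen x)

variable (cross : ∀ f x, I f * J (const (gen x)) = J (const (gen x)) * I f + I (DL x f))
  (hI : IsAlg I) (hJ : IsAlg J)

include cross

/-- Commuting past x ⊗ 1 differentiates only the first leg; it supplies the term D_x ⊗ id of the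
step operator. -/
theorem tmap_mul_tmul_one {B : Type} [AddCommGroup B] [Module ℂ B] (G : Ser B →ₗ[K] Ser U)
    (x : Lorentz) (b : Ser (UTranslations ⊗[ℂ] B)) :
    tmap I G b * tmul (J (const (gen x))) 1 =
      tmul (J (const (gen x))) 1 * tmap I G b + tmap I G (tmap (DL x) LinearMap.id b) := by
  refine isLinear_tmul_ext (f := fun b => tmap I G b * tmul (J (const (gen x))) 1)
    (g := fun b => tmul (J (const (gen x))) 1 * tmap I G b +
      tmap I G (tmap (DL x) LinearMap.id b)) ?_ ?_ (fun f u => ?_) b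
  · exact ⟨fun _ _ => by simp only [add_mul, map_add],
      fun _ _ => by simp only [smul_mul_assoc, map_smul]⟩
  · exact ⟨fun _ _ => by simp only [mul_add, map_add]; abel,
      fun _ _ => by simp only [mul_smul_comm, map_smul, smul_add]⟩
  simp only [tmap_tmul, tmul_mul_tmul, mul_one, one_mul, cross, add_tmul, LinearMap.id_apply]

include hI

/-- Commuting past ∑ c_l ⊗ e_l differentiates the second leg with weights c_l, which commute with 𝒜;
it supplies the remaining terms of the step operator. -/
theorem tmap_mul_gauge (c : Fin 3 ⊕ Fin 3 → Ser UTranslations)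
    (z : Ser (UTranslations ⊗[ℂ] UTranslations)) :
    tmap I I z * tmap I J (gauge c) = tmap I J (gauge c) * tmap I I z +
      tmap I I (∑ l, tmap (LinearMap.mulLeft K (c l)) (DGen l) z) := by
  refine isLinear_tmul_ext (f := fun z => tmap I I z * tmap I J (gauge c))
    (g := fun z => tmap I J (gauge c) * tmap I I z +
      tmap I I (∑ l, tmap (LinearMap.mulLeft K (c l)) (DGen l) z)) ?_ ?_ (fun f g => ?_) z
  · exact ⟨fun _ _ => by simp only [add_mul, map_add],
      fun _ _ => by simp only [smul_mul_assoc, map_smul]⟩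
  · exact ⟨fun _ _ => by simp only [mul_add, map_add, Finset.sum_add_distrib]; abel,
      fun _ _ => by simp only [mul_smul_comm, map_smul, smul_add, ← Finset.smul_sum]⟩
  simp only [gauge, map_sum, tmap_tmul, Finset.mul_sum, Finset.sum_mul, tmul_mul_tmul, cross,
    tmul_add, Finset.sum_add_distrib, ← hI.mul, LinearMap.mulLeft_apply, mul_comm f]

/-- The two preceding commutation rules add up to the operator in `transComul_DL`, so the deformed
coproducts satisfy the same cross relation as the generators. -/
theorem comul_mul_kappaGen (f : Ser UTranslations) (x : Lorentz) :
    tmap I I (transComul f) * kappaGen J I x =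
      kappaGen J I x * tmap I I (transComul f) + tmap I I (transComul (DL x f)) := by
  have h := tmap_mul_gauge cross hI (coactComp x) (transComul f)
  rw [transComul_DL, spread, LinearMap.add_apply, LinearMap.sum_apply, kappaGen, mul_add, add_mul,
    tmap_mul_tmul_one cross]
  change _ + tmap I I _ * tmap I J (gauge _) = _ + tmap I J (gauge _) * tmap I I _ + _
  rw [h, map_add]
  abel

include hJ

/-- Commutators of (I ⊗ J)(c(x)) with y ⊗ 1 produce D_y c(x); with the commutator of the two
coaction terms they assemble into the Maurer–Cartan equation. -/
theorem kappaGen_lie (x y : Lorentz) : kappaGen J I ⁅x, y⁆ =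
    kappaGen J I x * kappaGen J I y - kappaGen J I y * kappaGen J I x := by
  have hIJ := hI.tmap hJ
  rw [kappaGen, coactGen_lie, gen_lie, LinearMap.map_sub const, const_mul, const_mul, map_sub J,
    hJ.mul, hJ.mul, sub_tmul, map_add, map_sub, map_sub, hIJ.mul, hIJ.mul, kappaGen, kappaGen]
  simp only [mul_add, add_mul, tmap_mul_tmul_one cross, tmul_mul_tmul, mul_one]
  abel

end KappaGen

section Embeddings

/-- The inclusion of the enveloping algebra of the Lorentz algebra. -/
def lorentzHom : ULorentz →ₐ[ℂ] UPoincare :=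
  liftAlg (genMap Poincare ∘ₗ Poincare.ofLorentz) fun x y => by
    simp only [LinearMap.comp_apply, genMap_apply, ← Poincare.lie_ofLorentz, gen_lie]

/-- The inclusion of the enveloping algebra of the translations. -/
def translationHom : UTranslations →ₐ[ℂ] UPoincare :=
  liftAlg (genMap Poincare ∘ₗ Poincare.ofTrans) fun x y => by
    simp only [LinearMap.comp_apply, genMap_apply, ← gen_lie, Poincare.lie_ofTrans, gen_zero]
    rw [show ⁅x, y⁆ = 0 from rfl, map_zero, gen_zero]

/-- The inclusion of `ℋ` in the `κ`-Poincaré algebra. -/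
def lorentzIncl : Ser ULorentz →ₗ[K] Ser UPoincare := coeffwise lorentzHom.toLinearMap

/-- The inclusion of `𝒜` in the `κ`-Poincaré algebra. -/
def transIncl : Ser UTranslations →ₗ[K] Ser UPoincare := coeffwise translationHom.toLinearMap

theorem isAlg_lorentzIncl : IsAlg lorentzIncl := .coeffwise _

theorem isAlg_transIncl : IsAlg transIncl := .coeffwise _

theorem lorentzHom_gen (x : Lorentz) : lorentzHom (gen x) = gen (Poincare.ofLorentz x) :=
  liftAlg_gen _ _ _

theorem lorentzIncl_gen (x : Lorentz) :
    lorentzIncl (const (gen x)) = const (gen (Poincare.ofLorentz x)) := by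
  rw [lorentzIncl, coeffwise_const, AlgHom.toLinearMap_apply, lorentzHom_gen]

theorem translationHom_gen (q : Translations) :
    translationHom (gen q) = gen (Poincare.ofTrans q) := liftAlg_gen _ _ _

theorem transIncl_gen (q : Translations) :
    transIncl (const (gen q)) = const (gen (Poincare.ofTrans q)) := by
  rw [transIncl, coeffwise_const, AlgHom.toLinearMap_apply, translationHom_gen]

theorem const_gen_poincare (a : Poincare) : (const (gen a) : Ser UPoincare) =
    lorentzIncl (const (gen (Poincare.lorentzPart a))) +
      transIncl (const (gen (Poincare.transPart a))) := by
  rw [lorentzIncl_gen, transIncl_gen, ← map_add, ← gen_add, ← Poincare.eq_add]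

/-- On momenta this is a bracket of io(1,3); the general case follows since commuting with x and D_x
are both derivations. -/
theorem transIncl_mul_lorentzIncl (f : Ser UTranslations) (x : Lorentz) :
    transIncl f * lorentzIncl (const (gen x)) =
      lorentzIncl (const (gen x)) * transIncl f + transIncl (DL x f) := by
  refine LinearMap.congr_fun
    (f := LinearMap.mulRight K (lorentzIncl (const (gen x))) ∘ₗ transIncl)
    (g := LinearMap.mulLeft K (lorentzIncl (const (gen x))) ∘ₗ transIncl + transIncl ∘ₗ DL x)
    (adjoin_ext adjoin_gen ?_ fun q u hu => ?_) f
  · simp only [LinearMap.comp_apply, LinearMap.add_apply, LinearMap.mulRight_apply,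
      LinearMap.mulLeft_apply, isAlg_transIncl.one, DL_one, map_zero, one_mul, mul_one, add_zero]
  · have hq : transIncl (const (gen q)) * lorentzIncl (const (gen x)) =
        lorentzIncl (const (gen x)) * transIncl (const (gen q)) +
          transIncl (DL x (const (gen q))) := by
      rw [DL_const, lorentzDer_gen, transIncl_gen, transIncl_gen, lorentzIncl_gen, ← const_mul,
        ← const_mul, ← map_add, ← Poincare.lie_ofTrans_ofLorentz, gen_lie]
      congr 1
      abel
    simp only [LinearMap.comp_apply, LinearMap.add_apply, LinearMap.mulRight_apply,
      LinearMap.mulLeft_apply] at hu ⊢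
    rw [isAlg_transIncl.mul, mul_assoc, hq, mul_add, ← mul_assoc, hu, DL_mul, map_add,
      isAlg_transIncl.mul, isAlg_transIncl.mul, add_mul, mul_assoc]
    abel

/-- The `κ`-deformed coproducts of the elements of the Poincaré algebra. -/
def poincareComulGen : Poincare →ₗ[ℂ] Ser (UPoincare ⊗[ℂ] UPoincare) where
  toFun a := kappaGen lorentzIncl transIncl (Poincare.lorentzPart a) +
    tmap transIncl transIncl (transComul (const (gen (Poincare.transPart a))))
  map_add' a b := by
    simp only [kappaGen, map_add, add_tmul]
    abel
  map_smul' c a := by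
    have h : ∀ {V W : Type} [AddCommGroup V] [Module ℂ V] [AddCommGroup W] [Module ℂ W]
        (F : Ser V →ₗ[K] Ser W) (v : Ser V), F (c • v) = c • F v := fun F v =>
      F.map_smul_of_tower c v
    simp only [kappaGen, map_smul Poincare.lorentzPart, map_smul Poincare.transPart, gen_smul,
      map_smul const, map_smul coactGen, h, csmul_tmul, smul_add, RingHom.id_apply]

theorem poincareComulGen_apply (a : Poincare) : poincareComulGen a =
    kappaGen lorentzIncl transIncl (Poincare.lorentzPart a) +
      tmap transIncl transIncl (transComul (const (gen (Poincare.transPart a)))) := rfl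

/-- Split each element into Lorentz and translation parts: the three kinds of bracket are
`kappaGen_lie`, the cross relation `comul_mul_kappaGen`, and commutativity of 𝒜 ⊗̂ 𝒜. -/
theorem poincareComulGen_lie (a b : Poincare) : poincareComulGen ⁅a, b⁆ =
    poincareComulGen a * poincareComulGen b - poincareComulGen b * poincareComulGen a := by
  have hTT := isAlg_transIncl.tmap isAlg_transIncl
  have hd : ∀ q x, transComul (const (gen (ract x q))) = transComul (DL x (const (gen q))) :=
    fun q x => by rw [DL_const, lorentzDer_gen]
  rw [poincareComulGen_apply, poincareComulGen_apply, poincareComulGen_apply, Poincare.lorentzPart_lie, Poincare.transPart_lie, gen_sub, map_sub, map_sub, map_sub, hd, hd,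
    kappaGen_lie transIncl_mul_lorentzIncl isAlg_transIncl isAlg_lorentzIncl]
  generalize Poincare.lorentzPart a = x
  generalize Poincare.lorentzPart b = y
  generalize (const (gen (Poincare.transPart a)) : Ser UTranslations) = q
  generalize (const (gen (Poincare.transPart b)) : Ser UTranslations) = r
  have h₁ := comul_mul_kappaGen transIncl_mul_lorentzIncl isAlg_transIncl (J := lorentzIncl) q y
  have h₂ := comul_mul_kappaGen transIncl_mul_lorentzIncl isAlg_transIncl (J := lorentzIncl) r x
  have h₃ : tmap transIncl transIncl (transComul q) * tmap transIncl transIncl (transComul r) =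
      tmap transIncl transIncl (transComul r) * tmap transIncl transIncl (transComul q) := by
    rw [← hTT.mul, ← hTT.mul, mul_comm]
  rw [add_mul, add_mul, mul_add, mul_add, mul_add, mul_add, h₁, h₂, h₃]
  abel

/-- The `κ`-deformed coproduct. -/
def poincareComul : Ser UPoincare →ₗ[K] Ser (UPoincare ⊗[ℂ] UPoincare) :=
  liftSer poincareComulGen poincareComulGen_lie

theorem isAlg_poincareComul : IsAlg poincareComul := isAlg_liftSer _ _

theorem poincareComul_gen (a : Poincare) : poincareComul (const (gen a)) =
    kappaGen lorentzIncl transIncl (Poincare.lorentzPart a) +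
      tmap transIncl transIncl (transComul (const (gen (Poincare.transPart a)))) :=
  liftSer_gen _ _ _

theorem poincareComul_ofLorentz (x : Lorentz) :
    poincareComul (const (gen (Poincare.ofLorentz x))) = kappaGen lorentzIncl transIncl x := by
  rw [poincareComul_gen, show Poincare.transPart (Poincare.ofLorentz x) = 0 from rfl, gen_zero,
    map_zero, map_zero, map_zero, add_zero]
  rfl

theorem poincareComul_transIncl (f : Ser UTranslations) :
    poincareComul (transIncl f) = tmap transIncl transIncl (transComul f) := by
  refine LinearMap.congr_fun (f := poincareComul ∘ₗ transIncl)
    (g := tmap transIncl transIncl ∘ₗ transComul)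
    (IsAlg.ext adjoin_gen (isAlg_poincareComul.comp isAlg_transIncl)
      ((isAlg_transIncl.tmap isAlg_transIncl).comp isAlg_transComul) fun q => ?_) f
  rw [LinearMap.comp_apply, LinearMap.comp_apply, transIncl_gen, poincareComul_gen,
    show Poincare.lorentzPart (Poincare.ofTrans q) = 0 from rfl, kappaGen, gen_zero, map_zero,
    map_zero, map_zero, map_zero, zero_tmul, add_zero, zero_add]
  rfl

end Embeddings

/-! ### Factorisation of U(io(1,3))[[h]] by an orbit map -/

section Factorization

/-- The right action of the Poincaré algebra on `ℋ ⊗̂ 𝒜`. -/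
def smashOp : Poincare →ₗ[ℂ] Module.End K (Ser (ULorentz ⊗[ℂ] UTranslations)) where
  toFun a := tmap (LinearMap.mulRight K (const (gen (Poincare.lorentzPart a)))) LinearMap.id +
    tmap LinearMap.id (DL (Poincare.lorentzPart a) +
      LinearMap.mulRight K (const (gen (Poincare.transPart a))))
  map_add' a b := tmul_ext fun L f => by
    simp only [LinearMap.add_apply, tmap_tmul, LinearMap.mulRight_apply, map_add, DL_add,
      mul_add, add_tmul, tmul_add]
    abel
  map_smul' c a := tmul_ext fun L f => by
    simp only [LinearMap.add_apply, tmap_tmul, LinearMap.mulRight_apply,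
      map_smul Poincare.lorentzPart, map_smul Poincare.transPart, gen_smul, map_smul const, DL_smul,
      mul_smul_comm, csmul_tmul, tmul_csmul, tmul_add, RingHom.id_apply, LinearMap.smul_apply,
      smul_add]

theorem smashOp_tmul (a : Poincare) (L : Ser ULorentz) (f : Ser UTranslations) :
    smashOp a (tmul L f) = tmul (L * const (gen (Poincare.lorentzPart a))) f +
      tmul L (DL (Poincare.lorentzPart a) f + f * const (gen (Poincare.transPart a))) := by
  have h : smashOp a = (tmap (LinearMap.mulRight K (const (gen (Poincare.lorentzPart a))))
      LinearMap.id + tmap LinearMap.id (DL (Poincare.lorentzPart a) +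
        LinearMap.mulRight K (const (gen (Poincare.transPart a)))) :
      Ser (ULorentz ⊗[ℂ] UTranslations) →ₗ[K] Ser (ULorentz ⊗[ℂ] UTranslations)) := rfl
  rw [h]
  rw [LinearMap.add_apply, tmap_tmul, tmap_tmul]
  rfl

/-- The operators are those of right multiplication by io(1,3) in the smash product, written on ℋ ⊗̂
𝒜 before that product is available. Verifying the bracket relations here supplies an inverse to
multiplication. -/
theorem smashOp_lie (a b : Poincare) :
    smashOp ⁅a, b⁆ = smashOp b * smashOp a - smashOp a * smashOp b := tmul_ext fun L f => by
  have hd : ∀ q x, (const (gen (ract x q)) : Ser UTranslations) = DL x (const (gen q)) :=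
    fun q x => by rw [DL_const, lorentzDer_gen]
  rw [LinearMap.sub_apply, Module.End.mul_apply, Module.End.mul_apply]
  simp only [smashOp_tmul, map_add, Poincare.lorentzPart_lie, Poincare.transPart_lie, gen_lie,
    gen_sub, LinearMap.map_sub const, const_mul, hd, DL_lie, DL_mul, mul_sub, sub_tmul, tmul_add,
    tmul_sub, mul_assoc, mul_comm (const (gen (Poincare.transPart a)) : Ser UTranslations)]
  abel

/-- The map `L f ↦ L ⊗ f`. -/
def factor : Ser UPoincare →ₗ[K] Ser (ULorentz ⊗[ℂ] UTranslations) :=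
  orbit smashOp smashOp_lie (tmul 1 1)

/-- The map `L ⊗ f ↦ L f`. -/
def smashMul : Ser (ULorentz ⊗[ℂ] UTranslations) →ₗ[K] Ser UPoincare :=
  mulMap UPoincare ∘ₗ tmap lorentzIncl transIncl

theorem smashMul_tmul (L : Ser ULorentz) (f : Ser UTranslations) :
    smashMul (tmul L f) = lorentzIncl L * transIncl f := by
  rw [smashMul, LinearMap.comp_apply, tmap_tmul, mulMap_tmul]

/-- Multiplication L ⊗ f ↦ L f intertwines the action with right multiplication, by the relation f x
= x f + D_x f. -/
theorem smashMul_smashOp (a : Poincare) (z : Ser (ULorentz ⊗[ℂ] UTranslations)) :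
    smashMul (smashOp a z) = smashMul z * const (gen a) := by
  refine isLinear_tmul_ext (f := fun z => smashMul (smashOp a z))
    (g := fun z => smashMul z * const (gen a)) ?_ ?_ (fun L f => ?_) z
  · exact ⟨fun _ _ => by simp only [map_add], fun _ _ => by simp only [map_smul]⟩
  · exact ⟨fun _ _ => by simp only [map_add, add_mul],
      fun _ _ => by simp only [map_smul, smul_mul_assoc]⟩
  rw [smashOp_tmul, map_add, smashMul_tmul, smashMul_tmul, smashMul_tmul, const_gen_poincare,
    mul_add, mul_assoc, transIncl_mul_lorentzIncl, isAlg_lorentzIncl.mul, map_add,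
    isAlg_transIncl.mul, mul_add, mul_add, mul_assoc, mul_assoc]
  abel

/-- Both sides send 1 to 1 and commute with right multiplication by io(1,3). -/
theorem smashMul_factor : smashMul ∘ₗ factor = LinearMap.id := by
  refine recursion_ext adjoin_gen ?_ (fun a z => z * const (gen a)) (fun a u => ?_) (fun a u => rfl)
  · rw [LinearMap.comp_apply, factor, orbit_one, smashMul_tmul, isAlg_lorentzIncl.one,
      isAlg_transIncl.one, mul_one]
    rfl
  · rw [LinearMap.comp_apply, factor, orbit_mul_gen, smashMul_smashOp]
    rfl

/-- On L ⊗ 1 the action of a Lorentz element is pure right multiplication on L, since D_x kills 1.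
-/
theorem factor_lorentzIncl (L : Ser ULorentz) : factor (lorentzIncl L) = tmul L 1 := by
  refine LinearMap.congr_fun (f := factor ∘ₗ lorentzIncl) (g := tmulRight 1)
    (adjoin_ext adjoin_gen ?_ fun x u hu => ?_) L
  · rw [LinearMap.comp_apply, isAlg_lorentzIncl.one, factor, orbit_one]
    rfl
  · rw [LinearMap.comp_apply, tmulRight_apply] at hu ⊢
    rw [isAlg_lorentzIncl.mul, lorentzIncl_gen, factor, orbit_mul_gen, ← factor, hu, smashOp_tmul,
      show Poincare.transPart (Poincare.ofLorentz x) = 0 from rfl, gen_zero, map_zero, mul_zero,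
      DL_one, add_zero, tmul_zero, add_zero]
    rfl

theorem factor_mul_transIncl (L : Ser ULorentz) (f : Ser UTranslations) :
    factor (lorentzIncl L * transIncl f) = tmul L f := by
  refine LinearMap.congr_fun (f := factor ∘ₗ LinearMap.mulLeft K (lorentzIncl L) ∘ₗ transIncl)
    (g := tmulLeft L) (adjoin_ext adjoin_gen ?_ fun q u hu => ?_) f
  · rw [LinearMap.comp_apply, LinearMap.comp_apply, LinearMap.mulLeft_apply, isAlg_transIncl.one,
      mul_one, factor_lorentzIncl]
    rfl
  · rw [LinearMap.comp_apply, LinearMap.comp_apply, LinearMap.mulLeft_apply,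
      tmulLeft_apply] at hu ⊢
    rw [isAlg_transIncl.mul, ← mul_assoc, transIncl_gen, factor, orbit_mul_gen, ← factor, hu,
      smashOp_tmul, show Poincare.lorentzPart (Poincare.ofTrans q) = 0 from rfl, gen_zero, map_zero,
      mul_zero, zero_tmul, zero_add, show DL 0 (const u) = 0 by rw [DL_const, map_zero]; exact map_zero const,
      zero_add]
    rfl

/-- The isomorphism `L ⊗ f ↦ L f`. -/
def smashEquiv : Ser (ULorentz ⊗[ℂ] UTranslations) ≃ₗ[K] Ser UPoincare :=
  .ofLinearMap smashMul factor smashMul_factor (tmul_ext fun L f => by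
    rw [LinearMap.comp_apply, smashMul_tmul, factor_mul_transIncl]
    rfl)

theorem smashEquiv_tmul (L : Ser ULorentz) (f : Ser UTranslations) :
    smashEquiv (tmul L f) = lorentzIncl L * transIncl f := smashMul_tmul L f

theorem smashData : SmashData transHopf eL DGen coactMat lorentzIncl transIncl poincareComul
    (primCounit Poincare) smashEquiv where
  alg_J := isAlg_lorentzIncl
  alg_I := isAlg_transIncl
  alg_comul := isAlg_poincareComul
  alg_counit := isAlg_primCounit _
  alg_antipode := isAlg_transAntipode
  equiv_tmul := smashEquiv_tmul
  cross f k := transIncl_mul_lorentzIncl f _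
  comul_I := poincareComul_transIncl
  comul_J_e k := by
    rw [lorentzIncl_gen, poincareComul_ofLorentz, kappaGen, ← lorentzIncl_gen]
    change _ + tmap _ _ (gauge _) = _
    rw [gauge, map_sum]
    simp only [tmap_tmul]
    rfl
  counit_I f := by
    refine LinearMap.congr_fun (f := primCounit Poincare ∘ₗ transIncl) (g := transCounit)
      (IsAlg.ext adjoin_transGen ((isAlg_primCounit _).comp isAlg_transIncl) isAlg_transCounit
        fun k => ?_) f
    rw [LinearMap.comp_apply, transIncl_gen, primCounit_gen]
    rcases k with i | _
    · exact (transCounit_P i).symm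
    · exact transCounit_P4.symm
  counit_J_e k := by rw [lorentzIncl_gen, primCounit_gen]

end Factorization

/-! ### The κ-Poincaré Hopf algebra and its values on generators -/

section KappaPoincareHopf

/-- The `κ`-Poincaré Hopf algebra. -/
def kappaPoincare : HopfStr UPoincare := smashData.hopf bicrossData

theorem kappaPoincare_classical : HasClassicalProduct kappaPoincare := ⟨rfl, rfl⟩

theorem transIncl_P (i : Fin 3) : transIncl (pS i) = const (pP i) := transIncl_gen _

theorem transIncl_P4 : transIncl eS = const eP := transIncl_gen _

theorem translationHom_coords :
    (fun i => translationHom (pT i)) = pP ∧ translationHom eT = eP :=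
  ⟨funext fun _ => translationHom_gen _, translationHom_gen _⟩

theorem transIncl_Xi : transIncl xS = ofPS (Xi pP eP) := by
  rw [transIncl, coeffwise_ofPS, map_Xi, translationHom_coords.1, translationHom_coords.2]

theorem transIncl_XiInv : transIncl yS = ofPS (XiInv pP eP) := by
  rw [transIncl, coeffwise_ofPS, map_XiInv, translationHom_coords.1, translationHom_coords.2]

theorem transIncl_hPXiInv (i : Fin 3) :
    transIncl (ofPS (hPXiInv pT eT i)) = ofPS (hPXiInv pP eP i) := by
  rw [transIncl, coeffwise_ofPS, map_hPXiInv, translationHom_coords.1, translationHom_coords.2]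

theorem lorentzIncl_M (i : Fin 3) :
    lorentzIncl (const (gen (Lorentz.M i))) = const (gen (Poincare.M i)) := lorentzIncl_gen _

theorem lorentzIncl_N (i : Fin 3) :
    lorentzIncl (const (gen (Lorentz.N i))) = const (gen (Poincare.N i)) := lorentzIncl_gen _

theorem kappaPoincare_antipode_transIncl (f : Ser UTranslations) :
    kappaPoincare.antipode (transIncl f) = transIncl (transAntipode f) := by
  have h : transIncl f = smashEquiv (tmul 1 f) := by
    rw [smashEquiv_tmul, isAlg_lorentzIncl.one, one_mul]
  change SmashData.antipodeSmash lorentzHopf transHopf kappaCoact lorentzIncl transIncl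
    (smashEquiv.symm (transIncl f)) = _
  rw [h, LinearEquiv.symm_apply_apply, smashData.antipodeSmash_tmul, kappaCoact_one,
    SmashData.antipodeMul_tmul]
  change transIncl (transAntipode f) * (transIncl (transAntipode 1) *
    lorentzIncl (primAntipode Lorentz 1)) = _
  rw [isAlg_transAntipode.one, primAntipode_one, isAlg_transIncl.one, isAlg_lorentzIncl.one,
    mul_one, mul_one]

/-- For f = 1 the antipode is S(L⁽⁻¹⁾) S(L⁽⁰⁾), so antipodes of rotations and boosts can be read off
from their coactions. -/
theorem kappaPoincare_antipode_lorentzIncl (L : Ser ULorentz) :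
    kappaPoincare.antipode (lorentzIncl L) =
      SmashData.antipodeMul lorentzHopf transHopf lorentzIncl transIncl (kappaCoact L) := by
  have h : lorentzIncl L = smashEquiv (tmul L 1) := by
    rw [smashEquiv_tmul, isAlg_transIncl.one, mul_one]
  change SmashData.antipodeSmash lorentzHopf transHopf kappaCoact lorentzIncl transIncl
    (smashEquiv.symm (lorentzIncl L)) = _
  rw [h, LinearEquiv.symm_apply_apply, smashData.antipodeSmash_tmul]
  change transIncl (transAntipode 1) * _ = _
  rw [isAlg_transAntipode.one, isAlg_transIncl.one, one_mul]

theorem antipodeMul_gen (f : Ser UTranslations) (x : Lorentz) :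
    SmashData.antipodeMul lorentzHopf transHopf lorentzIncl transIncl
      (tmul f (const (gen x))) = -(transIncl (transAntipode f) * lorentzIncl (const (gen x))) := by
  rw [SmashData.antipodeMul_tmul]
  change transIncl (transAntipode f) * lorentzIncl (primAntipode Lorentz _) = _
  rw [primAntipode_gen, map_neg, mul_neg]

theorem transAntipode_hPXiInv (i : Fin 3) :
    transAntipode (ofPS (hPXiInv pT eT i)) = -(hSer _ * pS i) := by
  rw [ofPS_hPXiInv, isAlg_transAntipode.mul, isAlg_transAntipode.mul, isAlg_transAntipode.map_hSer,
    transAntipode_P, transAntipode_XiInv]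
  linear_combination -hSer _ * pS i * Xi_mul_XiInv_ser pT eT

theorem isKappaPoincare : IsKappaPoincare kappaPoincare where
  classical := kappaPoincare_classical
  comul_M i := by
    have h := poincareComul_ofLorentz (Lorentz.M i)
    rw [kappaGen, coactGen_M, tmap_tmul, isAlg_transIncl.one, lorentzIncl_M] at h
    exact h
  comul_N i := by
    have h := poincareComul_ofLorentz (Lorentz.N i)
    rw [kappaGen, coactGen_N, map_sub, tmap_tmul, transIncl_XiInv, lorentzIncl_N] at h
    simp only [map_sum, LinearMap.map_smul_of_tower, tmap_tmul, transIncl_hPXiInv,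
      lorentzIncl_M] at h
    exact h.trans (add_sub_assoc _ _ _).symm
  comul_P i := by
    have h := poincareComul_transIncl (pS i)
    rw [transComul_P, map_add, tmap_tmul, tmap_tmul, isAlg_transIncl.one, transIncl_P,
      transIncl_Xi] at h
    exact h
  comul_P4 := by
    have h := poincareComul_transIncl eS
    have h₁ := isKappaTranslations.comul_P4
    change transComul eS = _ at h₁
    rw [h₁, map_add, map_add, tmap_tmul, tmap_tmul, map_sum, transIncl_P4, transIncl_Xi,
      transIncl_XiInv] at h
    simp only [tmap_tmul, transIncl_hPXiInv, transIncl_P] at h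
    exact h
  counit_gen := primCounit_gen
  antipode_M i := by
    rw [← lorentzIncl_M, kappaPoincare_antipode_lorentzIncl, kappaCoact_gen, coactGen_M,
      antipodeMul_gen, isAlg_transAntipode.one, isAlg_transIncl.one, one_mul]
  antipode_N i := by
    -- From β(N_i), the antipode sends Ξ⁻¹ to Ξ and h P_j Ξ⁻¹ to -h P_j, and each Lorentz generator
    -- changes sign once more. So the rotation terms keep the minus sign they had in β(N_i).
    rw [← lorentzIncl_N, kappaPoincare_antipode_lorentzIncl, kappaCoact_gen, coactGen_N, map_sub,
      antipodeMul_gen, transAntipode_XiInv, transIncl_Xi, lorentzIncl_N, ofPS_sub, ofPS_neg,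
      ofPS_mul, ofPS_C]
    congr 1
    simp only [map_sum, LinearMap.map_smul_of_tower, antipodeMul_gen, transAntipode_hPXiInv,
      map_neg, isAlg_transIncl.mul, isAlg_transIncl.map_hSer, transIncl_P, lorentzIncl_M, ofPS_sum,
      ofPS_mul, ofPS_X, ofPS_C, neg_mul, neg_neg, LinearMap.map_smul const, const_mul, mul_assoc,
      mul_smul_comm]
  antipode_P i := by
    rw [← transIncl_P, kappaPoincare_antipode_transIncl, transAntipode_P, map_neg,
      isAlg_transIncl.mul, transIncl_P, transIncl_XiInv, ofPS_neg, ofPS_mul, ofPS_C]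
  antipode_P4 := by
    rw [← transIncl_P4, kappaPoincare_antipode_transIncl, transAntipode_P4, map_add, map_neg,
      isAlg_transIncl.mul, isAlg_transIncl.mul, isAlg_transIncl.map_hSer, transIncl_P4,
      transIncl_XiInv, ofPS_add, ofPS_neg, ofPS_mul, ofPS_mul, ofPS_C, ofPS_C, ofPS_X,
      Fin.sum_univ_three, map_add, map_add, map_add const, map_add const, const_pow, const_pow,
      const_pow, isAlg_transIncl.map_pow, isAlg_transIncl.map_pow, isAlg_transIncl.map_pow,
      transIncl_P, transIncl_P, transIncl_P]

/-- The coproducts of the generators alone determine the structure; counit and antipode values are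
consequences. -/
theorem IsKappaPoincare.eq_kappaPoincare {𝒬 : HopfStr UPoincare} (h : IsKappaPoincare 𝒬) :
    𝒬 = kappaPoincare := by
  refine h.classical.ext kappaPoincare_classical (adjoin_gen_of_span Poincare.span_basisGen)
    fun k => ?_
  rcases k with (i | i) | (i | _)
  · exact (h.comul_M i).trans (isKappaPoincare.comul_M i).symm
  · exact (h.comul_N i).trans (isKappaPoincare.comul_N i).symm
  · exact (h.comul_P i).trans (isKappaPoincare.comul_P i).symm
  · exact h.comul_P4.trans isKappaPoincare.comul_P4.symm

theorem smashEquiv_symm_lorentzIncl (L : Ser ULorentz) :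
    smashEquiv.symm (lorentzIncl L) = tmul L 1 := factor_lorentzIncl L

theorem smashEquiv_symm_transIncl (f : Ser UTranslations) :
    smashEquiv.symm (transIncl f) = tmul 1 f := by
  rw [LinearEquiv.symm_apply_eq, smashEquiv_tmul, isAlg_lorentzIncl.one, one_mul]

end KappaPoincareHopf

end KappaPoincare

end

theorem mainTheorem5 :
    ∃ (ℋ : HopfStr ULorentz) (𝒜 : HopfStr UTranslations)
      (act : Ser (UTranslations ⊗[ℂ] ULorentz) →ₗ[K] Ser UTranslations)
      (β : Ser ULorentz →ₗ[K] Ser (UTranslations ⊗[ℂ] ULorentz))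
      (ℬ : HopfStr (ULorentz ⊗[ℂ] UTranslations))
      (𝒬 : HopfStr UPoincare)
      (Φ : Ser UPoincare ≃ₗ[K] Ser (ULorentz ⊗[ℂ] UTranslations)),
      -- the generator formulas determine the two Hopf algebras, the action and the coaction
      (IsPrimitiveLorentz ℋ ∧ ∀ ℋ', IsPrimitiveLorentz ℋ' → ℋ' = ℋ) ∧
      (IsKappaTranslations 𝒜 ∧ ∀ 𝒜', IsKappaTranslations 𝒜' → 𝒜' = 𝒜) ∧
      (IsClassicalAction ℋ 𝒜 act ∧ ∀ act', IsClassicalAction ℋ 𝒜 act' → act' = act) ∧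
      (HasKappaValues β ∧
        ∀ β', HasKappaValues β' → IsMultiplicativeCoaction ℋ 𝒜 act β' → β' = β) ∧
      -- the comodule coalgebra axioms and Majid's compatibility conditions hold
      IsLeftComoduleCoalgebra ℋ 𝒜 β ∧
      MajidCompatible ℋ 𝒜 act β ∧
      -- the bicrossproduct is a Hopf algebra
      (IsBicrossproduct ℋ 𝒜 act β ℬ ∧ ∀ ℬ', IsBicrossproduct ℋ 𝒜 act β ℬ' → ℬ' = ℬ) ∧
      -- it is the `κ`-Poincaré Hopf algebra, with its generators in the classical basis
      (IsKappaPoincare 𝒬 ∧ ∀ 𝒬', IsKappaPoincare 𝒬' → 𝒬' = 𝒬) ∧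
      IsHopfIso 𝒬 ℬ Φ ∧
      (∀ i : Fin 3, Φ (Ser.const (gen (Poincare.M i))) =
        Ser.const (gen (Lorentz.M i) ⊗ₜ[ℂ] 1)) ∧
      (∀ i : Fin 3, Φ (Ser.const (gen (Poincare.N i))) =
        Ser.const (gen (Lorentz.N i) ⊗ₜ[ℂ] 1)) ∧
      (∀ i : Fin 3, Φ (Ser.const (gen (Poincare.P i))) =
        Ser.const (1 ⊗ₜ[ℂ] gen (Translations.P i))) ∧
      Φ (Ser.const (gen Poincare.P4)) = Ser.const (1 ⊗ₜ[ℂ] gen Translations.P4) := by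
  open Ser in
  -- The bicrossproduct is taken to be the κ-Poincaré structure carried along the factorisation. The
  -- isomorphism property is then automatic, and the content lies in its satisfying the
  -- bicrossproduct formulas.
  refine ⟨lorentzHopf, transHopf, classicalAct, kappaCoact, kappaPoincare.transport smashEquiv,
    kappaPoincare, smashEquiv.symm, ⟨isPrimitiveLorentz, fun _ h => h.eq_lorentzHopf⟩,
    ⟨isKappaTranslations, fun _ h => h.eq_transHopf⟩,
    ⟨isClassicalAction, fun _ h => h.eq_classicalAct⟩,
    ⟨hasKappaValues, fun _ h hm => h.eq_kappaCoact hm⟩, bicrossData.isLeftComoduleCoalgebra,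
    bicrossData.majidCompatible,
    ⟨smashData.isBicrossproduct bicrossData,
      fun _ h => h.unique (smashData.isBicrossproduct bicrossData)⟩,
    ⟨isKappaPoincare, fun _ h => h.eq_kappaPoincare⟩, kappaPoincare.isHopfIso_transport smashEquiv,
    fun i => ?_, fun i => ?_, fun i => ?_, ?_⟩
  · rw [← lorentzIncl_M, smashEquiv_symm_lorentzIncl, ← Ser.tmul_const_const]
    rfl
  · rw [← lorentzIncl_N, smashEquiv_symm_lorentzIncl, ← Ser.tmul_const_const]
    rfl
  · have h := smashEquiv_symm_transIncl (pS i)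
    rw [transIncl_P, ← Ser.const_one, Ser.tmul_const_const] at h
    exact h
  · have h := smashEquiv_symm_transIncl eS
    rw [transIncl_P4, ← Ser.const_one, Ser.tmul_const_const] at h
    exact h
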